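/- Conventions. For a subgroup $H$ of a topological group, $H^n$ denotes the closed subgroup generated by the $n$-th powers of elements of $H$. A pro-$p$ group $H$ is \emph{uniform} if it is topologically finitely generated, $H/H^p$ is abelian ($H/H^4$ if $p=2$), and for every $i\ge 0$ the map $x\mapsto x^p$ induces an isomorphism $H^{p^i}/H^{p^{i+1}}\to H^{p^{i+1}}/H^{p^{i+2}}$. A topological group is a \emph{$p$-adic Lie group} if it has an open uniform subgroup; a \emph{Lie filtration} of $G$ is a family $G(i)=H^{p^i}$ $(i\ge 0)$ for an open normal uniform subgroup $H$ of $G$. For a Galois extension with group $G$, a \emph{$p$-adic Lie tower} is the tower of fixed fields of a Lie filtration of $G$. $G^v$ ($v\ge -1$) denotes the ramification groups in upper numbering, for infinite extensions the inverse limit of those of the finite Galois subextensions. $\mathfrak D$ and $\mathfrak d=N(\mathfrak D)$ denote the different and the discriminant, and $v_F$ the normalized valuation of $F$. A tower $(F(i))_i$ over $F$ is \emph{stable} if there is $f\in\mathbb Q[x,y]$ with $v_F(\mathfrak d_{F(i)/F})=f(i,p^i)$ for all sufficiently large $i$. Proposition. Let $p$ be a prime, $K$ a nonarchimedean local field of characteristic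 $0$ with residue characteristic $p$, and $L/K$ a Galois extension inside an algebraic closure $\overline K$ whose group $G=\mathrm{Gal}(L/K)$ is a $p$-adic Lie group. Fix a Lie filtration $G(i)$ of $G$ and let $K(i)=L^{G(i)}$. Let $K^{\mathrm{unr}}$ be the maximal unramified extension of $K$ in $\overline K$, and put $$K'=\widehat{K^{\mathrm{unr}}},\qquad K(i)'=\widehat{K(i)K^{\mathrm{unr}}},\qquad L'=\bigcup_i K(i)',$$ where the hat denotes completion (all inside the completion of $\overline K$). Then each $K(i)'/K'$ is finite, Galois and totally ramified, $L'/K'$ is Galois, and with $G'=\mathrm{Gal}(L'/K')$: (i) There is an isomorphism of topological groups $\varphi:G^0\to G'$ preserving ramification groups, that is, $(G')^v=\varphi(G^v\cap G^0)$ for all real $v\ge -1$ (here $G^v\subseteq G^0$ as soon as $v>-1$). (ii) $G'$ is a $p$-adic Lie group, and there is a fixed $k\ge 0$ such that $G(i)'=\mathrm{Gal}(L'/K(k+i)')$ $(i\ge 0)$ is a Lie filtration of $G'$. Thus the $K(k+i)'$ form a $p$-adic Lie tower over $K'$. (iii) For all $i$, $v_{K(i)}(\mathfrak D_{K(i)/K})=v_{K(i)'}(\mathfrak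 D_{K(i)'/K'})$. In particular, for $k$ as in (ii), if the tower $(K(k+i)')_i$ over $K'$ is stable, then so is the tower $(K(i))_i$ over $K$. -/

import Mathlib

noncomputable section

namespace LieTower

open UniformSpace Filter

/-! ### Uniform pro-`p` groups, `p`-adic Lie groups and Lie filtrations -/

section Groups

variable {G : Type*} [Group G] [TopologicalSpace G] [IsTopologicalGroup G]

/-- `H ^ n` for a subgroup `H` of a topological group: the closed subgroup generated by the
`n`-th powers of the elements of `H`. -/
def powSubgroup (H : Subgroup G) (n : ℕ) : Subgroup G :=
  (Subgroup.closure ((fun x : G => x ^ n) '' (H : Set G))).topologicalClosure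

/-- A pro-`p` group: a profinite group all of whose open normal subgroups have index a power
of `p`. -/
structure IsProP (p : ℕ) (H : Type*) [Group H] [TopologicalSpace H] : Prop where
  compact : CompactSpace H
  t2 : T2Space H
  totallyDisconnected : TotallyDisconnectedSpace H
  index_eq : ∀ U : Subgroup H, U.Normal → IsOpen (U : Set H) → ∃ n : ℕ, U.index = p ^ n

/-- The subgroup `H` of the topological group `G` is a uniform pro-`p` group. -/
structure IsUniform (p : ℕ) (H : Subgroup G) : Prop where
  isProP : IsProP p H
  /-- `H` is topologically finitely generated. -/
  fg : ∃ S : Finset G, (S : Set G) ⊆ H ∧ (H : Set G) ⊆ closure (Subgroup.closure (S : Set G) : Set G)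
  /-- `H / H ^ p` is abelian (`H / H ^ 4` if `p = 2`). -/
  commutator_le : ∀ x ∈ H, ∀ y ∈ H, x * y * x⁻¹ * y⁻¹ ∈ powSubgroup H (if p = 2 then 4 else p)
  /-- For every `i`, `x ↦ x ^ p` maps `H ^ (p ^ i)` to `H ^ (p ^ (i + 1))`, ... -/
  pow_mem : ∀ i, ∀ x ∈ powSubgroup H (p ^ i), x ^ p ∈ powSubgroup H (p ^ (i + 1))
  /-- ... is a homomorphism modulo `H ^ (p ^ (i + 2))`, ... -/
  pow_mul : ∀ i, ∀ x ∈ powSubgroup H (p ^ i), ∀ y ∈ powSubgroup H (p ^ i),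
    ((x * y) ^ p)⁻¹ * (x ^ p * y ^ p) ∈ powSubgroup H (p ^ (i + 2))
  /-- ... whose kernel is exactly `H ^ (p ^ (i + 1))`, ... -/
  pow_ker : ∀ i, ∀ x ∈ powSubgroup H (p ^ i),
    x ^ p ∈ powSubgroup H (p ^ (i + 2)) ↔ x ∈ powSubgroup H (p ^ (i + 1))
  /-- ... and is surjective, so that it induces an isomorphism from
  `H ^ (p ^ i) / H ^ (p ^ (i + 1))` to `H ^ (p ^ (i + 1)) / H ^ (p ^ (i + 2))`. -/
  pow_surj : ∀ i, ∀ y ∈ powSubgroup H (p ^ (i + 1)), ∃ x ∈ powSubgroup H (p ^ i),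
    (x ^ p)⁻¹ * y ∈ powSubgroup H (p ^ (i + 2))

variable (G) in
/-- A `p`-adic Lie group: a topological group with an open uniform subgroup. -/
def IsPadicLieGroup (p : ℕ) : Prop :=
  ∃ H : Subgroup G, IsOpen (H : Set G) ∧ IsUniform p H

/-- A Lie filtration of `G`: the groups `H ^ (p ^ i)`, for an open normal uniform subgroup `H`. -/
def IsLieFiltration (p : ℕ) (Γ : ℕ → Subgroup G) : Prop :=
  ∃ H : Subgroup G, IsOpen (H : Set G) ∧ H.Normal ∧ IsUniform p H ∧
    ∀ i, Γ i = powSubgroup H (p ^ i)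

/-- A `p`-adic Lie tower in `L / k`: the fixed fields of a Lie filtration of `Gal(L/k)`. -/
def IsPadicLieTower (p : ℕ) {k L : Type*} [Field k] [Field L] [Algebra k L]
    (F : ℕ → IntermediateField k L) : Prop :=
  ∃ Γ : ℕ → Subgroup Gal(L/k), IsLieFiltration p Γ ∧
    ∀ i, F i = IntermediateField.fixedField (Γ i)

end Groups

/-! ### Ramification groups, different and discriminant

Everything below is used for a complete discretely valued field `k` and algebraic extensions
`F / k`. The ring of integers of `F` is then a local ring, so that its Jacobson radical is its
maximal ideal. -/

section Ramification

/-- The ideal of non-units of a local ring, as the intersection of all maximal ideals. -/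
def maxIdeal (R : Type*) [CommRing R] : Ideal R := Ideal.jacobson ⊥

/-- The normalized valuation of an ideal of a discrete valuation ring: the exponent of the largest
power of the maximal ideal dividing it. -/
def idealVal {R : Type*} [CommRing R] (I : Ideal R) : ℕ∞ := emultiplicity (maxIdeal R) I

variable (k F : Type*) [NormedField k] [IsUltrametricDist k] [Field F] [Algebra k F]

/-- The ring of integers `{x | ‖x‖ ≤ 1}` of a nonarchimedean normed field. -/
abbrev baseInt : ValuationSubring k := (NormedField.valuation (K := k)).valuationSubring

/-- The ring of integers of an algebraic extension: the integral closure. -/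
abbrev extInt : Subalgebra (baseInt k) F := integralClosure (baseInt k) F

/-- The lower ramification group `G_r`, for real `r ≥ -1`: all `σ` with
`v_F (σ x - x) ≥ r + 1` for all integral `x`. -/
def lowerRam (r : ℝ) : Subgroup Gal(F/k) :=
  Ideal.inertia Gal(F/k) (maxIdeal (extInt k F) ^ ⌈r + 1⌉₊)

/-- The Herbrand function `φ` of a finite Galois extension. -/
def herbrandPhi (r : ℝ) : ℝ :=
  if 0 ≤ r then ∫ w in (0 : ℝ)..r, (((lowerRam k F w).relIndex (lowerRam k F 0) : ℕ) : ℝ)⁻¹ else r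

/-- The inverse `ψ` of the Herbrand function on `[-1, ∞)`. -/
def herbrandPsi : ℝ → ℝ := Function.invFunOn (herbrandPhi k F) (Set.Ici (-1))

/-- The upper ramification group of a finite Galois extension. -/
def finUpperRam (v : ℝ) : Subgroup Gal(F/k) := lowerRam k F (herbrandPsi k F v)

/-- The upper ramification group `Gal(F/k)^v` of a Galois extension: the inverse limit of the
`Gal(E/k)^v` over the finite Galois subextensions `E / k`, as a subgroup of `Gal(F/k)`. -/
def upperRam (v : ℝ) : Subgroup Gal(F/k) :=
  ⨅ (E : IntermediateField k F) (_ : FiniteDimensional k E) (_ : IsGalois k E),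
    (finUpperRam k E v).comap (AlgEquiv.restrictNormalHom E)

/-- The different of a finite extension: the inverse of the fractional ideal of all `y : F` with
`Tr (y O_F) ⊆ O_k`. -/
def different : Ideal (extInt k F) where
  carrier := {x | ∀ y : F, (∀ z : extInt k F, Algebra.trace k F (y * z) ∈ baseInt k) →
    (x : F) * y ∈ extInt k F}
  zero_mem' := fun y _ => by simp
  add_mem' := fun {a b} ha hb y hy => by
    have := add_mem (ha y hy) (hb y hy)
    simpa [add_mul] using this
  smul_mem' := fun c x hx y hy => by
    have := mul_mem c.2 (hx y hy)
    simpa [mul_assoc] using this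

/-- The discriminant of a finite extension: the norm of the different, that is, the ideal
generated by the norms of its elements. -/
def discriminant : Ideal (baseInt k) :=
  Ideal.span {a | ∃ x ∈ different k F, (a : k) = Algebra.norm k (x : F)}

variable {F} in
/-- A tower of extensions `F i` of `k` is `p`-stable: for large `i`, the valuation of the
discriminant of `F i / k` is a fixed rational polynomial in `i` and `p ^ i`. -/
def IsStable (p : ℕ) (E : ℕ → IntermediateField k F) : Prop :=
  ∃ f : MvPolynomial (Fin 2) ℚ, ∀ᶠ i : ℕ in atTop, ∃ n : ℕ,
    idealVal (discriminant k (E i)) = n ∧ (n : ℚ) = MvPolynomial.eval ![(i : ℚ), (p : ℚ) ^ i] f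

end Ramification

/-! ### Completed maximal unramified extensions -/

section Unramified

variable (K : Type*) [NontriviallyNormedField K] [IsUltrametricDist K]
  (Ω : Type*) [NormedField Ω] [NormedAlgebra K Ω]

/-- The maximal unramified extension of `K` in an algebraic closure `Ω`: the compositum of the
finite Galois extensions with trivial inertia group. -/
def maxUnr : IntermediateField K Ω :=
  ⨆ (F : IntermediateField K Ω) (_ : FiniteDimensional K F) (_ : IsGalois K F)
    (_ : lowerRam K F 0 = ⊥), F

/-- The completion of a subfield of `Ω`: its closure in the completion of `Ω`. -/
def hat {K Ω : Type*} [NontriviallyNormedField K] [NormedField Ω] [NormedAlgebra K Ω]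
    (F : IntermediateField K Ω) : Subfield (Completion Ω) :=
  (F.toSubfield.map (algebraMap Ω (Completion Ω))).topologicalClosure

/-- `K'`, the completion of the maximal unramified extension. -/
def unrHat : Subfield (Completion Ω) := hat (maxUnr K Ω)

instance : IsUltrametricDist (unrHat K Ω) :=
  haveI : IsUltrametricDist (Completion Ω) := IsUltrametricDist.of_normedAlgebra K
  IsUltrametricDist.subtype _

variable {K Ω}

lemma unrHat_le (F : IntermediateField K Ω) : unrHat K Ω ≤ hat (F ⊔ maxUnr K Ω) :=
  closure_mono (Set.image_mono (le_sup_right : maxUnr K Ω ≤ F ⊔ maxUnr K Ω))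

/-- `F'`, the completion of `F K^unr`, as an extension of `K'`. -/
def extHat (F : IntermediateField K Ω) : IntermediateField (unrHat K Ω) (Completion Ω) :=
  Subfield.extendScalars (unrHat_le F)

/-- `L' = ⋃ i, K(i)'` for a tower `K(i)`. -/
def towerHat (F : ℕ → IntermediateField K Ω) : IntermediateField (unrHat K Ω) (Completion Ω) :=
  ⨆ i, extHat (F i)

/-- `K(i)'` as a subextension of `L' / K'`. -/
def stepHat (F : ℕ → IntermediateField K Ω) (i : ℕ) : IntermediateField (unrHat K Ω) (towerHat F) :=
  IntermediateField.restrict (le_iSup (fun j => extHat (F j)) i : extHat (F i) ≤ towerHat F)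

/-- The tower `K(i)`, as subfields of `Ω`, of the fixed fields of subgroups of `Gal(L/K)`. -/
def tower {L : IntermediateField K Ω} (Γ : ℕ → Subgroup Gal(L/K)) (i : ℕ) :
    IntermediateField K Ω :=
  IntermediateField.lift (IntermediateField.fixedField (Γ i))

end Unramified

end LieTower

end

open LieTower

/-!
Passage from `K` to the completion `K'` of its maximal unramified extension replaces the Galois
group `G` of `L / K` by its inertia group `G^0` and changes nothing else: ramification only sees
inertia.

Restriction gives a continuous homomorphism `ρ : Gal(L'/K') → Gal(L/K)` (`baseChangeRes`), which
is injective because `L` and `K'` generate `L'`, and whose image is the Galois group over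
`L ∩ K'`. By Krasner's argument `L ∩ K'` is the maximal unramified subextension
(`mem_maxUnr_of_coe_mem`), and Teichmüller representatives show that an automorphism of `L` acts
trivially on it if and only if it acts trivially on the residue field (`apply_eq_of_mem_inf`). So
the image is `G^0`. As `K'` has the residue field of the algebraic closure and the same value
group as `K`, every finite layer becomes totally ramified and keeps its uniformizers
(`IsUnrBaseChange`). In a totally ramified extension the lower ramification groups can be tested
on one uniformizer, so they correspond under `ρ`, and with them the Herbrand functions and the
upper ramification groups (`IsUnrBaseChange.finUpperRam_eq`). For the infinite extension, the
definition of `Gal(L'/K')^v` also involves finite layers of `L' / K'` which are not generated by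
layers of `L / K`; Herbrand's theorem (`IsResTrivial.restrict_mem_finUpperRam`) reduces these to
larger ones which are.

For the Lie filtration `Γ i = H ^ (p ^ i)`, the quotient `G / G^0` acts faithfully on residue
fields and is therefore procyclic. The sections of `i ↦ G^0 Γ i` are generated by one element
`g ^ (p ^ i)`, so from some index on they are all trivial, or else all of them have order `p`. In both
cases `p`-th powers remain surjective on the sections of `G^0 ∩ Γ i` for large `i`, which makes
`i ↦ G^0 ∩ Γ (k + i)` again a filtration by powers of a uniform group
(`IsPowFiltration.exists_surj_of_procyclic`, `IsPowFiltration.comap`,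
`IsPowFiltration.isLieFiltration`).

For the differents, the trace of `K(i)' / K'` restricted to `K(i)` is the sum over the inertia
group. That integrality of traces to `K` and of such inertia sums are equivalent
(`memCodiff_iff_inertia`) expresses that the different of the unramified part is trivial. It is
proved without the inertia field, from the independence of the characters of the residue field.
The discriminant exponents then differ by the residue degree, the index of `G^0 Γ i`, which by the
dichotomy above is eventually constant or eventually proportional to `p ^ i`; both preserve
stability (`IsStable.of_mul`).
-/

noncomputable section

namespace LieTower

open UniformSpace Filter

/-! ### Filtrations of power type -/

section PowFiltration

variable {X : Type*} [Group X] [TopologicalSpace X]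

/-- The properties of the filtration `i ↦ H ^ (p ^ i)` by powers of an open normal uniform subgroup
`H`, for an abstract decreasing sequence of open normal subgroups with trivial intersection. -/
structure IsPowFiltration (p : ℕ) (Q : ℕ → Subgroup X) : Prop where
  normal : ∀ i, (Q i).Normal
  isOpen : ∀ i, IsOpen (Q i : Set X)
  succ_le : ∀ i, Q (i + 1) ≤ Q i
  inter : ∀ x, (∀ i, x ∈ Q i) → x = 1
  commutator : ∀ x ∈ Q 0, ∀ y ∈ Q 0, x * y * x⁻¹ * y⁻¹ ∈ Q (if p = 2 then 2 else 1)
  pow_mem : ∀ i, ∀ x ∈ Q i, x ^ p ∈ Q (i + 1)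
  pow_mul : ∀ i, ∀ x ∈ Q i, ∀ y ∈ Q i, ((x * y) ^ p)⁻¹ * (x ^ p * y ^ p) ∈ Q (i + 2)
  pow_ker : ∀ i, ∀ x ∈ Q i, x ^ p ∈ Q (i + 2) → x ∈ Q (i + 1)
  pow_surj : ∀ i, ∀ y ∈ Q (i + 1), ∃ x ∈ Q i, (x ^ p)⁻¹ * y ∈ Q (i + 2)

namespace IsPowFiltration

variable {p : ℕ} {Q : ℕ → Subgroup X} (hQ : IsPowFiltration p Q)
include hQ

lemma antitone : Antitone Q := antitone_nat_of_succ_le hQ.succ_le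

lemma pow_pow_mem {i : ℕ} {x : X} (hx : x ∈ Q i) (j : ℕ) : x ^ p ^ j ∈ Q (i + j) := by
  induction j with
  | zero => simpa using hx
  | succ j ih =>
    rw [pow_succ, _root_.pow_mul]
    exact hQ.pow_mem _ _ ih

/-- Taking powers is compatible with congruences. -/
lemma pow_mul_congr {i : ℕ} {x z : X} (hx : x ∈ Q i) (hz : z ∈ Q (i + 1)) (j : ℕ) :
    (x ^ p ^ j)⁻¹ * (x * z) ^ p ^ j ∈ Q (i + j + 1) := by
  induction j with
  | zero => simpa using hz
  | succ j ih =>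
    have h1 := hQ.pow_mul _ _ (hQ.pow_pow_mem hx j) _ (hQ.antitone (by omega) ih)
    have h2 := hQ.pow_mem _ _ ih
    rw [mul_inv_cancel_left] at h1
    have := hQ.normal (i + (j + 1) + 1)
    have h3 := mul_mem h2 ((Subgroup.inv_mem_iff _).2 h1)
    rw [pow_succ, _root_.pow_mul, _root_.pow_mul]
    have e : ((x ^ p ^ j) ^ p)⁻¹ * ((x * z) ^ p ^ j) ^ p =
      ((x ^ p ^ j)⁻¹ * (x * z) ^ p ^ j) ^ p *
        ((((x * z) ^ p ^ j) ^ p)⁻¹ * ((x ^ p ^ j) ^ p * ((x ^ p ^ j)⁻¹ * (x * z) ^ p ^ j) ^ p))⁻¹ := by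
      group
    rw [e]
    exact h3

/-- `p ^ j`-th powers are surjective from the sections of the filtration at `i` to those at `i + j`. -/
lemma exists_pow_congr (i j : ℕ) {y : X} (hy : y ∈ Q (i + j)) :
    ∃ x ∈ Q i, (x ^ p ^ j)⁻¹ * y ∈ Q (i + j + 1) := by
  induction j generalizing y with
  | zero => exact ⟨y, hy, by simp [one_mem]⟩
  | succ j ih =>
    obtain ⟨w, hw, hwy⟩ := hQ.pow_surj _ _ hy
    obtain ⟨x, hx, hxw⟩ := ih hw
    refine ⟨x, hx, ?_⟩
    have h1 := hQ.pow_mul_congr (hQ.pow_pow_mem hx j) hxw 1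
    rw [mul_inv_cancel_left, pow_one] at h1
    have h2 := mul_mem h1 hwy
    rw [mul_assoc, mul_inv_cancel_left, ← _root_.pow_mul, ← pow_succ] at h2
    exact h2

variable [IsTopologicalGroup X]

lemma isClosed (i : ℕ) : IsClosed (Q i : Set X) := (Q i).isClosed_of_isOpen (hQ.isOpen i)

variable [CompactSpace X]

lemma exists_le {U : Set X} (hU : U ∈ nhds (1 : X)) : ∃ i, (Q i : Set X) ⊆ U := by
  refine exists_subset_nhds_of_compactSpace (V := fun i => (Q i : Set X)) ?_ hQ.isClosed ?_
  · exact directed_of_isDirected_le fun i j hij => hQ.antitone hij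
  · intro x hx
    rw [hQ.inter x fun i => Set.mem_iInter.1 hx i]
    exact hU

/-- A closed subgroup which covers all sections `Q m / Q (m + 1)` beyond `m₀` contains `Q m₀`. -/
lemma le_of_isClosed {T : Subgroup X} (hT : IsClosed (T : Set X)) {m₀ : ℕ}
    (h : ∀ m, m₀ ≤ m → ∀ y ∈ Q m, ∃ t ∈ T, t⁻¹ * y ∈ Q (m + 1)) : Q m₀ ≤ T := by
  intro y hy
  have key : ∀ n, ∃ t ∈ T, t⁻¹ * y ∈ Q (m₀ + n) := by
    intro n
    induction n with
    | zero => exact ⟨1, one_mem _, by simpa using hy⟩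
    | succ n ih =>
      obtain ⟨t, ht, hty⟩ := ih
      obtain ⟨s, hs, hsy⟩ := h _ (by omega) _ hty
      refine ⟨t * s, mul_mem ht hs, ?_⟩
      rwa [mul_inv_rev, mul_assoc]
  have : y ∈ closure (T : Set X) := by
    rw [mem_closure_iff_nhds]
    intro U hU
    have hU' : (fun z => y * z⁻¹) ⁻¹' U ∈ nhds (1 : X) := by
      apply ContinuousAt.preimage_mem_nhds (by fun_prop)
      simpa using hU
    obtain ⟨n, hn⟩ := hQ.exists_le hU'
    obtain ⟨t, ht, hty⟩ := key n
    refine ⟨t, ?_, ht⟩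
    have := hn (hQ.antitone (Nat.le_add_left n m₀) hty)
    simpa using this
  rwa [hT.closure_eq] at this

lemma powSubgroup_eq (j : ℕ) : powSubgroup (Q 0) (p ^ j) = Q j := by
  apply le_antisymm
  · refine Subgroup.topologicalClosure_minimal _ ?_ (hQ.isClosed j)
    rw [Subgroup.closure_le]
    rintro _ ⟨x, hx, rfl⟩
    simpa using hQ.pow_pow_mem hx j
  · refine hQ.le_of_isClosed (Subgroup.isClosed_topologicalClosure _) fun m hm y hy => ?_
    obtain ⟨l, rfl⟩ := Nat.exists_eq_add_of_le' hm
    obtain ⟨x, hx, hxy⟩ := hQ.exists_pow_congr l j hy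
    exact ⟨_, Subgroup.le_topologicalClosure _ (Subgroup.subset_closure
      ⟨x, hQ.antitone (Nat.zero_le l) hx, rfl⟩), hxy⟩

variable [T2Space X] [TotallyDisconnectedSpace X] [Fact p.Prime]

lemma isProP : IsProP p (Q 0) where
  compact := isCompact_iff_compactSpace.1 (hQ.isClosed 0).isCompact
  t2 := inferInstance
  totallyDisconnected := inferInstance
  index_eq U hU hUo := by
    have := isCompact_iff_compactSpace.1 (hQ.isClosed 0).isCompact
    have hfin : Finite (Q 0 ⧸ U) := U.quotient_finite_of_isOpen hUo
    obtain ⟨n, hn⟩ : ∃ n, (Q n).subgroupOf (Q 0) ≤ U := by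
      obtain ⟨V, hV, hVU⟩ := isOpen_induced_iff.1 hUo
      have : V ∈ nhds (1 : X) := hV.mem_nhds (by
        have : (1 : Q 0) ∈ ((↑) : Q 0 → X) ⁻¹' V := by rw [hVU]; exact one_mem U
        exact this)
      obtain ⟨n, hn⟩ := hQ.exists_le this
      refine ⟨n, fun x hx => ?_⟩
      have : x ∈ ((↑) : Q 0 → X) ⁻¹' V := hn hx
      rwa [hVU] at this
    have hp : IsPGroup p (Q 0 ⧸ U) := by
      rw [isPGroup_iff_pow_pow_eq_one]
      intro g
      obtain ⟨x, rfl⟩ := QuotientGroup.mk_surjective g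
      refine ⟨n, ?_⟩
      rw [← QuotientGroup.mk_pow, QuotientGroup.eq_one_iff]
      apply hn
      rw [Subgroup.mem_subgroupOf]
      simpa using hQ.pow_pow_mem x.2 n
    exact IsPGroup.iff_card.1 hp

/-- The groups of a filtration of power type are the iterated powers of a uniform group. -/
theorem isUniform : IsUniform p (Q 0) where
  isProP := hQ.isProP
  fg := by
    classical
    have hfin : Finite (X ⧸ Q 1) := (Q 1).quotient_finite_of_isOpen (hQ.isOpen 1)
    let A : Set (X ⧸ Q 1) := QuotientGroup.mk '' (Q 0 : Set X)
    obtain ⟨S, hSQ, hSf, hSA⟩ : ∃ S ⊆ (Q 0 : Set X), S.Finite ∧ QuotientGroup.mk '' S = A := by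
      have h1 : ∀ a : A, ∃ x ∈ Q 0, (QuotientGroup.mk x : X ⧸ Q 1) = a := fun a => a.2
      choose f hf hfa using h1
      refine ⟨Set.range f, by rintro _ ⟨a, rfl⟩; exact hf a, Set.finite_range f, ?_⟩
      ext a
      constructor
      · rintro ⟨_, ⟨b, rfl⟩, rfl⟩
        rw [hfa]; exact b.2
      · intro ha
        exact ⟨f ⟨a, ha⟩, ⟨_, rfl⟩, hfa ⟨a, ha⟩⟩
    refine ⟨hSf.toFinset, by simpa using hSQ, ?_⟩
    have h2 : Q 0 ≤ (Subgroup.closure S).topologicalClosure := by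
      refine hQ.le_of_isClosed (Subgroup.isClosed_topologicalClosure _) fun m _ y hy => ?_
      obtain ⟨x, hx, hxy⟩ := hQ.exists_pow_congr 0 m (by simpa using hy)
      have hxA : (QuotientGroup.mk x : X ⧸ Q 1) ∈ A := ⟨x, hx, rfl⟩
      rw [← hSA] at hxA
      obtain ⟨s, hs, hsx⟩ := hxA
      refine ⟨s ^ p ^ m, Subgroup.le_topologicalClosure _ (_root_.pow_mem
        (Subgroup.subset_closure hs) _), ?_⟩
      have h3 := hQ.pow_mul_congr (hSQ hs) (QuotientGroup.eq.1 hsx) m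
      rw [mul_inv_cancel_left] at h3
      have h4 := mul_mem h3 hxy
      rw [mul_assoc, mul_inv_cancel_left] at h4
      simpa using h4
    rw [hSf.coe_toFinset]
    exact h2
  commutator_le := by
    intro x hx y hy
    have h := hQ.commutator x hx y hy
    split_ifs at h ⊢ with h2
    · have := hQ.powSubgroup_eq 2
      rw [h2] at this
      rwa [← this] at h
    · have := hQ.powSubgroup_eq 1
      rw [pow_one] at this
      rwa [this]
  pow_mem := by simpa only [hQ.powSubgroup_eq] using hQ.pow_mem
  pow_mul := by simpa only [hQ.powSubgroup_eq] using hQ.pow_mul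
  pow_ker := by
    simp only [hQ.powSubgroup_eq]
    exact fun i x hx => ⟨hQ.pow_ker i x hx, fun h => hQ.pow_mem _ _ h⟩
  pow_surj := by simpa only [hQ.powSubgroup_eq] using hQ.pow_surj

theorem isLieFiltration : IsLieFiltration p Q :=
  ⟨Q 0, hQ.isOpen 0, hQ.normal 0, hQ.isUniform, fun i => (hQ.powSubgroup_eq i).symm⟩

end IsPowFiltration

end PowFiltration

section Uniform

variable {G : Type*} [Group G] [TopologicalSpace G] [IsTopologicalGroup G]

lemma isClosed_powSubgroup (H : Subgroup G) (n : ℕ) : IsClosed (powSubgroup H n : Set G) :=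
  Subgroup.isClosed_topologicalClosure _

lemma pow_mem_powSubgroup {H : Subgroup G} {x : G} (hx : x ∈ H) (n : ℕ) :
    x ^ n ∈ powSubgroup H n :=
  Subgroup.le_topologicalClosure _ (Subgroup.subset_closure ⟨x, hx, rfl⟩)

lemma powSubgroup_le {H T : Subgroup G} (hT : IsClosed (T : Set G)) {n : ℕ}
    (h : ∀ x ∈ H, x ^ n ∈ T) : powSubgroup H n ≤ T := by
  refine Subgroup.topologicalClosure_minimal _ ?_ hT
  rw [Subgroup.closure_le]
  rintro _ ⟨x, hx, rfl⟩
  exact h x hx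

lemma powSubgroup_mul_le (H : Subgroup G) (m n : ℕ) : powSubgroup H (m * n) ≤ powSubgroup H n :=
  powSubgroup_le (isClosed_powSubgroup _ _) fun x hx => by
    rw [pow_mul]
    exact pow_mem_powSubgroup (pow_mem hx m) n

lemma powSubgroup_one {H : Subgroup G} (hH : IsClosed (H : Set G)) : powSubgroup H 1 = H :=
  le_antisymm (powSubgroup_le hH fun x hx => by simpa using hx) fun x hx => by
    simpa using pow_mem_powSubgroup hx 1

lemma powSubgroup_normal (H : Subgroup G) [hH : H.Normal] (n : ℕ) : (powSubgroup H n).Normal := by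
  have : (Subgroup.closure ((fun x : G => x ^ n) '' (H : Set G))).Normal := by
    refine ⟨fun x hx g => ?_⟩
    induction hx using Subgroup.closure_induction with
    | mem x hx =>
      obtain ⟨y, hy, rfl⟩ := hx
      exact Subgroup.subset_closure ⟨g * y * g⁻¹, hH.conj_mem y hy g, by simp [conj_pow]⟩
    | one => simp [one_mem]
    | mul x y _ _ hx hy =>
      have := mul_mem hx hy
      rwa [show g * x * g⁻¹ * (g * y * g⁻¹) = g * (x * y) * g⁻¹ by group] at this
    | inv x _ hx =>
      have := inv_mem hx
      rwa [show (g * x * g⁻¹)⁻¹ = g * x⁻¹ * g⁻¹ by group] at this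
  exact Subgroup.is_normal_topologicalClosure _

/-- The exponent `ε` such that `H / H ^ (p ^ ε)` is required to be abelian for a uniform group
`H`. -/
def commExp (p : ℕ) : ℕ := if p = 2 then 2 else 1

lemma pow_commExp (p : ℕ) : p ^ commExp p = if p = 2 then 4 else p := by
  unfold commExp
  split_ifs with h
  · rw [h]; norm_num
  · simp

lemma one_le_commExp (p : ℕ) : 1 ≤ commExp p := by
  unfold commExp; split_ifs <;> norm_num

variable [CompactSpace G] {p : ℕ} [Fact p.Prime] {H : Subgroup G}

lemma relIndex_ne_zero_of_isOpen {A B : Subgroup G} (hA : IsOpen (A : Set G)) :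
    A.relIndex B ≠ 0 := by
  have : Finite (G ⧸ A) := A.quotient_finite_of_isOpen hA
  have := A.finiteIndex_of_finite_quotient
  exact Subgroup.FiniteIndex.index_ne_zero

lemma isOpen_of_relIndex_ne_zero {A B : Subgroup G} (hA : IsClosed (A : Set G))
    (hB : IsOpen (B : Set G)) (h : A.relIndex B ≠ 0) (hAB : A ≤ B) : IsOpen (A : Set G) := by
  have h1 : A.index ≠ 0 := by
    rw [← Subgroup.relIndex_mul_index hAB]
    refine mul_ne_zero h ?_
    have := relIndex_ne_zero_of_isOpen (B := ⊤) hB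
    rwa [Subgroup.relIndex_top_right] at this
  have : A.FiniteIndex := ⟨h1⟩
  exact A.isOpen_of_isClosed_of_finiteIndex hA

/-- An abelian quotient of finite exponent of a topologically finitely generated group by a closed
subgroup is finite. -/
lemma isOpen_of_fg {N : Subgroup G} [N.Normal] (hN : IsClosed (N : Set G)) (hNH : N ≤ H)
    (hH : IsOpen (H : Set G)) (S : Finset G) (hSH : (S : Set G) ⊆ H)
    (hS : (H : Set G) ⊆ closure (Subgroup.closure (S : Set G) : Set G))
    (hcomm : ∀ x ∈ H, ∀ y ∈ H, x * y * x⁻¹ * y⁻¹ ∈ N) {n : ℕ} (hn : 0 < n)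
    (hpow : ∀ x ∈ H, x ^ n ∈ N) : IsOpen (N : Set G) := by
  have hcH : Subgroup.closure (S : Set G) ≤ H := (Subgroup.closure_le _).2 hSH
  let f := QuotientGroup.mk' N
  let A : Subgroup (G ⧸ N) := (Subgroup.closure (S : Set G)).map f
  have hAc : ∀ x ∈ f '' (S : Set G), ∀ y ∈ f '' (S : Set G), x * y = y * x := by
    rintro _ ⟨x, hx, rfl⟩ _ ⟨y, hy, rfl⟩
    have := (QuotientGroup.eq_one_iff (N := N) _).2 (hcomm x (hSH hx) y (hSH hy))
    change f _ = 1 at this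
    rw [map_mul, map_mul, map_mul, map_inv, map_inv, mul_inv_eq_one, mul_inv_eq_iff_eq_mul] at this
    exact this
  have hA : A = Subgroup.closure (f '' (S : Set G)) := by rw [← MonoidHom.map_closure]
  have hAf : Finite A := by
    rw [hA]
    have hc := Subgroup.isMulCommutative_closure hAc
    let _ : CommGroup (Subgroup.closure (f '' (S : Set G))) :=
      { (inferInstance : Group (Subgroup.closure (f '' (S : Set G)))) with
        mul_comm := hc.is_comm.comm }
    have : Group.FG (Subgroup.closure (f '' (S : Set G))) := by
      classical
      rw [← Finset.coe_image]
      infer_instance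
    refine CommGroup.finite_of_fg_isMulTorsion _ fun x => ?_
    rw [isOfFinOrder_iff_pow_eq_one]
    refine ⟨n, hn, ?_⟩
    have hx : (x : G ⧸ N) ∈ A := by rw [hA]; exact x.2
    obtain ⟨y, hy, hyx⟩ := hx
    apply Subtype.ext
    change (x : G ⧸ N) ^ n = 1
    rw [← hyx, ← map_pow]
    exact (QuotientGroup.eq_one_iff _).2 (hpow y (hcH hy))
  have : IsClosed (N : Set G) := hN
  have hAcl : IsClosed (A : Set (G ⧸ N)) := (Set.toFinite _).isClosed
  have hHA : H ≤ A.comap f := by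
    intro x hx
    have h1 : IsClosed ((A.comap f : Subgroup G) : Set G) := hAcl.preimage QuotientGroup.continuous_mk
    exact closure_minimal (Subgroup.le_comap_map f _) h1 (hS hx)
  refine isOpen_of_relIndex_ne_zero hN hH ?_ hNH
  have hker : f.ker = N := QuotientGroup.ker_mk' N
  rw [← hker, Subgroup.relIndex_ker]
  have : Finite (H.map f) := Finite.Set.subset (A : Set (G ⧸ N)) (Subgroup.map_le_iff_le_comap.2 hHA)
  exact Nat.card_pos.ne'

variable (hH : IsUniform p H) (hHo : IsOpen (H : Set G)) (hHn : H.Normal)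
include hH hHo hHn

/-- The power subgroups are open: `H ^ p` by finite generation and finite exponent, and the further
ones because their sections are images of earlier ones under `p`-th powers. -/
lemma IsUniform.isOpen_powSubgroup (i : ℕ) : IsOpen (powSubgroup H (p ^ i) : Set G) := by
  have hnorm : ∀ n, (powSubgroup H n).Normal := fun n => powSubgroup_normal H n
  have hHc := H.isClosed_of_isOpen hHo
  have hle : ∀ n, powSubgroup H n ≤ H := fun n =>
    powSubgroup_le hHc fun x hx => _root_.pow_mem hx n
  obtain ⟨S, hSH, hS⟩ := hH.fg
  -- finiteness of `H / H ^ (p ^ ε)`, where the quotient is known to be abelian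
  have h1 : IsOpen (powSubgroup H (p ^ commExp p) : Set G) := by
    have := hnorm (p ^ commExp p)
    refine isOpen_of_fg (isClosed_powSubgroup _ _) (hle _) hHo S hSH hS ?_
      (pow_pos (Fact.out : p.Prime).pos _) fun x hx => pow_mem_powSubgroup hx _
    rw [pow_commExp]
    exact hH.commutator_le
  have h2 : IsOpen (powSubgroup H (p ^ 1) : Set G) := by
    refine Subgroup.isOpen_mono ?_ h1
    have := powSubgroup_mul_le H (p ^ (commExp p - 1)) (p ^ 1)
    rwa [← pow_add, Nat.sub_add_cancel (one_le_commExp p)] at this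
  have hsucc : ∀ i, powSubgroup H (p ^ (i + 1)) ≤ powSubgroup H (p ^ i) := fun i => by
    rw [pow_succ']; exact powSubgroup_mul_le _ _ _
  have h3 : ∀ i, IsOpen (powSubgroup H (p ^ (i + 1)) : Set G) := by
    intro i
    induction i with
    | zero => exact h2
    | succ i ih =>
      have ihi : IsOpen (powSubgroup H (p ^ i) : Set G) := Subgroup.isOpen_mono (hsucc i) ih
      refine isOpen_of_relIndex_ne_zero (isClosed_powSubgroup _ _) ih ?_ (hsucc _)
      have hn2 := hnorm (p ^ (i + 2))
      have hn1 := hnorm (p ^ (i + 1))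
      let f := QuotientGroup.mk' (powSubgroup H (p ^ (i + 2)))
      have hker : f.ker = powSubgroup H (p ^ (i + 2)) := QuotientGroup.ker_mk' _
      rw [show i + 1 + 1 = i + 2 from rfl, ← hker, Subgroup.relIndex_ker]
      have hfin : Finite (G ⧸ powSubgroup H (p ^ (i + 1))) := Subgroup.quotient_finite_of_isOpen _ ih
      -- the image of `H ^ (p ^ (i + 1))` consists of the powers of representatives
      have : Finite ((powSubgroup H (p ^ (i + 1))).map f) := by
        let R := {a : G ⧸ powSubgroup H (p ^ (i + 1)) // ∃ x ∈ powSubgroup H (p ^ i),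
          QuotientGroup.mk x = a}
        have hR : ∀ a : R, ∃ x ∈ powSubgroup H (p ^ i), QuotientGroup.mk x = a.1 := fun a => a.2
        choose r hr hra using hR
        refine Finite.Set.subset (Set.range fun a : R => f (r a ^ p)) ?_
        rintro _ ⟨y, hy, rfl⟩
        obtain ⟨x, hx, hxy⟩ := hH.pow_surj i y hy
        let a : R := ⟨QuotientGroup.mk x, x, hx, rfl⟩
        refine ⟨a, ?_⟩
        have hz : (r a)⁻¹ * x ∈ powSubgroup H (p ^ (i + 1)) := QuotientGroup.eq.1 (hra a)
        have e1 := hH.pow_mul i (r a) (hr a) _ (hsucc i hz)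
        rw [mul_inv_cancel_left] at e1
        have e2 := hH.pow_mem _ _ hz
        have e1' : f (x ^ p) = f (r a ^ p * ((r a)⁻¹ * x) ^ p) := QuotientGroup.eq.2 e1
        have e2' : f (((r a)⁻¹ * x) ^ p) = 1 := (QuotientGroup.eq_one_iff _).2 e2
        have e3' : f (x ^ p) = f y := QuotientGroup.eq.2 hxy
        rw [map_mul, e2', mul_one] at e1'
        change f (r a ^ p) = f y
        rw [← e1', e3']
      exact Nat.card_pos.ne'
  exact Subgroup.isOpen_mono (hsucc i) (h3 i)

/-- The powers of an open normal uniform subgroup form a filtration of power type. -/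
theorem IsUniform.isPowFiltration [T2Space G] [TotallyDisconnectedSpace G] :
    IsPowFiltration p (fun i => powSubgroup H (p ^ i)) where
  normal i := powSubgroup_normal H _
  isOpen := hH.isOpen_powSubgroup hHo hHn
  succ_le i := by
    rw [pow_succ']; exact powSubgroup_mul_le _ _ _
  inter := by
    intro x hx
    by_contra hx1
    have hHc := H.isClosed_of_isOpen hHo
    have hcomp : CompactSpace H := isCompact_iff_compactSpace.1 hHc.isCompact
    have hxH : x ∈ H := by
      have := hx 0
      rwa [pow_zero, powSubgroup_one hHc] at this
    obtain ⟨U, hU⟩ := ProfiniteGrp.exist_openNormalSubgroup_sub_open_nhds_of_one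
      (G := H) (U := {⟨x, hxH⟩}ᶜ) isOpen_compl_singleton (by
        intro h
        exact hx1 (congrArg Subtype.val h).symm)
    obtain ⟨n, hn⟩ := hH.isProP.index_eq U.toSubgroup inferInstance U.isOpen'
    have hUo : IsOpen ((U.toSubgroup.map H.subtype : Subgroup G) : Set G) := by
      rw [Subgroup.coe_map]
      exact hHo.isOpenMap_subtype_val _ U.isOpen'
    have hle : powSubgroup H (p ^ n) ≤ U.toSubgroup.map H.subtype := by
      refine powSubgroup_le (Subgroup.isClosed_of_isOpen _ hUo) fun y hy => ?_
      refine ⟨⟨y, hy⟩ ^ p ^ n, ?_, by simp⟩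
      rw [← hn]
      exact U.toSubgroup.pow_index_mem _
    obtain ⟨y, hy, hyx⟩ := hle (hx n)
    refine hU hy (Set.mem_singleton_iff.2 (Subtype.ext hyx))
  commutator := by
    have h := hH.commutator_le
    rw [← pow_commExp] at h
    simpa only [pow_zero, powSubgroup_one (H.isClosed_of_isOpen hHo)] using! h
  pow_mem := hH.pow_mem
  pow_mul := hH.pow_mul
  pow_ker i x hx := (hH.pow_ker i x hx).1
  pow_surj := hH.pow_surj

end Uniform

namespace IsPowFiltration

variable {G : Type*} [Group G] [TopologicalSpace G] [IsTopologicalGroup G] [CompactSpace G]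
  {p : ℕ} {P : ℕ → Subgroup G} (hP : IsPowFiltration p P)
include hP

/-- A bound for the commutators of `g` with all `p ^ i`-th powers of elements of `P 0` extends to
`P i`, which these powers generate. -/
lemma conj_mem_of_pow {g : G} {i l : ℕ}
    (h : ∀ w ∈ P 0, (w ^ p ^ i)⁻¹ * (g * w ^ p ^ i * g⁻¹) ∈ P (i + l)) :
    ∀ x ∈ P i, x⁻¹ * (g * x * g⁻¹) ∈ P (i + l) := by
  have hn := hP.normal (i + l)
  let f := QuotientGroup.mk' (P (i + l))
  let T : Subgroup G := (Subgroup.centralizer {f g}).comap f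
  have hmem : ∀ x, x ∈ T ↔ x⁻¹ * (g * x * g⁻¹) ∈ P (i + l) := by
    intro x
    rw [Subgroup.mem_comap, Subgroup.mem_centralizer_singleton_iff, ← QuotientGroup.eq]
    change f x * f g = f g * f x ↔ f x = f (g * x * g⁻¹)
    rw [map_mul, map_mul, map_inv, eq_mul_inv_iff_mul_eq]
  have hT : IsOpen (T : Set G) := by
    refine Subgroup.isOpen_mono (H₁ := P (i + l)) (fun x hx => ?_) (hP.isOpen _)
    rw [hmem]
    exact mul_mem (inv_mem hx) (hn.conj_mem x hx g)
  intro x hx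
  rw [← hmem]
  rw [← hP.powSubgroup_eq i] at hx
  exact powSubgroup_le (T.isClosed_of_isOpen hT) (fun w hw => (hmem _).2 (h w hw)) hx

/-- `[P 0, P i] ⊆ P (i + 1)`: for `p ^ i`-th powers this follows from `[P 0, P 0] ⊆ P 1` by taking
powers of the congruence `g w g⁻¹ ≡ w` modulo `P 1`. -/
lemma conj_mem_succ {g : G} (hg : g ∈ P 0) {i : ℕ} {x : G} (hx : x ∈ P i) :
    x⁻¹ * (g * x * g⁻¹) ∈ P (i + 1) := by
  refine hP.conj_mem_of_pow (g := g) (l := 1) (fun w hw => ?_) x hx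
  have h1 := hP.commutator w⁻¹ (inv_mem hw) g hg
  have h2 : w⁻¹ * (g * w * g⁻¹) ∈ P (0 + 1) := by
    have : w⁻¹ * g * w⁻¹⁻¹ * g⁻¹ ∈ P (0 + 1) := hP.antitone (by split_ifs <;> omega) h1
    simpa [mul_assoc] using this
  have h3 := hP.pow_mul_congr hw h2 i
  rw [mul_inv_cancel_left, conj_pow, zero_add] at h3
  exact h3

/-- `[P 0, P i] ⊆ P (i + 1)`, and even `[P 0, P i] ⊆ P (i + 2)` for `p = 2`. -/
lemma conj_mem_commExp {g : G} (hg : g ∈ P 0) {i : ℕ} {x : G} (hx : x ∈ P i) :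
    x⁻¹ * (g * x * g⁻¹) ∈ P (i + commExp p) := by
  rw [commExp]
  split_ifs with hp
  swap
  · exact hP.conj_mem_succ hg hx
  subst hp
  refine hP.conj_mem_of_pow (g := g) (l := 2) (fun w hw => ?_) x hx
  have key : ∀ c ∈ P 2, (w ^ 2 ^ i)⁻¹ * (w * c) ^ 2 ^ i ∈ P (i + 2) := by
    intro c hc
    induction i with
    | zero => simpa using hc
    | succ i ih =>
      have hn := hP.normal (i + 1 + 2)
      have ih := ih (hP.antitone (Nat.le_succ i) hx)
      set u := w ^ 2 ^ i with hu
      set d := u⁻¹ * (w * c) ^ 2 ^ i with hd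
      have e : (w * c) ^ 2 ^ i = u * d := by rw [hd, mul_inv_cancel_left]
      rw [pow_succ, _root_.pow_mul, _root_.pow_mul, e, ← hu]
      have hu0 : u ∈ P 0 := _root_.pow_mem hw _
      have h1 := hP.conj_mem_succ (inv_mem hu0) ih
      have h2 := hP.pow_mem _ _ ih
      have e2 : (u ^ 2)⁻¹ * (u * d) ^ 2 = d * (d⁻¹ * (u⁻¹ * d * u⁻¹⁻¹)) * d⁻¹ * d ^ 2 := by
        simp only [pow_two]; group
      rw [e2]
      have e3 : i + 1 + 2 = i + 2 + 1 := by ring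
      rw [e3] at hn ⊢
      exact mul_mem (hn.conj_mem _ h1 d) h2
  have h1 := hP.commutator w⁻¹ (inv_mem hw) g hg
  have h2 := key _ h1
  rw [show w * (w⁻¹ * g * w⁻¹⁻¹ * g⁻¹) = g * w * g⁻¹ by group, conj_pow] at h2
  exact h2

/-- The intersection of a shifted filtration of power type with a subgroup is again of power type
as soon as `p`-th powers stay surjective on its sections. -/
theorem comap {X : Type*} [Group X] [TopologicalSpace X] (ρ : X →* G) (hρ : Continuous ρ)
    (hinj : Function.Injective ρ) (k : ℕ)
    (hs : ∀ i, k ≤ i → ∀ y ∈ ρ.range, y ∈ P (i + 1) → ∃ x ∈ ρ.range, x ∈ P i ∧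
      (x ^ p)⁻¹ * y ∈ P (i + 2)) :
    IsPowFiltration p (fun i => (P (k + i)).comap ρ) where
  normal i := (hP.normal (k + i)).comap ρ
  isOpen i := (hP.isOpen (k + i)).preimage hρ
  succ_le i := Subgroup.comap_mono (hP.succ_le (k + i))
  inter x hx := hinj <| by
    rw [map_one]
    exact hP.inter _ fun i => hP.antitone (Nat.le_add_left i k) (hx i)
  commutator x hx y hy := by
    change ρ (x * y * x⁻¹ * y⁻¹) ∈ P (k + commExp p)
    have h := hP.conj_mem_commExp (hP.antitone (Nat.zero_le _) (show ρ y ∈ P (k + 0) from hy))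
      (inv_mem (show ρ x ∈ P (k + 0) from hx))
    simpa [mul_assoc] using h
  pow_mem i x hx := by
    change ρ (x ^ p) ∈ P (k + (i + 1))
    rw [map_pow]
    exact hP.pow_mem _ _ hx
  pow_mul i x hx y hy := by
    change ρ (((x * y) ^ p)⁻¹ * (x ^ p * y ^ p)) ∈ P (k + (i + 2))
    simpa [add_assoc] using hP.pow_mul (k + i) _ hx _ hy
  pow_ker i x hx h := by
    refine hP.pow_ker _ _ hx ?_
    rw [← map_pow]
    exact h
  pow_surj i y hy := by
    obtain ⟨_, ⟨x, rfl⟩, hx, hxy⟩ := hs (k + i) (by omega) (ρ y) ⟨y, rfl⟩ hy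
    refine ⟨x, hx, ?_⟩
    change ρ ((x ^ p)⁻¹ * y) ∈ P (k + (i + 2))
    simpa [add_assoc] using hxy

end IsPowFiltration

/-! ### Normal subgroups with procyclic quotient -/

namespace IsPowFiltration

variable {G : Type*} [Group G] [TopologicalSpace G] [IsTopologicalGroup G] [CompactSpace G]
  {p : ℕ} [Fact p.Prime] {P : ℕ → Subgroup G} (hP : IsPowFiltration p P) {C : Subgroup G}
  (hC : IsClosed (C : Set G)) (hcomm : ∀ x y : G, x * y * x⁻¹ * y⁻¹ ∈ C)

include hcomm in
omit [TopologicalSpace G] [IsTopologicalGroup G] [CompactSpace G] in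
lemma normal_of_commutator : C.Normal :=
  ⟨fun x hx g => by simpa [mul_assoc] using mul_mem (hcomm g x) hx⟩

include hP hC in
omit [Fact p.Prime] in
lemma mem_of_forall_mem_sup (j : ℕ) {x : G} (hx : ∀ i, j ≤ i → x ∈ C ⊔ P i) : x ∈ C := by
  have : x ∈ closure (C : Set G) := by
    rw [mem_closure_iff_nhds]
    intro U hU
    have hU' : (fun z => x * z⁻¹) ⁻¹' U ∈ nhds (1 : G) := by
      apply ContinuousAt.preimage_mem_nhds (by fun_prop)
      simpa using hU
    obtain ⟨n, hn⟩ := hP.exists_le hU'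
    have := hP.normal (max j n)
    obtain ⟨c, hc, y, hy, rfl⟩ := Subgroup.mem_sup_of_normal_right.1 (hx (max j n) (le_max_left _ _))
    refine ⟨c, ?_, hc⟩
    have := hn (hP.antitone (le_max_right j n) hy)
    simpa using this
  rwa [hC.closure_eq] at this

include hP hC hcomm in
/-- Let `C` be a closed normal subgroup with abelian quotient such that the image of `P 0` in
`G / C P 1` is generated by one element. Then either `C P i = C P j` for all large `i`, and `C`
contains some `P j`, or all the sections of `i ↦ C P i` are of order `p`, and for `w ∈ P i` with
`w ^ p ∈ C P (i + 2)` one has `w ∈ C P (i + 1)`. In both cases `p`-th powers are surjective on the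
sections of `i ↦ C ∩ P i` for large `i`. -/
theorem exists_surj_of_procyclic
    (hcyc : ∃ g ∈ P 0, ∀ x ∈ P 0, ∃ n : ℤ, (g ^ n)⁻¹ * x ∈ C ⊔ P 1) :
    ∃ k, (∀ i, k ≤ i → ∀ y ∈ C, y ∈ P (i + 1) → ∃ x ∈ C, x ∈ P i ∧ (x ^ p)⁻¹ * y ∈ P (i + 2)) ∧
      ((∀ i, k ≤ i → (C ⊔ P i).index = (C ⊔ P k).index) ∨
        ∀ i, k ≤ i → (C ⊔ P i).index = (C ⊔ P k).index * p ^ (i - k)) := by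
  have hCn : C.Normal := normal_of_commutator hcomm
  have hn := hP.normal
  obtain ⟨g, hg, hgen⟩ := hcyc
  -- calculations modulo `C` and modulo `C P i` take place in abelian groups
  have hle : ∀ i, P i ≤ C ⊔ P i := fun i => le_sup_right
  have hCle : ∀ i, C ≤ C ⊔ P i := fun i => le_sup_left
  have hBn : ∀ i, (C ⊔ P i).Normal := fun i => inferInstance
  have hBanti : ∀ {i j}, i ≤ j → C ⊔ P j ≤ C ⊔ P i := fun h => sup_le_sup_left (hP.antitone h) C
  have habel : ∀ x y : G, (QuotientGroup.mk' C) x * (QuotientGroup.mk' C) y =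
      (QuotientGroup.mk' C) y * (QuotientGroup.mk' C) x := fun x y => by
    have h1 : QuotientGroup.mk' C (x * y * x⁻¹ * y⁻¹) = 1 := (QuotientGroup.eq_one_iff _).2 (hcomm x y)
    rwa [map_mul, map_mul, map_mul, map_inv, map_inv, mul_inv_eq_one, mul_inv_eq_iff_eq_mul] at h1
  have hmem : ∀ {i x}, x ∈ C ⊔ P i ↔ ∃ z ∈ P i, QuotientGroup.mk' C x = QuotientGroup.mk' C z := by
    intro i x
    rw [Subgroup.mem_sup_of_normal_left]
    constructor
    · rintro ⟨c, hc, z, hz, rfl⟩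
      refine ⟨z, hz, ?_⟩
      rw [map_mul, show QuotientGroup.mk' C c = 1 from (QuotientGroup.eq_one_iff _).2 hc, one_mul]
    · rintro ⟨z, hz, h⟩
      refine ⟨x * z⁻¹, ?_, z, hz, by group⟩
      rw [← QuotientGroup.eq_one_iff]
      change QuotientGroup.mk' C _ = 1
      rw [map_mul, map_inv, h, mul_inv_cancel]
  have hgp : ∀ i, g ^ p ^ i ∈ P i := fun i => by simpa using hP.pow_pow_mem hg i
  have hgenB : ∀ i, ∀ y ∈ C ⊔ P i, ∃ n : ℤ, ((g ^ p ^ i) ^ n)⁻¹ * y ∈ C ⊔ P (i + 1) := by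
    intro i y hy
    obtain ⟨y', hy', hyy'⟩ := hmem.1 hy
    obtain ⟨w, hw, hwy⟩ := hP.exists_pow_congr 0 i (by simpa using hy')
    obtain ⟨n, hnw⟩ := hgen w hw
    obtain ⟨z, hz, hwz⟩ := hmem.1 hnw
    refine ⟨n, hmem.2 ⟨z ^ p ^ i * ((w ^ p ^ i)⁻¹ * y'), mul_mem ?_ ?_, ?_⟩⟩
    · have := hP.pow_pow_mem hz i
      rwa [add_comm] at this
    · simpa using hwy
    · have hw' : QuotientGroup.mk' C w = QuotientGroup.mk' C (g ^ n) * QuotientGroup.mk' C z := by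
        rw [← hwz, ← map_mul, mul_inv_cancel_left]
      have hc : Commute (QuotientGroup.mk' C (g ^ n)) (QuotientGroup.mk' C z) := habel _ _
      simp only [map_mul, map_inv, map_pow, hyy', hw', hc.mul_pow]
      have hgn : QuotientGroup.mk' C ((g ^ p ^ i) ^ n) = QuotientGroup.mk' C (g ^ n) ^ p ^ i := by
        rw [← map_pow, ← zpow_natCast, ← zpow_natCast, ← zpow_mul, ← zpow_mul, mul_comm]
      rw [hgn]
      group
  -- the powers `g ^ p ^ i` generate the sections of `C P i`; either one of these sections is trivial,
  -- and then all later ones are, or none is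
  by_cases hcase : ∃ j, g ^ p ^ j ∈ C ⊔ P (j + 1)
  · obtain ⟨j, hj⟩ := hcase
    have h1 : ∀ m, g ^ p ^ (j + m) ∈ C ⊔ P (j + m + 1) := by
      intro m
      induction m with
      | zero => exact hj
      | succ m ih =>
        obtain ⟨z, hz, h⟩ := hmem.1 ih
        refine hmem.2 ⟨z ^ p, hP.pow_mem _ _ hz, ?_⟩
        rw [map_pow _ z, ← h, ← map_pow, ← _root_.pow_mul, ← pow_succ, add_assoc]
    have h2 : ∀ i, j ≤ i → C ⊔ P i = C ⊔ P (i + 1) := by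
      intro i hi
      obtain ⟨m, rfl⟩ := Nat.exists_eq_add_of_le hi
      refine le_antisymm (fun y hy => ?_) (hBanti (Nat.le_succ _))
      obtain ⟨n, hn⟩ := hgenB _ y hy
      simpa using mul_mem (zpow_mem (h1 m) n) hn
    have h3 : ∀ i, j ≤ i → C ⊔ P i = C ⊔ P j := fun i hi => by
      induction i, hi using Nat.le_induction with
      | base => rfl
      | succ i hi ih => rw [← h2 i hi, ih]
    have h4 : P j ≤ C := fun x hx => hP.mem_of_forall_mem_sup hC j fun i hi => by
      rw [h3 i hi]; exact hle j hx
    refine ⟨j, fun i hi y _ hyi => ?_, Or.inl fun i hi => by rw [h3 i hi]⟩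
    obtain ⟨x, hx, hxy⟩ := hP.pow_surj i y hyi
    exact ⟨x, h4 (hP.antitone hi hx), hx, hxy⟩
  · push Not at hcase
    have hp := (Fact.out : p.Prime)
    have hgp2 : ∀ i, g ^ p ^ (i + 1) ∈ C ⊔ P (i + 1) := fun i => hle _ (hgp _)
    have hdvd : ∀ i (n : ℤ), (g ^ p ^ i) ^ n ∈ C ⊔ P (i + 1) → (p : ℤ) ∣ n := by
      intro i n h
      by_contra hnd
      have hcop : IsCoprime (p : ℤ) n :=
        (Nat.prime_iff_prime_int.1 hp).irreducible.coprime_iff_not_dvd.2 hnd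
      obtain ⟨a, b, hab⟩ := hcop
      refine hcase i ?_
      have e : g ^ p ^ i = (g ^ p ^ (i + 1)) ^ a * ((g ^ p ^ i) ^ n) ^ b := by
        rw [pow_succ, _root_.pow_mul, ← zpow_natCast (g ^ p ^ i) p, ← zpow_mul, ← zpow_mul,
          ← zpow_add, mul_comm (p : ℤ), mul_comm n, hab, zpow_one]
      rw [e]
      exact mul_mem (zpow_mem (hgp2 i) a) (zpow_mem h b)
    -- `p`-th powers are injective on the sections of `C P i`
    have hkey : ∀ i, ∀ w ∈ P i, w ^ p ∈ C ⊔ P (i + 2) → w ∈ C ⊔ P (i + 1) := by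
      intro i w hw hwp
      obtain ⟨n, hn⟩ := hgenB i w (hle i hw)
      obtain ⟨z, hz, hwz⟩ := hmem.1 hn
      have h1 : (g ^ p ^ (i + 1)) ^ n ∈ C ⊔ P (i + 2) := by
        have hw' : QuotientGroup.mk' C w =
            QuotientGroup.mk' C ((g ^ p ^ i) ^ n) * QuotientGroup.mk' C z := by
          rw [← hwz, ← map_mul, mul_inv_cancel_left]
        have hc : Commute (QuotientGroup.mk' C ((g ^ p ^ i) ^ n)) (QuotientGroup.mk' C z) :=
          habel _ _
        obtain ⟨y, hy, hyw⟩ := hmem.1 hwp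
        rw [map_pow, hw', hc.mul_pow] at hyw
        refine hmem.2 ⟨y * (z ^ p)⁻¹, mul_mem hy (inv_mem (hP.pow_mem _ _ hz)), ?_⟩
        rw [map_mul, map_inv, ← hyw, map_pow, mul_inv_cancel_right, ← map_pow]
        congr 1
        rw [← zpow_natCast ((g ^ p ^ i) ^ n), ← zpow_mul, pow_succ, _root_.pow_mul,
          ← zpow_natCast (g ^ p ^ i) p, ← zpow_mul, mul_comm n]
      obtain ⟨m, rfl⟩ := hdvd (i + 1) n h1
      have h2 : (g ^ p ^ i) ^ ((p : ℤ) * m) ∈ C ⊔ P (i + 1) := by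
        rw [zpow_mul, zpow_natCast, ← _root_.pow_mul, ← pow_succ]
        exact zpow_mem (hgp2 i) m
      simpa using mul_mem h2 hn
    have hrel : ∀ i, (C ⊔ P (i + 1)).relIndex (C ⊔ P i) = p := by
      intro i
      let f := QuotientGroup.mk' (C ⊔ P (i + 1))
      have hker : f.ker = C ⊔ P (i + 1) := QuotientGroup.ker_mk' _
      have hmap : (C ⊔ P i).map f = Subgroup.zpowers (f (g ^ p ^ i)) := by
        apply le_antisymm
        · rintro _ ⟨y, hy, rfl⟩
          obtain ⟨n, hn⟩ := hgenB i y hy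
          refine Subgroup.mem_zpowers_iff.2 ⟨n, ?_⟩
          rw [← map_zpow]
          exact QuotientGroup.eq.2 hn
        · rw [Subgroup.zpowers_le]
          exact ⟨_, hle i (hgp i), rfl⟩
      rw [← hker, Subgroup.relIndex_ker, hmap, Nat.card_zpowers]
      apply orderOf_eq_prime
      · rw [← map_pow, ← _root_.pow_mul, ← pow_succ]
        exact (QuotientGroup.eq_one_iff _).2 (hgp2 i)
      · intro h
        exact hcase i ((QuotientGroup.eq_one_iff _).1 h)
    refine ⟨0, fun i _ y hyC hyi => ?_, Or.inr fun i _ => ?_⟩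
    · obtain ⟨w, hw, hwy⟩ := hP.pow_surj i y hyi
      have h1 : w ^ p ∈ C ⊔ P (i + 2) := by
        have := mul_mem (hCle (i + 2) hyC) (inv_mem (hle _ hwy))
        simpa using this
      obtain ⟨c, hc, z, hz, rfl⟩ := Subgroup.mem_sup_of_normal_left.1 (hkey i w hw h1)
      have hci : c ∈ P i := by
        have := mul_mem hw (inv_mem (hP.succ_le i hz))
        simpa using this
      refine ⟨c, hc, hci, ?_⟩
      have h2 := hP.pow_mul_congr hci hz 1
      rw [pow_one] at h2
      have h3 := mul_mem h2 hwy
      rwa [mul_assoc, mul_inv_cancel_left] at h3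
    · rw [Nat.sub_zero]
      induction i with
      | zero => simp
      | succ i ih =>
        rw [← Subgroup.relIndex_mul_index (hBanti (Nat.le_succ i)), hrel, ih (Nat.zero_le i), pow_succ]
        ring

end IsPowFiltration

/-! ### Discrete absolute values -/

section AbsVal

variable {F : Type*} [Field F]

/-- `π` is a uniformizer for the absolute value `v`: its value is the largest one below `1`. -/
structure IsUnif (v : AbsoluteValue F ℝ) (π : F) : Prop where
  pos : 0 < v π
  lt_one : v π < 1
  le : ∀ x, v x < 1 → v x ≤ v π

variable {v : AbsoluteValue F ℝ} {π : F}

lemma IsUnif.ne_zero (h : IsUnif v π) : π ≠ 0 := fun h0 => by simpa [h0] using h.pos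

/-- An absolute value with a uniformizer is discrete. -/
lemma IsUnif.exists_zpow (h : IsUnif v π) {x : F} (hx : x ≠ 0) : ∃ n : ℤ, v x = v π ^ n := by
  obtain ⟨n, h1, h2⟩ := exists_mem_Ioc_zpow (v.pos hx) ((one_lt_inv₀ h.pos).2 h.lt_one)
  refine ⟨-(n + 1), ?_⟩
  rw [inv_zpow'] at h1 h2
  have hp : 0 < v π ^ (-(n + 1)) := zpow_pos h.pos _
  have h3 : v (x * π ^ (n + 1)) ≤ 1 := by
    rw [map_mul, map_zpow₀, ← le_div_iff₀ (zpow_pos h.pos _), one_div, ← zpow_neg]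
    exact h2
  have h4 : ¬ v (x * π ^ (n + 1)) < 1 := fun hlt => by
    have := h.le _ hlt
    rw [map_mul, map_zpow₀, zpow_add_one₀ h.pos.ne', ← mul_assoc] at this
    have h5 : v x * v π ^ n ≤ 1 := by
      by_contra hc
      push Not at hc
      nlinarith [h.pos]
    rw [← le_div_iff₀ (zpow_pos h.pos _), one_div, ← zpow_neg] at h5
    exact absurd h5 (not_le.2 h1)
  have h5 := le_antisymm h3 (not_lt.1 h4)
  rw [map_mul, map_zpow₀] at h5
  rw [zpow_neg, eq_inv_of_mul_eq_one_left h5]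

lemma IsUnif.zpow_le_zpow (h : IsUnif v π) {m n : ℤ} : v π ^ m ≤ v π ^ n ↔ n ≤ m :=
  zpow_le_zpow_iff_right_of_lt_one₀ h.pos h.lt_one

lemma IsUnif.pow_le_pow (h : IsUnif v π) {m n : ℕ} : v π ^ m ≤ v π ^ n ↔ n ≤ m :=
  pow_le_pow_iff_right_of_lt_one₀ h.pos h.lt_one

lemma IsUnif.exists_pow (h : IsUnif v π) {x : F} (hx : x ≠ 0) (h1 : v x ≤ 1) :
    ∃ n : ℕ, v x = v π ^ n := by
  obtain ⟨n, hn⟩ := h.exists_zpow hx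
  have : 0 ≤ n := by
    rw [hn, ← zpow_zero (v π), h.zpow_le_zpow] at h1
    exact h1
  lift n to ℕ using this
  exact ⟨n, by simpa using hn⟩

lemma nonarch_sub_le (hv : IsNonarchimedean v) (x y : F) :
    v (x - y) ≤ max (v x) (v y) := by
  simpa [sub_eq_add_neg] using hv x (-y)

lemma nonarch_sum_le (hv : IsNonarchimedean v) {ι : Type*} (s : Finset ι) (f : ι → F)
    {B : ℝ} (hB : 0 ≤ B) (h : ∀ i ∈ s, v (f i) ≤ B) : v (∑ i ∈ s, f i) ≤ B := by
  classical
  induction s using Finset.induction_on with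
  | empty => simpa using hB
  | insert a s ha ih =>
    rw [Finset.sum_insert ha]
    exact (hv _ _).trans (max_le (h _ (by simp)) (ih fun i hi => h i (by simp [hi])))

lemma nonarch_eq_of_sub_lt (hv : IsNonarchimedean v) {x y : F} (h : v (x - y) < v y) :
    v x = v y := by
  apply le_antisymm
  · have := hv (x - y) y
    rw [sub_add_cancel] at this
    exact this.trans (max_le h.le le_rfl)
  · have := nonarch_sub_le hv x (x - y)
    rw [sub_sub_cancel] at this
    rcases le_max_iff.1 this with h1 | h1
    · exact h1
    · exact absurd h (not_lt.2 h1)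

end AbsVal

/-! ### Ideals of the ring of integers -/

section Ring

variable {R F : Type*} [CommRing R] [Field F] {ι : R →+* F} {v : AbsoluteValue F ℝ}

lemma isUnit_iff_absVal (hι : Function.Injective ι) (hr : ∀ x, v x ≤ 1 ↔ ∃ r, ι r = x) (r : R) :
    IsUnit r ↔ v (ι r) = 1 := by
  constructor
  · rintro ⟨u, rfl⟩
    have h1 : v (ι u) ≤ 1 := (hr _).2 ⟨_, rfl⟩
    have h2 : v (ι ↑u⁻¹) ≤ 1 := (hr _).2 ⟨_, rfl⟩
    have h3 : v (ι u) * v (ι ↑u⁻¹) = 1 := by rw [← map_mul, ← map_mul]; simp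
    nlinarith [v.nonneg (ι u), v.nonneg (ι ↑u⁻¹)]
  · intro h
    obtain ⟨s, hs⟩ := (hr (ι r)⁻¹).1 (by rw [map_inv₀, h, inv_one])
    refine IsUnit.of_mul_eq_one s (hι ?_)
    rw [map_mul, hs, map_one, mul_inv_cancel₀]
    intro h0
    simp [h0] at h

lemma mem_maxIdeal_iff (hι : Function.Injective ι) (hv : IsNonarchimedean v)
    (hr : ∀ x, v x ≤ 1 ↔ ∃ r, ι r = x) (r : R) : r ∈ maxIdeal R ↔ v (ι r) < 1 := by
  rw [maxIdeal, Ideal.mem_jacobson_bot]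
  constructor
  · intro h
    refine lt_of_le_of_ne ((hr _).2 ⟨r, rfl⟩) fun h1 => ?_
    obtain ⟨u, rfl⟩ := (isUnit_iff_absVal hι hr r).2 h1
    have := h (-↑u⁻¹)
    rw [mul_neg, u.mul_inv, neg_add_cancel, isUnit_zero_iff] at this
    have h2 := congrArg ι this
    have h3 : v (ι 1) = 0 := by rw [← h2]; simp
    simp at h3
  · intro h y
    rw [isUnit_iff_absVal hι hr]
    have : v (ι (r * y + 1)) = v 1 := by
      apply nonarch_eq_of_sub_lt hv
      have hy : v (ι y) ≤ 1 := (hr _).2 ⟨y, rfl⟩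
      rw [map_add, map_one, add_sub_cancel_right, map_mul, map_mul, map_one]
      nlinarith [v.nonneg (ι r), v.nonneg (ι y)]
    rwa [map_one] at this

variable {π : F}

/-- If `ι` identifies `R` with the integers `v x ≤ 1`, the powers of the maximal ideal are the sets
`v x ≤ v π ^ n`. -/
lemma mem_maxIdeal_pow_iff (hι : Function.Injective ι) (hv : IsNonarchimedean v)
    (hr : ∀ x, v x ≤ 1 ↔ ∃ r, ι r = x) (hπ : IsUnif v π) (n : ℕ) (r : R) :
    r ∈ maxIdeal R ^ n ↔ v (ι r) ≤ v π ^ n := by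
  obtain ⟨p, hp⟩ := (hr π).1 hπ.lt_one.le
  have hdvd : ∀ r n, v (ι r) ≤ v π ^ n → p ^ n ∣ r := by
    intro r n h
    obtain ⟨s, hs⟩ := (hr (ι r / π ^ n)).1 (by
      rw [map_div₀, map_pow, div_le_one (pow_pos hπ.pos _)]; exact h)
    refine ⟨s, hι ?_⟩
    rw [map_mul, hs, map_pow, hp, mul_div_cancel₀ _ (pow_ne_zero _ hπ.ne_zero)]
  have hm : maxIdeal R = Ideal.span {p} := by
    ext r
    rw [mem_maxIdeal_iff hι hv hr, Ideal.mem_span_singleton]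
    constructor
    · intro h
      simpa using hdvd r 1 (by simpa using hπ.le _ h)
    · rintro ⟨s, rfl⟩
      have hs : v (ι s) ≤ 1 := (hr _).2 ⟨s, rfl⟩
      rw [map_mul, map_mul, hp]
      nlinarith [hπ.pos, hπ.lt_one, v.nonneg (ι s)]
  rw [hm, Ideal.span_singleton_pow, Ideal.mem_span_singleton]
  refine ⟨?_, hdvd r n⟩
  rintro ⟨s, rfl⟩
  have hs : v (ι s) ≤ 1 := (hr _).2 ⟨s, rfl⟩
  rw [map_mul, map_mul, map_pow, hp, map_pow]
  exact mul_le_of_le_one_right (pow_nonneg hπ.pos.le _) hs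

lemma idealVal_eq_of_mem_iff (hι : Function.Injective ι) (hv : IsNonarchimedean v)
    (hr : ∀ x, v x ≤ 1 ↔ ∃ r, ι r = x) (hπ : IsUnif v π) {I : Ideal R} {d : ℕ}
    (h : ∀ r, r ∈ I ↔ v (ι r) ≤ v π ^ d) : idealVal I = d := by
  have hI : I = maxIdeal R ^ d := by
    ext r
    rw [h, mem_maxIdeal_pow_iff hι hv hr hπ]
  rw [idealVal, emultiplicity_eq_coe]
  refine ⟨hI ▸ dvd_rfl, fun hd => ?_⟩
  have hle := Ideal.le_of_dvd hd
  obtain ⟨p, hp⟩ := (hr π).1 hπ.lt_one.le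
  have h1 : p ^ d ∈ I := by rw [h, map_pow, hp, map_pow]
  have h2 := (mem_maxIdeal_pow_iff hι hv hr hπ _ _).1 (hle h1)
  rw [map_pow, hp, map_pow, hπ.pow_le_pow] at h2
  omega

end Ring

/-! ### The absolute value of an algebraic extension -/

section Spectral

lemma baseInt_iff {k : Type*} [NormedField k] [IsUltrametricDist k] (x : k) :
    x ∈ baseInt k ↔ ‖x‖ ≤ 1 := by
  rw [baseInt, Valuation.mem_valuationSubring_iff]
  rfl

lemma extInt_inj (k F : Type*) [NormedField k] [IsUltrametricDist k] [Field F] [Algebra k F] :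
    Function.Injective (algebraMap (extInt k F) F) := Subtype.val_injective

variable (k F : Type*) [NontriviallyNormedField k] [IsUltrametricDist k] [CompleteSpace k]
  [Field F] [Algebra k F] [Algebra.IsAlgebraic k F]

/-- The unique extension to an algebraic extension `F` of the absolute value of a complete
nonarchimedean field `k`. -/
def extAbs : AbsoluteValue F ℝ where
  toFun := spectralNorm k F
  map_mul' := map_mul (spectralMulAlgNorm k F)
  nonneg' := spectralNorm_nonneg
  eq_zero' x := ⟨fun h => eq_zero_of_map_spectralNorm_eq_zero h (Algebra.IsAlgebraic.isAlgebraic x),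
    fun h => h ▸ spectralNorm_zero⟩
  add_le' := map_add_le_add (spectralAlgNorm k F)

lemma extAbs_apply (x : F) : extAbs k F x = spectralNorm k F x := rfl

lemma isNonarchimedean_extAbs : IsNonarchimedean (extAbs k F) :=
  isNonarchimedean_spectralNorm

variable {k F}

@[simp] lemma extAbs_algebraMap (x : k) : extAbs k F (algebraMap k F x) = ‖x‖ :=
  spectralNorm_extends x

lemma extAbs_algEquiv {F' : Type*} [Field F'] [Algebra k F'] [Algebra.IsAlgebraic k F']
    (σ : F ≃ₐ[k] F') (x : F) : extAbs k F' (σ x) = extAbs k F x := by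
  simp only [extAbs_apply, spectralNorm, minpoly.algEquiv_eq σ x]

lemma extAbs_tower {E : Type*} [Field E] [Algebra k E] [Algebra.IsAlgebraic k E] [Algebra E F]
    [IsScalarTower k E F] (x : E) : extAbs k F (algebraMap E F x) = extAbs k E x :=
  (spectralNorm.eq_of_tower x).symm

/-- The extended absolute value is the only one with the given restriction. -/
lemma extAbs_unique (w : AbsoluteValue F ℝ) (hw : ∀ x, w (algebraMap k F x) = ‖x‖) (x : F) :
    extAbs k F x = w x :=
  (spectralNorm_unique_field_norm_ext hw x).symm

/-- The integral closure consists of the elements of absolute value at most `1`. -/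
lemma mem_extInt_iff (x : F) : x ∈ extInt k F ↔ extAbs k F x ≤ 1 := by
  rw [mem_integralClosure_iff]
  have hxk : IsIntegral k x := (Algebra.IsAlgebraic.isAlgebraic x).isIntegral
  constructor
  · rintro ⟨P, hP, hx⟩
    by_contra hc
    push Not at hc
    set n := P.natDegree
    have hx' : ∑ i ∈ Finset.range n, algebraMap k F (P.coeff i) * x ^ i = - x ^ n := by
      rw [Polynomial.eval₂_eq_sum_range, Finset.sum_range_succ] at hx
      have : P.coeff P.natDegree = 1 := hP
      rw [this, map_one, one_mul] at hx
      rw [← add_eq_zero_iff_eq_neg]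
      exact hx
    have hn : 0 < n := by
      rcases Nat.eq_zero_or_pos n with h | h
      · rw [h] at hx'; simp at hx'
      · exact h
    have h1 : extAbs k F (- x ^ n) ≤ extAbs k F x ^ (n - 1) := by
      rw [← hx']
      apply nonarch_sum_le (isNonarchimedean_extAbs k F)
      · positivity
      · intro i hi
        rw [map_mul, extAbs_algebraMap, map_pow]
        have h2 : ‖(P.coeff i : k)‖ ≤ 1 := (baseInt_iff _).1 (P.coeff i).2
        have h3 : extAbs k F x ^ i ≤ extAbs k F x ^ (n - 1) :=
          pow_le_pow_right₀ hc.le (by have := Finset.mem_range.1 hi; omega)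
        calc _ ≤ 1 * extAbs k F x ^ i := by gcongr
          _ ≤ _ := by simpa using h3
    rw [AbsoluteValue.map_neg, map_pow] at h1
    exact absurd ((pow_le_pow_iff_right₀ hc).1 h1) (by omega)
  · intro h
    rw [extAbs_apply, spectralNorm, spectralValue_le_one_iff (minpoly.monic hxk)] at h
    have hl : minpoly k x ∈ Polynomial.lifts (algebraMap (baseInt k) k) := by
      rw [Polynomial.lifts_iff_coeff_lifts]
      intro n
      exact ⟨⟨_, (baseInt_iff _).2 (h n)⟩, rfl⟩
    obtain ⟨q, hq, -, hm⟩ := Polynomial.lifts_and_natDegree_eq_and_monic hl (minpoly.monic hxk)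
    refine ⟨q, hm, ?_⟩
    have := minpoly.aeval k x
    rw [← hq, Polynomial.aeval_map_algebraMap] at this
    exact this

variable (k F) in
lemma extInt_range (x : F) :
    extAbs k F x ≤ 1 ↔ ∃ r, (algebraMap (extInt k F) F) r = x := by
  rw [← mem_extInt_iff]
  exact ⟨fun h => ⟨⟨x, h⟩, rfl⟩, fun ⟨r, hr⟩ => hr ▸ r.2⟩

lemma mem_lowerRam_iff {π : F} (hπ : IsUnif (extAbs k F) π) (r : ℝ) (σ : Gal(F/k)) :
    σ ∈ lowerRam k F r ↔
      ∀ x, extAbs k F x ≤ 1 → extAbs k F (σ x - x) ≤ extAbs k F π ^ ⌈r + 1⌉₊ := by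
  have h : σ ∈ lowerRam k F r ↔ ∀ x : extInt k F, σ • x - x ∈ maxIdeal (extInt k F) ^ ⌈r + 1⌉₊ :=
    Iff.rfl
  rw [h]
  simp only [mem_maxIdeal_pow_iff (extInt_inj k F) (isNonarchimedean_extAbs k F)
    (extInt_range k F) hπ]
  exact ⟨fun h x hx => h ⟨x, (mem_extInt_iff x).2 hx⟩, fun h x => h x ((mem_extInt_iff _).1 x.2)⟩

/-- Contrary to `mem_lowerRam_iff`, this needs no uniformizer, and it applies to extensions which
are not discretely valued. -/
lemma mem_lowerRam_zero_iff (σ : Gal(F/k)) :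
    σ ∈ lowerRam k F 0 ↔ ∀ x, extAbs k F x ≤ 1 → extAbs k F (σ x - x) < 1 := by
  have h : σ ∈ lowerRam k F 0 ↔ ∀ x : extInt k F, σ • x - x ∈ maxIdeal (extInt k F) ^ ⌈(0:ℝ) + 1⌉₊ :=
    Iff.rfl
  rw [h, zero_add, Nat.ceil_one, pow_one]
  simp only [mem_maxIdeal_iff (extInt_inj k F) (isNonarchimedean_extAbs k F)
    (extInt_range k F)]
  exact ⟨fun h x hx => h ⟨x, (mem_extInt_iff x).2 hx⟩, fun h x => h x ((mem_extInt_iff _).1 x.2)⟩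

end Spectral

/-! ### Totally ramified extensions: density of `O_k[π]` -/

section Dense

variable {F : Type*} [Field F] {v : AbsoluteValue F ℝ} {π : F}

/-- If every integer of `F` is congruent to an element of the subring `S`, then the integers of `F`
are approximated by polynomials in a uniformizer with coefficients in `S`. -/
lemma exists_poly_approx (hv : IsNonarchimedean v) (hπ : IsUnif v π) (S : Subring F)
    (hres : ∀ x, v x ≤ 1 → ∃ t ∈ S, v t ≤ 1 ∧ v (x - t) < 1) {x : F} (hx : v x ≤ 1) (n : ℕ) :
    ∃ g : Polynomial F, (∀ i, g.coeff i ∈ S ∧ v (g.coeff i) ≤ 1) ∧ v (x - g.eval π) ≤ v π ^ n := by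
  induction n with
  | zero => exact ⟨0, by simp, by simpa using hx⟩
  | succ n ih =>
    obtain ⟨g, hg, hgx⟩ := ih
    have hy : v ((x - g.eval π) / π ^ n) ≤ 1 := by
      rw [map_div₀, map_pow, div_le_one (pow_pos hπ.pos _)]; exact hgx
    obtain ⟨t, htS, ht1, ht⟩ := hres _ hy
    refine ⟨g + Polynomial.C t * Polynomial.X ^ n, fun i => ?_, ?_⟩
    · rw [Polynomial.coeff_add, Polynomial.coeff_C_mul_X_pow]
      split_ifs with h
      · exact ⟨S.add_mem (hg i).1 htS, (hv _ _).trans (max_le (hg i).2 ht1)⟩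
      · simpa using hg i
    · have e : x - (g + Polynomial.C t * Polynomial.X ^ n).eval π
          = ((x - g.eval π) / π ^ n - t) * π ^ n := by
        have := pow_ne_zero n hπ.ne_zero
        simp only [Polynomial.eval_add, Polynomial.eval_mul, Polynomial.eval_C,
          Polynomial.eval_pow, Polynomial.eval_X]
        field_simp
        ring
      rw [e, map_mul, map_pow, pow_succ']
      exact mul_le_mul_of_nonneg_right (hπ.le _ ht) (pow_nonneg hπ.pos.le _)

/-- Two isometric ring homomorphisms which differ by at most `v π ^ m` on the coefficients and on a
uniformizer differ by at most `v π ^ m` on all integers. -/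
lemma sub_le_of_unif (hv : IsNonarchimedean v) (hπ : IsUnif v π) (S : Subring F)
    (hres : ∀ x, v x ≤ 1 → ∃ t ∈ S, v t ≤ 1 ∧ v (x - t) < 1) {F' : Type*} [Field F']
    {w : AbsoluteValue F' ℝ} (hw : IsNonarchimedean w) (σ τ : F →+* F')
    (hσ : ∀ x, w (σ x) = v x) (hτ : ∀ x, w (τ x) = v x) (m : ℕ)
    (hS : ∀ t ∈ S, v t ≤ 1 → w (σ t - τ t) ≤ v π ^ m)
    (hm : w (σ π - τ π) ≤ v π ^ m) {x : F} (hx : v x ≤ 1) : w (σ x - τ x) ≤ v π ^ m := by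
  have hB : 0 ≤ v π ^ m := pow_nonneg hπ.pos.le _
  let A : Subring F :=
    { carrier := {x | v x ≤ 1 ∧ w (σ x - τ x) ≤ v π ^ m}
      zero_mem' := by simp [hB]
      one_mem' := by simp [hB]
      neg_mem' := fun {a} h => by
        refine ⟨by simpa using h.1, ?_⟩
        rw [map_neg, map_neg, show -σ a - -τ a = -(σ a - τ a) by ring, AbsoluteValue.map_neg]
        exact h.2
      add_mem' := fun {a b} ha hb => by
        refine ⟨(hv _ _).trans (max_le ha.1 hb.1), ?_⟩
        rw [map_add, map_add, add_sub_add_comm]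
        exact (hw _ _).trans (max_le ha.2 hb.2)
      mul_mem' := fun {a b} ha hb => by
        refine ⟨by rw [map_mul]; exact mul_le_one₀ ha.1 (v.nonneg _) hb.1, ?_⟩
        rw [map_mul, map_mul,
          show σ a * σ b - τ a * τ b = σ a * (σ b - τ b) + (σ a - τ a) * τ b by ring]
        refine (hw _ _).trans (max_le ?_ ?_)
        · rw [map_mul, hσ]
          exact (mul_le_of_le_one_left (w.nonneg _) ha.1).trans hb.2
        · rw [map_mul, hτ]
          exact (mul_le_of_le_one_right (w.nonneg _) hb.1).trans ha.2 }
  obtain ⟨g, hg, hgx⟩ := exists_poly_approx hv hπ S hres hx m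
  have hgA : g.eval π ∈ A := by
    rw [Polynomial.eval_eq_sum_range]
    exact A.sum_mem fun i _ => A.mul_mem ⟨(hg i).2, hS _ (hg i).1 (hg i).2⟩
      (A.pow_mem (show π ∈ A from ⟨hπ.lt_one.le, hm⟩) i)
  rw [show σ x - τ x = (σ (g.eval π) - τ (g.eval π)) + (σ (x - g.eval π) - τ (x - g.eval π)) by
    rw [map_sub, map_sub]; ring]
  refine (hw _ _).trans (max_le hgA.2 ((nonarch_sub_le hw _ _).trans (max_le ?_ ?_)))
  · rwa [hσ]
  · rwa [hτ]

end Dense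

/-! ### An interpolation estimate -/

section Interpolation

variable {F : Type*} [Field F] {v : AbsoluteValue F ℝ}

/-- Newton interpolation over the integers: a polynomial `g` with integral coefficients which is
nearly equal to `c` at integral nodes `x i` differs from `c` at `y` by at most
`∏ i, v (y - x i)`, up to an error coming from the values at the nodes. -/
lemma exists_interpolation_bound (hv : IsNonarchimedean v) {ι : Type*} [Fintype ι] [Nonempty ι]
    (x : ι → F) (hxi : Function.Injective x) (hx : ∀ i, v (x i) ≤ 1) {y : F} (hy : v y ≤ 1) :
    ∃ M : ℝ, 0 ≤ M ∧ ∀ (g : Polynomial F) (c : F) (ε : ℝ), (∀ i, v (g.coeff i) ≤ 1) →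
      (∀ i, v (g.eval (x i) - c) ≤ ε) → v (g.eval y - c) ≤ max (∏ i, v (y - x i)) (ε * M) := by
  classical
  let O : Subring F :=
    { carrier := {x | v x ≤ 1}
      zero_mem' := by simp
      one_mem' := by simp
      neg_mem' := fun {a} h => by simpa using h
      add_mem' := fun {a b} ha hb => (hv _ _).trans (max_le ha hb)
      mul_mem' := fun {a b} ha hb => by
        change v (a * b) ≤ 1
        rw [map_mul]; exact mul_le_one₀ ha (v.nonneg _) hb }
  have hOv : ∀ a : O, v a ≤ 1 := fun a => a.2
  let ℓ : ι → F := fun i => (Lagrange.basis Finset.univ x i).eval y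
  refine ⟨∑ i, v (ℓ i), Finset.sum_nonneg fun i _ => v.nonneg _, fun g c ε hg hε => ?_⟩
  have hε0 : 0 ≤ ε := (v.nonneg _).trans (hε (Classical.arbitrary ι))
  obtain ⟨g₀, rfl⟩ : ∃ g₀ : Polynomial O, g₀.map O.subtype = g := by
    have : g ∈ Polynomial.lifts O.subtype := by
      rw [Polynomial.lifts_iff_coeff_lifts]
      exact fun n => ⟨⟨_, hg n⟩, rfl⟩
    exact (Polynomial.mem_lifts _).1 this
  let f₀ : Polynomial O := ∏ i, (Polynomial.X - Polynomial.C (⟨x i, hx i⟩ : O))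
  have hf₀ : f₀.Monic := Polynomial.monic_prod_X_sub_C _ _
  have hf : f₀.map O.subtype = ∏ i, (Polynomial.X - Polynomial.C (x i)) := by
    simp [f₀, Polynomial.map_prod]
  have hdiv := congrArg (Polynomial.map O.subtype) (Polynomial.modByMonic_add_div g₀ f₀)
  rw [Polynomial.map_add, Polynomial.map_mul] at hdiv
  set r := (g₀ %ₘ f₀).map O.subtype
  set h := (g₀ /ₘ f₀).map O.subtype with hh
  have hfx : ∀ i, (f₀.map O.subtype).eval (x i) = 0 := fun i => by
    rw [hf, Polynomial.eval_prod]
    exact Finset.prod_eq_zero (Finset.mem_univ i) (by simp)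
  have hrx : ∀ i, r.eval (x i) = (g₀.map O.subtype).eval (x i) := fun i => by
    rw [← hdiv, Polynomial.eval_add, Polynomial.eval_mul, hfx, zero_mul, add_zero]
  have hcard : 0 < Fintype.card ι := Fintype.card_pos
  have hr : (r - Polynomial.C c) =
      Lagrange.interpolate Finset.univ x (fun i => (g₀.map O.subtype).eval (x i) - c) := by
    apply Lagrange.eq_interpolate_of_eval_eq _ hxi.injOn
    · refine (Polynomial.degree_sub_le _ _).trans_lt (max_lt ?_ ?_)
      · refine lt_of_le_of_lt Polynomial.degree_map_le ?_
        refine lt_of_lt_of_le (Polynomial.degree_modByMonic_lt _ hf₀) ?_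
        simp [f₀, Polynomial.degree_prod]
      · exact lt_of_le_of_lt Polynomial.degree_C_le (by simpa using hcard)
    · intro i _
      rw [Polynomial.eval_sub, hrx, Polynomial.eval_C]
  have hry : v (r.eval y - c) ≤ ε * ∑ i, v (ℓ i) := by
    have := congrArg (Polynomial.eval y) hr
    rw [Polynomial.eval_sub, Polynomial.eval_C, Lagrange.interpolate_apply,
      Polynomial.eval_finsetSum] at this
    rw [this]
    apply nonarch_sum_le hv
    · exact mul_nonneg hε0 (Finset.sum_nonneg fun i _ => v.nonneg _)
    · intro i _
      rw [Polynomial.eval_mul, Polynomial.eval_C, map_mul]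
      refine mul_le_mul (hε i) ?_ (v.nonneg _) hε0
      exact Finset.single_le_sum (f := fun i => v (ℓ i)) (fun j _ => v.nonneg _) (Finset.mem_univ i)
  have hhy : v (h.eval y) ≤ 1 := by
    have : h.eval y = ((g₀ /ₘ f₀).eval ⟨y, hy⟩ : O) := by
      rw [hh, Polynomial.eval_map]
      exact Polynomial.eval₂_at_apply O.subtype (⟨y, hy⟩ : O)
    rw [this]
    exact hOv _
  rw [← hdiv, Polynomial.eval_add, Polynomial.eval_mul, add_sub_right_comm, max_comm]
  refine (hv _ _).trans (max_le_max hry ?_)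
  rw [map_mul, hf, Polynomial.eval_prod, map_prod]
  simp only [Polynomial.eval_sub, Polynomial.eval_X, Polynomial.eval_C]
  exact mul_le_of_le_one_right (Finset.prod_nonneg fun i _ => v.nonneg _) hhy

end Interpolation

/-! ### Ramification in extensions with trivial residue extension -/

section Herbrand

/-- The residue field extension of `F / k` is trivial. -/
def IsResTrivial (k F : Type*) [NontriviallyNormedField k] [IsUltrametricDist k] [CompleteSpace k]
    [Field F] [Algebra k F] [Algebra.IsAlgebraic k F] : Prop :=
  ∀ x : F, extAbs k F x ≤ 1 → ∃ t : k, extAbs k F (x - algebraMap k F t) < 1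

/-- The ramification number of `σ`, truncated at `r`, where `i` counts the ramification numbers
as exponents of a uniformizer. -/
def ramTrunc {G : Type*} [One G] [DecidableEq G] (i : G → ℕ) (σ : G) (r : ℝ) : ℝ :=
  if σ = 1 then r else min r (i σ - 1)

variable {k F : Type*} [NontriviallyNormedField k] [IsUltrametricDist k] [CompleteSpace k]
  [Field F] [Algebra k F] [Algebra.IsAlgebraic k F]

lemma IsResTrivial.exists_mem_range (h : IsResTrivial k F) (x : F) (hx : extAbs k F x ≤ 1) :
    ∃ t ∈ (algebraMap k F).range, extAbs k F t ≤ 1 ∧ extAbs k F (x - t) < 1 := by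
  obtain ⟨t, ht⟩ := h x hx
  refine ⟨_, ⟨t, rfl⟩, ?_, ht⟩
  have := nonarch_sub_le (isNonarchimedean_extAbs k F) x (x - algebraMap k F t)
  rw [sub_sub_cancel] at this
  exact this.trans (max_le hx ht.le)

lemma IsResTrivial.lowerRam_zero (h : IsResTrivial k F) : lowerRam k F 0 = ⊤ := by
  rw [eq_top_iff]
  intro σ _
  rw [mem_lowerRam_zero_iff]
  intro x hx
  obtain ⟨t, ht⟩ := h x hx
  have : σ x - x = σ (x - algebraMap k F t) - (x - algebraMap k F t) := by simp
  rw [this]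
  refine (nonarch_sub_le (isNonarchimedean_extAbs k F) _ _).trans_lt (max_lt ?_ ht)
  rwa [extAbs_algEquiv]

variable {π : F} (h : IsResTrivial k F) (hπ : IsUnif (extAbs k F) π)
include h hπ

lemma IsResTrivial.sub_le {σ : Gal(F/k)} {m : ℕ}
    (hm : extAbs k F (σ π - π) ≤ extAbs k F π ^ m) {x : F} (hx : extAbs k F x ≤ 1) :
    extAbs k F (σ x - x) ≤ extAbs k F π ^ m := by
  refine sub_le_of_unif (isNonarchimedean_extAbs k F) hπ (algebraMap k F).range h.exists_mem_range
    (isNonarchimedean_extAbs k F) (σ : F →+* F) (RingHom.id F) (fun x => extAbs_algEquiv σ x)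
    (fun _ => rfl) m ?_ hm hx
  rintro _ ⟨t, rfl⟩ _
  simp [pow_nonneg hπ.pos.le m]

lemma IsResTrivial.mem_lowerRam_iff {σ : Gal(F/k)} {r : ℝ} :
    σ ∈ lowerRam k F r ↔ extAbs k F (σ π - π) ≤ extAbs k F π ^ ⌈r + 1⌉₊ := by
  rw [LieTower.mem_lowerRam_iff hπ]
  exact ⟨fun H => H π hπ.lt_one.le, fun H x hx => h.sub_le hπ H hx⟩

lemma IsResTrivial.eq_one_of_apply_eq {σ : Gal(F/k)} (hσ : σ π = π) : σ = 1 := by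
  have key : ∀ x, extAbs k F x ≤ 1 → σ x = x := by
    intro x hx
    rw [← sub_eq_zero, ← (extAbs k F).eq_zero]
    refine le_antisymm ?_ ((extAbs k F).nonneg _)
    refine ge_of_tendsto' (tendsto_pow_atTop_nhds_zero_of_lt_one hπ.pos.le hπ.lt_one) fun m => ?_
    exact h.sub_le hπ (by simp [hσ, pow_nonneg hπ.pos.le m]) hx
  ext x
  rcases le_total (extAbs k F x) 1 with hx | hx
  · exact key x hx
  · have := key x⁻¹ (by rw [map_inv₀]; exact inv_le_one_of_one_le₀ hx)
    rw [map_inv₀, inv_inj] at this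
    exact this

/-- The ramification number `i σ` is the exponent with `‖σ π - π‖ = ‖π‖ ^ i σ`; its value at `σ = 1`,
where `σ π - π = 0`, is not used. -/
lemma IsResTrivial.exists_ramNum :
    ∃ i : Gal(F/k) → ℕ, ∀ σ, σ ≠ 1 → extAbs k F (σ π - π) = extAbs k F π ^ i σ ∧ 1 ≤ i σ := by
  have : ∀ σ : Gal(F/k), ∃ n : ℕ,
      σ ≠ 1 → extAbs k F (σ π - π) = extAbs k F π ^ n ∧ 1 ≤ n := by
    intro σ
    by_cases hσ : σ = 1
    · exact ⟨0, fun h => absurd hσ h⟩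
    have h0 : σ π - π ≠ 0 := fun h1 => hσ (h.eq_one_of_apply_eq hπ (sub_eq_zero.1 h1))
    have hle : extAbs k F (σ π - π) ≤ extAbs k F π :=
      (nonarch_sub_le (isNonarchimedean_extAbs k F) _ _).trans
        (max_le (extAbs_algEquiv σ π).le le_rfl)
    obtain ⟨n, hn⟩ := hπ.exists_pow h0 (hle.trans hπ.lt_one.le)
    refine ⟨n, fun _ => ⟨hn, ?_⟩⟩
    rw [hn] at hle
    exact hπ.pow_le_pow.1 (by simpa using hle)
  choose i hi using this
  exact ⟨i, hi⟩

variable {i : Gal(F/k) → ℕ}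
  (hi : ∀ σ, σ ≠ 1 → extAbs k F (σ π - π) = extAbs k F π ^ i σ ∧ 1 ≤ i σ)
include hi

lemma IsResTrivial.mem_lowerRam_iff_ramNum {σ : Gal(F/k)} {r : ℝ} :
    σ ∈ lowerRam k F r ↔ σ = 1 ∨ r ≤ i σ - 1 := by
  by_cases hσ : σ = 1
  · simp [hσ, one_mem]
  rw [h.mem_lowerRam_iff hπ, (hi σ hσ).1, hπ.pow_le_pow, Nat.ceil_le, le_sub_iff_add_le]
  simp [hσ]

variable [DecidableEq Gal(F/k)]

/-- The truncated ramification number is the largest `c ≤ r` with `σ ∈ G_c`, so that its behaviour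
under products and inverses reflects that the `G_c` are subgroups. -/
lemma IsResTrivial.le_ramTrunc_iff {σ : Gal(F/k)} {r c : ℝ} :
    c ≤ ramTrunc i σ r ↔ c ≤ r ∧ σ ∈ lowerRam k F c := by
  rw [h.mem_lowerRam_iff_ramNum hπ hi, ramTrunc]
  split_ifs with hσ
  · simp [hσ]
  · simp [hσ]

omit h hπ in
lemma IsResTrivial.ramTrunc_nonneg {σ : Gal(F/k)} {r : ℝ} (hr : 0 ≤ r) :
    0 ≤ ramTrunc i σ r := by
  rw [ramTrunc]
  split_ifs with hσ
  · exact hr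
  · have : (1 : ℝ) ≤ i σ := by exact_mod_cast (hi σ hσ).2
    exact le_min hr (by linarith)

lemma IsResTrivial.ramTrunc_mul {σ τ : Gal(F/k)} {r : ℝ} :
    min (ramTrunc i σ r) (ramTrunc i τ r) ≤ ramTrunc i (σ * τ) r := by
  rw [h.le_ramTrunc_iff hπ hi]
  have h1 := (h.le_ramTrunc_iff hπ hi).1 (min_le_left (ramTrunc i σ r) (ramTrunc i τ r))
  have h2 := (h.le_ramTrunc_iff hπ hi).1 (min_le_right (ramTrunc i σ r) (ramTrunc i τ r))
  exact ⟨h1.1, mul_mem h1.2 h2.2⟩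

lemma IsResTrivial.ramTrunc_inv {σ : Gal(F/k)} {r : ℝ} :
    ramTrunc i σ⁻¹ r = ramTrunc i σ r := by
  have : ∀ σ : Gal(F/k), ramTrunc i σ r ≤ ramTrunc i σ⁻¹ r := fun σ => by
    rw [h.le_ramTrunc_iff hπ hi]
    have h1 := (h.le_ramTrunc_iff hπ hi).1 (le_refl (ramTrunc i σ r))
    exact ⟨h1.1, inv_mem h1.2⟩
  refine le_antisymm ?_ (this σ)
  simpa using this σ⁻¹

variable [FiniteDimensional k F]

/-- The Herbrand function as a sum: the integrand is the proportion of the `σ` lying in `G_w`, and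
integrating over `w` for each `σ` gives its truncated ramification number. -/
lemma IsResTrivial.card_mul_herbrandPhi {r : ℝ} (hr : 0 ≤ r) :
    (Fintype.card Gal(F/k) : ℝ) * herbrandPhi k F r = ∑ σ, ramTrunc i σ r := by
  classical
  have hind : ∀ w ∈ Set.uIcc 0 r,
      (((lowerRam k F w).relIndex (lowerRam k F 0) : ℕ) : ℝ)⁻¹ =
      (Fintype.card Gal(F/k) : ℝ)⁻¹ * ∑ σ, (if σ ∈ lowerRam k F w then (1 : ℝ) else 0) := by
    intro w _
    rw [h.lowerRam_zero, Subgroup.relIndex_top_right, Finset.sum_boole,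
      ← Fintype.card_subtype, ← Nat.card_eq_fintype_card, ← Nat.card_eq_fintype_card,
      ← Subgroup.card_mul_index (lowerRam k F w)]
    have h1 : (Nat.card (lowerRam k F w) : ℝ) ≠ 0 := by exact_mod_cast Nat.card_pos.ne'
    push_cast
    rw [mul_inv_rev, mul_assoc]
    change _ = _ * ((Nat.card (lowerRam k F w) : ℝ)⁻¹ * (Nat.card (lowerRam k F w) : ℝ))
    rw [inv_mul_cancel₀ h1, mul_one]
  have hint : ∀ σ : Gal(F/k), IntervalIntegrable
      (fun w => if σ ∈ lowerRam k F w then (1 : ℝ) else 0) MeasureTheory.volume 0 r ∧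
      ∫ w in (0 : ℝ)..r, (if σ ∈ lowerRam k F w then (1 : ℝ) else 0) = ramTrunc i σ r := by
    intro σ
    by_cases hσ : σ = 1
    · simp [hσ, one_mem, ramTrunc]
    · have h1 : (1 : ℝ) ≤ i σ := by exact_mod_cast (hi σ hσ).2
      have e : (fun w => if σ ∈ lowerRam k F w then (1 : ℝ) else 0) =
          {x | x ≤ (i σ - 1 : ℝ)}.indicator (fun _ => 1) := by
        ext w
        simp only [h.mem_lowerRam_iff_ramNum hπ hi, hσ, false_or, Set.indicator, Set.mem_ofPred_eq]
      rw [e]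
      constructor
      · rw [intervalIntegrable_iff]
        exact (MeasureTheory.integrableOn_const (by simp)).indicator measurableSet_Iic
      · rw [ramTrunc, if_neg hσ]
        rcases le_total r (i σ - 1 : ℝ) with h2 | h2
        · rw [min_eq_left h2, intervalIntegral.integral_congr (g := fun _ => (1 : ℝ))]
          · simp
          · intro x hx
            rw [Set.uIcc_of_le hr] at hx
            simp only [Set.indicator, Set.mem_ofPred_eq]
            rw [if_pos (hx.2.trans h2)]
        · rw [min_eq_right h2, intervalIntegral.integral_indicator ⟨by linarith, h2⟩]
          simp
  rw [herbrandPhi, if_pos hr, intervalIntegral.integral_congr hind,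
    intervalIntegral.integral_const_mul, intervalIntegral.integral_finsetSum fun σ _ => (hint σ).1,
    ← mul_assoc, mul_inv_cancel₀ (by simp), one_mul]
  exact Finset.sum_congr rfl fun σ _ => (hint σ).2

omit [DecidableEq Gal(F/k)] hi
lemma IsResTrivial.herbrandPhi_strictMono : StrictMono (herbrandPhi k F) := by
  classical
  obtain ⟨i, hi⟩ := h.exists_ramNum hπ
  have hc : (0 : ℝ) < Fintype.card Gal(F/k) := by exact_mod_cast Fintype.card_pos
  have h0 : herbrandPhi k F 0 = 0 := by simp [herbrandPhi]
  have hpos : ∀ r s : ℝ, 0 ≤ r → r < s → herbrandPhi k F r < herbrandPhi k F s := by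
    intro r s hr hrs
    refine lt_of_mul_lt_mul_left ?_ hc.le
    rw [h.card_mul_herbrandPhi hπ hi hr, h.card_mul_herbrandPhi hπ hi (hr.trans hrs.le)]
    refine Finset.sum_lt_sum (fun σ _ => ?_) ⟨1, Finset.mem_univ _, by simpa [ramTrunc] using hrs⟩
    rw [ramTrunc, ramTrunc]
    split_ifs
    · exact hrs.le
    · exact min_le_min_right _ hrs.le
  have hneg : ∀ r : ℝ, r < 0 → herbrandPhi k F r = r := fun r hr => by
    rw [herbrandPhi, if_neg (not_le.2 hr)]
  intro r s hrs
  rcases le_or_gt 0 r with hr | hr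
  · exact hpos r s hr hrs
  · rw [hneg r hr]
    rcases lt_trichotomy s 0 with hs | hs | hs
    · rwa [hneg s hs]
    · rw [hs, h0]; exact hr
    · have := hpos 0 s le_rfl hs
      rw [h0] at this
      exact hr.trans this

/-- `herbrandPsi` really is a right inverse of `herbrandPhi` on `[-1, ∞)`, by the intermediate value
theorem. -/
lemma IsResTrivial.herbrandPsi_spec {v : ℝ} (hv : -1 ≤ v) :
    -1 ≤ herbrandPsi k F v ∧ herbrandPhi k F (herbrandPsi k F v) = v := by
  have : ∃ u ∈ Set.Ici (-1 : ℝ), herbrandPhi k F u = v := by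
    classical
    rcases lt_or_ge v 0 with hv0 | hv0
    · exact ⟨v, hv, by rw [herbrandPhi, if_neg (not_le.2 hv0)]⟩
    obtain ⟨i, hi⟩ := h.exists_ramNum hπ
    have hc : (1 : ℝ) ≤ Fintype.card Gal(F/k) := by exact_mod_cast Fintype.card_pos
    have hc0 : (0 : ℝ) < Fintype.card Gal(F/k) := by linarith
    -- a continuous function which agrees with `herbrandPhi` on `[0, ∞)` and is at least `v` at `R`
    let f : ℝ → ℝ := fun r => (Fintype.card Gal(F/k) : ℝ)⁻¹ * ∑ σ, ramTrunc i σ r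
    have hf : Continuous f := by
      refine continuous_const.mul (continuous_finsetSum _ fun σ _ => ?_)
      by_cases hσ : σ = 1
      · exact (continuous_id (X := ℝ)).congr fun r => by simp [ramTrunc, hσ]
      · exact ((continuous_id (X := ℝ)).min (continuous_const (y := (i σ : ℝ) - 1))).congr fun r => by
          simp [ramTrunc, hσ]
    have hfφ : ∀ r, 0 ≤ r → herbrandPhi k F r = f r := fun r hr => by
      simp only [f]
      rw [← h.card_mul_herbrandPhi hπ hi hr, ← mul_assoc, inv_mul_cancel₀ hc0.ne', one_mul]
    set R := Fintype.card Gal(F/k) * v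
    have hR : 0 ≤ R := mul_nonneg hc0.le hv0
    have h0 : f 0 ≤ v := by rw [← hfφ 0 le_rfl]; simpa [herbrandPhi] using hv0
    have h1 : v ≤ f R := by
      simp only [f]
      rw [← div_eq_inv_mul, le_div_iff₀ hc0, mul_comm]
      refine le_trans (b := ramTrunc i 1 R) (by simp [ramTrunc, R]) ?_
      exact Finset.single_le_sum (f := fun σ => ramTrunc i σ R)
        (fun σ _ => IsResTrivial.ramTrunc_nonneg hi hR) (Finset.mem_univ _)
    obtain ⟨u, hu, huv⟩ := intermediate_value_Icc hR hf.continuousOn ⟨h0, h1⟩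
    exact ⟨u, by simp only [Set.mem_Ici]; linarith [hu.1], by rw [hfφ u hu.1, huv]⟩
  exact ⟨Function.invFunOn_mem this, Function.invFunOn_eq this⟩

lemma IsResTrivial.herbrandPsi_zero : herbrandPsi k F 0 = 0 := by
  apply (h.herbrandPhi_strictMono hπ).injective
  rw [(h.herbrandPsi_spec hπ (by norm_num)).2]
  simp [herbrandPhi]

end Herbrand

/-! ### Herbrand's theorem -/

section Quotient

lemma IsResTrivial.of_tower {k E F : Type*} [NontriviallyNormedField k] [IsUltrametricDist k]
    [CompleteSpace k] [Field F] [Algebra k F] [Algebra.IsAlgebraic k F] [Field E] [Algebra k E]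
    [Algebra.IsAlgebraic k E] [Algebra E F] [IsScalarTower k E F] (h : IsResTrivial k F) :
    IsResTrivial k E := fun x hx => by
  obtain ⟨t, ht⟩ := h (algebraMap E F x) (by rwa [extAbs_tower])
  exact ⟨t, by rwa [IsScalarTower.algebraMap_apply k E F, ← map_sub, extAbs_tower] at ht⟩

open AlgEquiv in
lemma card_fiber_restrictNormalHom {k E F : Type*} [Field k] [Field F] [Algebra k F]
    [FiniteDimensional k F] [IsGalois k F] [Field E] [Algebra k E] [FiniteDimensional k E]
    [IsGalois k E] [Algebra E F] [IsScalarTower k E F] [DecidableEq Gal(E/k)] (τ : Gal(E/k)) :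
    (Finset.univ.filter fun t : Gal(F/k) => restrictNormalHom E t = τ).card
      = Module.finrank E F := by
  have : FiniteDimensional E F := FiniteDimensional.right k E F
  have hsurj : ∀ τ : Gal(E/k), τ ∈ Set.range (restrictNormalHom (F := k) (K₁ := F) E) := fun τ =>
    restrictNormalHom_surjective F τ
  have hconst : ∀ τ' : Gal(E/k),
      (Finset.univ.filter fun t : Gal(F/k) => restrictNormalHom E t = τ').card =
      (Finset.univ.filter fun t : Gal(F/k) => restrictNormalHom E t = τ).card := fun τ' =>
    MonoidHom.card_fiber_eq_of_mem_range _ (hsurj _) (hsurj _)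
  have h1 := Finset.card_eq_sum_card_fiberwise (s := (Finset.univ : Finset Gal(F/k)))
    (t := (Finset.univ : Finset Gal(E/k))) (f := fun t => restrictNormalHom E t) (by simp)
  simp only [hconst, Finset.sum_const, smul_eq_mul, Finset.card_univ,
    ← Nat.card_eq_fintype_card, IsGalois.card_aut_eq_finrank] at h1
  rw [← Module.finrank_mul_finrank k E F] at h1
  exact (Nat.eq_of_mul_eq_mul_left Module.finrank_pos h1).symm

variable {k E F : Type*} [NontriviallyNormedField k] [IsUltrametricDist k] [CompleteSpace k]
  [Field F] [Algebra k F] [FiniteDimensional k F] [IsGalois k F]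
  [Field E] [Algebra k E] [FiniteDimensional k E] [IsGalois k E]
  [Algebra E F] [IsScalarTower k E F]

variable {π : F} (h : IsResTrivial k F) (hπ : IsUnif (extAbs k F) π)

include hπ in
omit [FiniteDimensional k E] in
/-- The absolute value of the norm of a uniformizer of `F` is at most that of a uniformizer of `E`. -/
lemma pow_finrank_le_unif {ϖ : E} (hϖ : IsUnif (extAbs k E) ϖ) :
    extAbs k F π ^ Module.finrank E F ≤ extAbs k E ϖ := by
  have : IsGalois E F := IsGalois.tower_top_of_isGalois k E F
  have : FiniteDimensional E F := FiniteDimensional.right k E F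
  have e : extAbs k E (Algebra.norm E π) = extAbs k F π ^ Module.finrank E F := by
    rw [← extAbs_tower (F := F), Algebra.norm_eq_prod_automorphisms, map_prod,
      ← IsGalois.card_aut_eq_finrank, Nat.card_eq_fintype_card]
    have : ∀ σ : Gal(F/E), extAbs k F (σ π) = extAbs k F π := fun σ =>
      extAbs_algEquiv (σ.restrictScalars k) π
    simp [this]
  rw [← e]
  apply hϖ.le
  rw [e]
  exact pow_lt_one₀ hπ.pos.le hπ.lt_one Module.finrank_pos.ne'

open AlgEquiv in
include h hπ in
omit [FiniteDimensional k E] in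
/-- The half of the formula for the ramification numbers of a quotient which Herbrand's theorem
uses: an integer of `E` is a polynomial in `π` up to a small error, and interpolating this
polynomial at the conjugates of `π` over `τ` gives the bound. -/
lemma IsResTrivial.apply_sub_le_prod [DecidableEq Gal(E/k)] {τ : Gal(E/k)} (hτ : τ ≠ 1) {y : E}
    (hy : extAbs k E y ≤ 1) :
    extAbs k E (τ y - y) ≤
      ∏ t ∈ Finset.univ.filter (fun t : Gal(F/k) => restrictNormalHom E t = τ),
        extAbs k F (t π - π) := by
  set v := extAbs k F
  have hv : IsNonarchimedean v := isNonarchimedean_extAbs k F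
  let ι := {t : Gal(F/k) // restrictNormalHom E t = τ}
  have : Nonempty ι := by
    obtain ⟨t, ht⟩ := restrictNormalHom_surjective F τ
    exact ⟨⟨t, ht⟩⟩
  have hπt : ∀ t : Gal(F/k), v (t π) = v π := fun t => extAbs_algEquiv t π
  have htE : ∀ (t : ι) (z : E), t.1 (algebraMap E F z) = algebraMap E F (τ z) := fun t z => by
    have := restrictNormal_commutes t.1 E z
    exact this.symm.trans (congrArg (fun s : Gal(E/k) => algebraMap E F (s z)) t.2)
  have hinj : Function.Injective fun t : ι => t.1 π := fun s t hst => by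
    apply Subtype.ext
    have := h.eq_one_of_apply_eq hπ (σ := s.1⁻¹ * t.1) (by
      change s.1⁻¹ (t.1 π) = π
      rw [← show s.1 π = t.1 π from hst]
      exact s.1.symm_apply_apply π)
    exact (inv_mul_eq_one.1 this)
  obtain ⟨M, hM0, hM⟩ := exists_interpolation_bound hv (fun t : ι => t.1 π) hinj
    (fun t => (hπt t).trans_le hπ.lt_one.le) hπ.lt_one.le
  rw [← Finset.prod_subtype_eq_prod_filter, Finset.subtype_univ]
  set P := ∏ t : ι, v (t.1 π - π) with hP
  have hP' : ∏ t : ι, v (π - t.1 π) = P :=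
    Finset.prod_congr rfl fun t _ => (AbsoluteValue.map_sub _ _ _)
  have hP0 : 0 < P := by
    refine Finset.prod_pos fun t _ => v.pos fun h0 => hτ ?_
    have := h.eq_one_of_apply_eq hπ (sub_eq_zero.1 h0)
    rw [← t.2, this, map_one]
  -- `M` does not depend on the polynomial `g`, so that the error terms tend to `0` with `m`
  have key : ∀ m : ℕ, extAbs k E (τ y - y) ≤ max (v π ^ m) (max P (v π ^ m * M)) := by
    intro m
    have hy' : v (algebraMap E F y) ≤ 1 := by rwa [extAbs_tower]
    obtain ⟨g, hg, hgy⟩ := exists_poly_approx hv hπ (algebraMap k F).range h.exists_mem_range hy' m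
    have hgt : ∀ t : Gal(F/k), t (g.eval π) = g.eval (t π) := by
      intro t
      rw [Polynomial.eval_eq_sum_range, Polynomial.eval_eq_sum_range, map_sum]
      refine Finset.sum_congr rfl fun j _ => ?_
      obtain ⟨c, hc⟩ := (hg j).1
      rw [← hc, map_mul, map_pow, t.commutes]
    have h1 : v (g.eval π - algebraMap E F (τ y)) ≤ max P (v π ^ m * M) := by
      rw [← hP']
      refine hM g _ _ (fun j => (hg j).2) fun t => ?_
      rw [← hgt, ← htE t y, ← map_sub, extAbs_algEquiv, AbsoluteValue.map_sub]
      exact hgy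
    rw [← extAbs_tower (F := F), ← neg_sub, map_neg, AbsoluteValue.map_neg, map_sub,
      ← sub_add_sub_cancel _ (g.eval π) _]
    exact (hv _ _).trans (max_le_max hgy h1)
  obtain ⟨m, hm⟩ := exists_pow_lt_of_lt_one (y := v π) (div_pos hP0 (show 0 < 1 + M by linarith))
    hπ.lt_one
  rw [lt_div_iff₀ (by linarith)] at hm
  have hm0 : 0 ≤ v π ^ m := pow_nonneg hπ.pos.le m
  refine (key m).trans (max_le ?_ (max_le le_rfl ?_)) <;> nlinarith [mul_nonneg hm0 hM0]

open AlgEquiv in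
include h hπ in
/-- **Herbrand's theorem**: restriction maps the upper ramification groups into those of a
quotient. -/
theorem IsResTrivial.restrict_mem_finUpperRam {ϖ : E} (hϖ : IsUnif (extAbs k E) ϖ) {r : ℝ}
    (hr : -1 ≤ r) {σ : Gal(F/k)} (hσ : σ ∈ finUpperRam k F r) :
    restrictNormalHom E σ ∈ finUpperRam k E r := by
  classical
  have hE : IsResTrivial k E := h.of_tower
  obtain ⟨i, hi⟩ := h.exists_ramNum hπ
  obtain ⟨j, hj⟩ := hE.exists_ramNum hϖ
  rw [finUpperRam] at hσ ⊢
  obtain ⟨hu, hφu⟩ := h.herbrandPsi_spec hπ hr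
  obtain ⟨hw, hφw⟩ := hE.herbrandPsi_spec hϖ hr
  set u := herbrandPsi k F r
  set w := herbrandPsi k E r
  -- for `w ≤ 0` the group `G_w` is everything, as the extension is totally ramified
  rcases le_or_gt w 0 with hw0 | hw0
  · rw [hE.mem_lowerRam_iff_ramNum hϖ hj]
    by_cases h1 : restrictNormalHom E σ = 1
    · exact Or.inl h1
    · right
      have : (1 : ℝ) ≤ j (restrictNormalHom E σ) := by exact_mod_cast (hj _ h1).2
      linarith
  have hr0 : 0 < r := by
    rw [← hφw, show (0 : ℝ) = herbrandPhi k E 0 by simp [herbrandPhi]]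
    exact hE.herbrandPhi_strictMono hϖ hw0
  have hu0 : 0 ≤ u := by
    by_contra hc
    have hlt := h.herbrandPhi_strictMono hπ (not_le.1 hc)
    rw [hφu, show herbrandPhi k F 0 = 0 by simp [herbrandPhi]] at hlt
    linarith
  have : FiniteDimensional E F := FiniteDimensional.right k E F
  set d := Module.finrank E F with hd
  have hd0 : (0 : ℝ) < d := by exact_mod_cast Module.finrank_pos
  let fib : Gal(E/k) → Finset Gal(F/k) := fun τ =>
    Finset.univ.filter fun t : Gal(F/k) => restrictNormalHom E t = τ
  have hmem : ∀ {τ t}, t ∈ fib τ ↔ restrictNormalHom E t = τ := by simp [fib]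
  have hfc : ∀ τ, ((fib τ).card : ℝ) = d := fun τ => by
    rw [card_fiber_restrictNormalHom (F := F) τ]
  set Φ : ℝ := (d : ℝ)⁻¹ * ∑ n ∈ fib 1, ramTrunc i n u with hΦ
  have hdΦ : d * Φ = ∑ n ∈ fib 1, ramTrunc i n u := by
    rw [hΦ, ← mul_assoc, mul_inv_cancel₀ hd0.ne', one_mul]
  have hΦ0 : 0 ≤ Φ := mul_nonneg (inv_nonneg.2 hd0.le) (Finset.sum_nonneg fun _ _ =>
    IsResTrivial.ramTrunc_nonneg hi hu0)
  -- the sum of the ramification numbers over a fiber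
  have hsum : ∀ τ : Gal(E/k), τ ≠ 1 → ∑ t ∈ fib τ, ramTrunc i t u ≤ d * (j τ - 1) := by
    intro τ hτ
    have hne : ∀ t ∈ fib τ, t ≠ 1 := fun t ht h1 => hτ (by rw [← hmem.1 ht, h1, map_one])
    have h1 := h.apply_sub_le_prod hπ hτ hϖ.lt_one.le
    rw [(hj τ hτ).1, Finset.prod_congr rfl fun t ht => (hi t (hne t ht)).1,
      Finset.prod_pow_eq_pow_sum] at h1
    have h2 := pow_finrank_le_unif (E := E) hπ hϖ
    have h3 := (pow_le_pow_left₀ (pow_nonneg hπ.pos.le _) h2 (j τ)).trans h1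
    rw [← pow_mul, hπ.pow_le_pow] at h3
    have h4 : (∑ t ∈ fib τ, (i t : ℝ)) ≤ d * j τ := by exact_mod_cast h3
    calc ∑ t ∈ fib τ, ramTrunc i t u ≤ ∑ t ∈ fib τ, ((i t : ℝ) - 1) := by
          refine Finset.sum_le_sum fun t ht => ?_
          rw [ramTrunc, if_neg (hne t ht)]
          exact min_le_right _ _
      _ = ∑ t ∈ fib τ, (i t : ℝ) - d := by
          rw [Finset.sum_sub_distrib, Finset.sum_const, nsmul_one, hfc]
      _ ≤ d * (j τ - 1) := by linarith
  -- translating a fiber to the kernel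
  have htrans : ∀ (τ : Gal(E/k)) (t₀ : Gal(F/k)), restrictNormalHom E t₀ = τ →
      ∀ f : Gal(F/k) → ℝ, ∑ t ∈ fib τ, f t = ∑ n ∈ fib 1, f (t₀ * n) := by
    intro τ t₀ ht₀ f
    refine (Finset.sum_bij (fun n _ => t₀ * n) ?_ (fun _ _ _ _ h => mul_left_cancel h) ?_
      fun _ _ => rfl).symm
    · intro n hn
      rw [hmem] at hn ⊢
      rw [map_mul, hn, mul_one, ht₀]
    · intro t ht
      refine ⟨t₀⁻¹ * t, ?_, by group⟩
      rw [hmem] at ht ⊢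
      rw [map_mul, map_inv, ht, ht₀, inv_mul_cancel]
  have hle : ∀ τ : Gal(E/k), ∑ t ∈ fib τ, ramTrunc i t u ≤ d * ramTrunc j τ Φ := by
    intro τ
    by_cases hτ : τ = 1
    · rw [hτ, ramTrunc, if_pos rfl, hdΦ]
    · rw [show ramTrunc j τ Φ = min Φ (j τ - 1) by rw [ramTrunc, if_neg hτ],
        mul_min_of_nonneg _ _ hd0.le]
      refine le_min ?_ (hsum τ hτ)
      obtain ⟨s, hs⟩ := restrictNormalHom_surjective (F := k) (K₁ := E) F τ
      -- the fiber is a coset of the kernel, based at an element of maximal ramification number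
      obtain ⟨t₀, ht₀, hmax⟩ := Finset.exists_max_image (fib τ) (fun t => ramTrunc i t u)
        ⟨s, hmem.2 hs⟩
      rw [hdΦ, htrans τ t₀ (hmem.1 ht₀)]
      refine Finset.sum_le_sum fun n hn => ?_
      have h1 := hmax (t₀ * n) (by
        rw [hmem] at hn ht₀ ⊢
        rw [map_mul, hn, mul_one, ht₀])
      have h2 := h.ramTrunc_mul hπ hi (σ := t₀⁻¹) (τ := t₀ * n) (r := u)
      rw [h.ramTrunc_inv hπ hi, min_eq_right h1, inv_mul_cancel_left] at h2
      exact h2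
  -- `Φ` is the value at `u` of the Herbrand function of `F / E`, and the estimate says that
  -- `φ_{F/k} u ≤ φ_{E/k} Φ`
  have hwΦ : w ≤ Φ := by
    rw [← (hE.herbrandPhi_strictMono hϖ).le_iff_le, hφw]
    have h1 := h.card_mul_herbrandPhi hπ hi hu0
    have h2 := hE.card_mul_herbrandPhi hϖ hj hΦ0
    rw [hφu] at h1
    have h3 : ∑ t : Gal(F/k), ramTrunc i t u = ∑ τ : Gal(E/k), ∑ t ∈ fib τ, ramTrunc i t u :=
      (Finset.sum_fiberwise _ _ _).symm
    have hcard : (Fintype.card Gal(F/k) : ℝ) = d * Fintype.card Gal(E/k) := by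
      rw [← Nat.card_eq_fintype_card, ← Nat.card_eq_fintype_card, IsGalois.card_aut_eq_finrank,
        IsGalois.card_aut_eq_finrank, ← Module.finrank_mul_finrank k E F]
      push_cast
      ring
    have hcpos : (0 : ℝ) < d * Fintype.card Gal(E/k) :=
      mul_pos hd0 (by exact_mod_cast Fintype.card_pos)
    refine le_of_mul_le_mul_left ?_ hcpos
    rw [← hcard, h1, h3, hcard, mul_assoc, h2, Finset.mul_sum]
    exact Finset.sum_le_sum fun τ _ => hle τ
  rw [hE.mem_lowerRam_iff_ramNum hϖ hj]
  by_cases hσ1 : restrictNormalHom E σ = 1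
  · exact Or.inl hσ1
  right
  refine hwΦ.trans (le_of_mul_le_mul_left ?_ hd0)
  refine le_trans ?_ (hsum _ hσ1)
  rw [hdΦ, htrans _ σ rfl]
  refine Finset.sum_le_sum fun n _ => ?_
  have h1 := h.ramTrunc_mul hπ hi (σ := σ) (τ := n) (r := u)
  have h2 : u ≤ ramTrunc i σ u := (h.le_ramTrunc_iff hπ hi).2 ⟨le_rfl, hσ⟩
  have h3 : ramTrunc i n u ≤ u := ((h.le_ramTrunc_iff hπ hi).1 le_rfl).1
  rwa [min_eq_right (h3.trans h2)] at h1

end Quotient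

/-! ### Unramified base change -/

section BaseChange

/-- The absolute value of an extension does not change under an isometric base change. -/
lemma extAbs_baseChange {K E K' E' : Type*} [NontriviallyNormedField K] [IsUltrametricDist K]
    [CompleteSpace K] [Field E] [Algebra K E] [Algebra.IsAlgebraic K E]
    [NontriviallyNormedField K'] [IsUltrametricDist K'] [CompleteSpace K'] [Field E'] [Algebra K' E']
    [Algebra.IsAlgebraic K' E'] [Algebra K K'] [Algebra E E'] [Algebra K E'] [IsScalarTower K E E']
    [IsScalarTower K K' E'] (hn : ∀ x : K, ‖algebraMap K K' x‖ = ‖x‖) (x : E) :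
    extAbs K' E' (algebraMap E E' x) = extAbs K E x :=
  (extAbs_unique ((extAbs K' E').comp (algebraMap E E').injective) (fun x => by
    change extAbs K' E' (algebraMap E E' (algebraMap K E x)) = _
    rw [← IsScalarTower.algebraMap_apply, IsScalarTower.algebraMap_apply K K' E', extAbs_algebraMap,
      hn]) x).symm

/-- The map restricting automorphisms of `E' / K'` to a normal extension `E / K`. -/
abbrev baseChangeRes (K E K' E' : Type*) [Field K] [Field E] [Field K'] [Field E'] [Algebra K E]
    [Algebra K' E'] [Algebra K K'] [Algebra E E'] [Algebra K E'] [IsScalarTower K E E']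
    [IsScalarTower K K' E'] [Normal K E] : Gal(E'/K') →* Gal(E/K) :=
  IntermediateField.restrictRestrictAlgEquivMapHom K E K' E'

section Field

variable {K E K' E' : Type*} [Field K] [Field E] [Field K'] [Field E'] [Algebra K E]
    [Algebra K' E'] [Algebra K K'] [Algebra E E'] [Algebra K E'] [IsScalarTower K E E']
    [IsScalarTower K K' E']

lemma algebraMap_baseChangeRes [Normal K E] (σ : Gal(E'/K')) (x : E) :
    algebraMap E E' (baseChangeRes K E K' E' σ x) = σ (algebraMap E E' x) :=
  AlgEquiv.restrictNormal_commutes _ E x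

/-- An automorphism of `E' / K'` is determined by its restriction to `E` if `E` generates `E'`. -/
lemma baseChangeRes_injective [Normal K E]
    (h : IntermediateField.adjoin K' (Set.range (algebraMap E E')) = ⊤) :
    Function.Injective (baseChangeRes K E K' E') := by
  rw [injective_iff_map_eq_one]
  intro σ hσ
  have h1 : ∀ x : E, σ (algebraMap E E' x) = algebraMap E E' x := fun x => by
    rw [← algebraMap_baseChangeRes (K := K), hσ, AlgEquiv.one_apply]
  have h2 : (⊤ : IntermediateField K' E') ≤
      IntermediateField.fixedField (Subgroup.zpowers σ) := by
    rw [← h, IntermediateField.adjoin_le_iff]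
    rintro _ ⟨x, rfl⟩
    rintro ⟨τ, hτ⟩
    have : Subgroup.zpowers σ ≤ MulAction.stabilizer Gal(E'/K') (algebraMap E E' x) := by
      rw [Subgroup.zpowers_le]; exact h1 x
    exact this hτ
  ext x
  exact h2 (IntermediateField.mem_top (x := x)) ⟨σ, Subgroup.mem_zpowers σ⟩

lemma baseChangeRes_continuous [Normal K E] [Algebra.IsAlgebraic K' E'] :
    Continuous (baseChangeRes K E K' E') := by
  refine continuous_of_continuousAt_one _ ?_
  rw [ContinuousAt, map_one]
  intro A hA
  obtain ⟨F, hF, hFA⟩ := (krullTopology_mem_nhds_one_iff K E A).1 hA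
  let b := Module.finBasis K F
  have h1 : (⋂ i, (MulAction.stabilizer Gal(E'/K') (algebraMap E E' (b i)) : Set Gal(E'/K'))) ∈
      nhds (1 : Gal(E'/K')) := by
    refine IsOpen.mem_nhds (isOpen_iInter_of_finite fun i => ?_) ?_
    · exact stabilizer_isOpen_of_isIntegral _
    · exact Set.mem_iInter.2 fun i => one_mem _
  refine Filter.mem_map.2 (Filter.mem_of_superset h1 fun σ hσ => hFA ?_)
  rw [SetLike.mem_coe, IntermediateField.mem_fixingSubgroup_iff]
  intro x hx
  have hb : ∀ i, baseChangeRes K E K' E' σ (b i) = b i := fun i => by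
    apply (algebraMap E E').injective
    rw [algebraMap_baseChangeRes]
    exact Set.mem_iInter.1 hσ i
  have hlin : (baseChangeRes K E K' E' σ).toLinearMap ∘ₗ F.val.toLinearMap = F.val.toLinearMap :=
    b.ext hb
  exact LinearMap.congr_fun hlin ⟨x, hx⟩

/-- The image of the restriction map is the Galois group over `E ∩ K'`. -/
lemma mem_range_baseChangeRes_iff [IsGalois K E] [IsGalois K' E'] (τ : Gal(E/K)) :
    τ ∈ (baseChangeRes K E K' E').range ↔
      ∀ x : E, algebraMap E E' x ∈ (algebraMap K' E').range → τ x = x := by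
  constructor
  · rintro ⟨σ, rfl⟩ x ⟨y, hy⟩
    apply (algebraMap E E').injective
    rw [algebraMap_baseChangeRes, ← hy, σ.commutes]
  · intro h
    have hcl : IsClosed ((baseChangeRes K E K' E').range : Set Gal(E/K)) := by
      rw [MonoidHom.coe_range]
      exact (isCompact_range baseChangeRes_continuous).isClosed
    let R : ClosedSubgroup Gal(E/K) := ⟨(baseChangeRes K E K' E').range, hcl⟩
    have := InfiniteGalois.fixingSubgroup_fixedField R
    change τ ∈ R.toSubgroup
    rw [← this, IntermediateField.mem_fixingSubgroup_iff]
    intro x hx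
    refine h x ?_
    rw [RingHom.mem_range, ← Set.mem_range, InfiniteGalois.mem_range_algebraMap_iff_fixed]
    intro σ
    rw [← algebraMap_baseChangeRes (K := K)]
    congr 1
    exact hx ⟨baseChangeRes K E K' E' σ, σ, rfl⟩

end Field

/-- The extension `E' / K'` arises from `E / K` by a base change `K' / K` which is unramified with
residue field large enough to make `E' / K'` totally ramified. -/
structure IsUnrBaseChange (K E K' E' : Type*) [NontriviallyNormedField K] [IsUltrametricDist K]
    [CompleteSpace K] [Field E] [Algebra K E] [Algebra.IsAlgebraic K E]
    [NontriviallyNormedField K'] [IsUltrametricDist K'] [CompleteSpace K'] [Field E'] [Algebra K' E']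
    [Algebra.IsAlgebraic K' E'] [Algebra K K'] [Algebra E E'] : Prop where
  norm : ∀ x : K, ‖algebraMap K K' x‖ = ‖x‖
  adjoin : IntermediateField.adjoin K' (Set.range (algebraMap E E')) = ⊤
  res : IsResTrivial K' E'
  inertia : ∀ τ ∈ lowerRam K E 0, ∀ x : E, algebraMap E E' x ∈ (algebraMap K' E').range → τ x = x

namespace IsUnrBaseChange

variable {K E K' E' : Type*} [NontriviallyNormedField K] [IsUltrametricDist K]
    [CompleteSpace K] [Field E] [Algebra K E] [IsGalois K E]
    [NontriviallyNormedField K'] [IsUltrametricDist K'] [CompleteSpace K'] [Field E'] [Algebra K' E']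
    [IsGalois K' E'] [Algebra K K'] [Algebra E E'] [Algebra K E']
    [IsScalarTower K E E'] [IsScalarTower K K' E'] (h : IsUnrBaseChange K E K' E')
include h

lemma extAbs_algebraMap (x : E) : extAbs K' E' (algebraMap E E' x) = extAbs K E x :=
  extAbs_baseChange h.norm x

/-- Restriction identifies the Galois group of the totally ramified extension `E' / K'` with the
inertia group of `E / K`. -/
lemma range_eq : (baseChangeRes K E K' E').range = lowerRam K E 0 := by
  ext τ
  constructor
  · rintro ⟨σ, rfl⟩
    rw [mem_lowerRam_zero_iff]
    intro x hx
    rw [← h.extAbs_algebraMap, map_sub, algebraMap_baseChangeRes]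
    have : σ ∈ lowerRam K' E' 0 := h.res.lowerRam_zero ▸ Subgroup.mem_top σ
    exact (mem_lowerRam_zero_iff σ).1 this _ (by rwa [h.extAbs_algebraMap])
  · intro hτ
    rw [mem_range_baseChangeRes_iff]
    exact h.inertia τ hτ

variable {π : E} (hπ : IsUnif (extAbs K E) π) (hπ' : IsUnif (extAbs K' E') (algebraMap E E' π))
include hπ hπ'

/-- The lower ramification groups correspond to each other, since for `E' / K'` they can be tested
on a single uniformizer, and this may be taken in `E`. -/
lemma lowerRam_eq (r : ℝ) :
    lowerRam K' E' r = (lowerRam K E r).comap (baseChangeRes K E K' E') := by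
  ext σ
  rw [Subgroup.mem_comap, h.res.mem_lowerRam_iff hπ', mem_lowerRam_iff hπ]
  have key : ∀ x, extAbs K E (baseChangeRes K E K' E' σ x - x) =
      extAbs K' E' (σ (algebraMap E E' x) - algebraMap E E' x) := fun x => by
    rw [← h.extAbs_algebraMap, map_sub, algebraMap_baseChangeRes]
  constructor
  · intro hσ x hx
    rw [key, ← h.extAbs_algebraMap π]
    exact h.res.sub_le hπ' hσ (by rwa [h.extAbs_algebraMap])
  · intro hσ
    rw [← key, h.extAbs_algebraMap]
    exact hσ π hπ.lt_one.le

lemma herbrandPhi_eq : herbrandPhi K' E' = herbrandPhi K E := by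
  have : ∀ w, (lowerRam K' E' w).relIndex (lowerRam K' E' 0) =
      (lowerRam K E w).relIndex (lowerRam K E 0) := fun w => by
    rw [h.res.lowerRam_zero, h.lowerRam_eq hπ hπ', Subgroup.relIndex_comap, ← MonoidHom.range_eq_map,
      h.range_eq]
  ext r
  simp only [herbrandPhi, this]

lemma finUpperRam_eq (v : ℝ) :
    finUpperRam K' E' v = (finUpperRam K E v).comap (baseChangeRes K E K' E') := by
  rw [finUpperRam, finUpperRam, herbrandPsi, herbrandPsi, h.herbrandPhi_eq hπ hπ', h.lowerRam_eq hπ hπ']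

/-- The inertia group is the upper ramification group of index `0`. -/
lemma finUpperRam_zero [FiniteDimensional K' E'] : finUpperRam K E 0 = lowerRam K E 0 := by
  have h1 : herbrandPsi K E 0 = 0 := by
    have := h.res.herbrandPsi_zero hπ'
    rwa [herbrandPsi, h.herbrandPhi_eq hπ hπ'] at this
  rw [finUpperRam, h1]

end IsUnrBaseChange

end BaseChange

/-! ### Independence of residue characters -/

section Dedekind

/-- Multiplicative maps into the integers of `M` with distinct reductions are independent modulo
the maximal ideal: some linear combination with coefficients `w i` is as large as any `w i`. -/
lemma exists_le_abs_sum {M : Type*} [Field M] {v : AbsoluteValue M ℝ} (hv : IsNonarchimedean v)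
    {A : Type*} [MulOneClass A] {ι : Type*} [Fintype ι] (f : ι → A →* M) (hf : ∀ i a, v (f i a) ≤ 1)
    (hdist : ∀ i j, i ≠ j → ∃ a, 1 ≤ v (f i a - f j a)) (w : ι → M) (j : ι) :
    ∃ a, v (w j) ≤ v (∑ i, f i a * w i) := by
  classical
  obtain ⟨j₀, -, hj₀⟩ := Finset.exists_max_image Finset.univ (fun i => v (w i)) ⟨j, Finset.mem_univ j⟩
  by_cases h0 : w j₀ = 0
  · have := hj₀ j (Finset.mem_univ j)
    simp only [h0, map_zero] at this
    exact ⟨1, this.trans (v.nonneg _)⟩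
  -- after division by a coefficient of maximal absolute value, this is independence of characters of
  -- the residue field
  suffices ∃ a, 1 ≤ v (∑ i, f i a * (w i / w j₀)) by
    obtain ⟨a, ha⟩ := this
    refine ⟨a, (hj₀ j (Finset.mem_univ j)).trans ?_⟩
    have e : ∑ i, f i a * (w i / w j₀) = (∑ i, f i a * w i) / w j₀ := by
      rw [Finset.sum_div]
      exact Finset.sum_congr rfl fun i _ => by rw [mul_div_assoc]
    rw [e, map_div₀, le_div_iff₀ (v.pos h0), one_mul] at ha
    exact ha
  let O : Subring M :=
    { carrier := {x | v x ≤ 1}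
      zero_mem' := by simp
      one_mem' := by simp
      neg_mem' := fun {a} h => by simpa using h
      add_mem' := fun {a b} ha hb => (hv _ _).trans (max_le ha hb)
      mul_mem' := fun {a b} ha hb => by
        change v (a * b) ≤ 1
        rw [map_mul]; exact mul_le_one₀ ha (v.nonneg _) hb }
  let m : Ideal O :=
    { carrier := {x | v x < 1}
      zero_mem' := by simp
      add_mem' := fun {a b} ha hb => (hv _ _).trans_lt (max_lt ha hb)
      smul_mem' := fun c x hx => by
        change v (c * x) < 1
        rw [map_mul]
        exact (mul_le_of_le_one_left (v.nonneg _) c.2).trans_lt hx }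
  have hmem : ∀ x : O, x ∈ m ↔ v x < 1 := fun x => Iff.rfl
  have hm : m.IsPrime := by
    refine ⟨?_, fun {x y} hxy => ?_⟩
    · rw [Ideal.ne_top_iff_one, hmem]; simp
    · rw [hmem, hmem]
      by_contra! hc
      have h3 : v x * v y < 1 := by
        have := (hmem _).1 hxy
        rwa [Subring.coe_mul, map_mul] at this
      nlinarith [hc.1, hc.2]
  by_contra! hlt
  let g : ι → A →* (O ⧸ m) := fun i =>
    (Ideal.Quotient.mk m).toMonoidHom.comp ((f i).codRestrict O fun a => hf i a)
  have hg : Function.Injective g := by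
    intro i k hik
    by_contra hne
    obtain ⟨a, ha⟩ := hdist i k hne
    have h1 : Ideal.Quotient.mk m ⟨f i a, hf i a⟩ = Ideal.Quotient.mk m ⟨f k a, hf k a⟩ :=
      DFunLike.congr_fun hik a
    rw [Ideal.Quotient.eq, hmem] at h1
    exact absurd h1 (not_lt.2 ha)
  have hu : ∀ i, v (w i / w j₀) ≤ 1 := fun i => by
    rw [map_div₀, div_le_one (v.pos h0)]
    exact hj₀ i (Finset.mem_univ i)
  have hli := (linearIndependent_monoidHom A (O ⧸ m)).comp g hg
  rw [Fintype.linearIndependent_iff] at hli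
  have h2 := hli (fun i => Ideal.Quotient.mk m ⟨w i / w j₀, hu i⟩) (by
    ext a
    rw [Finset.sum_apply]
    have h3 : Ideal.Quotient.mk m (∑ i, (⟨w i / w j₀, hu i⟩ : O) * ⟨f i a, hf i a⟩) = 0 := by
      rw [Ideal.Quotient.eq_zero_iff_mem, hmem]
      refine lt_of_eq_of_lt ?_ (hlt a)
      congr 1
      rw [AddSubmonoidClass.coe_finsetSum]
      exact Finset.sum_congr rfl fun i _ => mul_comm _ _
    rw [map_sum] at h3
    exact h3) j₀
  rw [Ideal.Quotient.eq_zero_iff_mem, hmem] at h2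
  simp [div_self h0] at h2

end Dedekind

/-! ### Finite extensions of local fields -/

section Finite

variable {k F : Type*} [NontriviallyNormedField k] [IsUltrametricDist k] [CompleteSpace k]
  [Field F] [Algebra k F]

/-- A finite Galois extension of a discretely valued field is discretely valued. -/
lemma exists_isUnif [FiniteDimensional k F] [IsGalois k F] {ϖ : k}
    (hϖ : IsUnif (extAbs k k) ϖ) : ∃ π : F, IsUnif (extAbs k F) π := by
  classical
  set n := Fintype.card Gal(F/k)
  have hn : n ≠ 0 := Fintype.card_ne_zero
  have hnorm : ∀ x : F, ‖Algebra.norm k x‖ = extAbs k F x ^ n := fun x => by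
    rw [← extAbs_algebraMap (F := F), Algebra.norm_eq_prod_automorphisms, map_prod]
    simp [extAbs_algEquiv, n]
  have hself : ∀ x : k, extAbs k k x = ‖x‖ := fun x => extAbs_algebraMap (F := k) x
  -- the values below `1` have `n`-th powers in the discrete value group of `k`; take the largest
  have hex : ∃ m : ℕ, ∃ x : F, x ≠ 0 ∧ extAbs k F x < 1 ∧ extAbs k F x ^ n = ‖ϖ‖ ^ m := by
    refine ⟨n, algebraMap k F ϖ, ?_, ?_, ?_⟩
    · rw [map_ne_zero]; exact hϖ.ne_zero
    · rw [extAbs_algebraMap, ← hself]; exact hϖ.lt_one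
    · rw [extAbs_algebraMap]
  obtain ⟨π, hπ0, hπ1, hπ⟩ := Nat.find_spec hex
  refine ⟨π, (extAbs k F).pos hπ0, hπ1, fun x hx => ?_⟩
  by_cases hx0 : x = 0
  · rw [hx0, map_zero]; exact (extAbs k F).nonneg _
  have h1 : extAbs k k (Algebra.norm k x) ≤ 1 := by
    rw [hself, hnorm]; exact pow_le_one₀ ((extAbs k F).nonneg _) hx.le
  obtain ⟨m, hm⟩ := hϖ.exists_pow (Algebra.norm_ne_zero_iff.2 hx0) h1
  rw [hself, hself, hnorm] at hm
  have h2 : Nat.find hex ≤ m := Nat.find_min' hex ⟨x, hx0, hx, hm⟩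
  refine le_of_pow_le_pow_left₀ hn ((extAbs k F).nonneg _) ?_
  have h3 := hϖ.pow_le_pow.2 h2
  rw [hself] at h3
  rw [hπ, hm]
  exact h3

variable (k F) in
/-- The residue field of a finite extension of a local field is finite. -/
lemma finite_residue [LocallyCompactSpace k] [FiniteDimensional k F] :
    Finite (extInt k F ⧸ maxIdeal (extInt k F)) := by
  classical
  let : NormedField F := spectralNorm.normedField k F
  let : NormedAlgebra k F := spectralNorm.normedAlgebra k F
  have : ProperSpace F := FiniteDimensional.proper k F
  have hn : ∀ x : F, ‖x‖ = extAbs k F x := fun x => rfl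
  obtain ⟨s, -, hs, hcov⟩ := (isCompact_closedBall (0 : F) 1).elim_finite_subcover_image
    (b := Metric.closedBall (0 : F) 1) (c := fun x => Metric.ball x 1)
    (fun x _ => Metric.isOpen_ball) (fun x hx => Set.mem_biUnion hx (Metric.mem_ball_self one_pos))
  let f : s → extInt k F ⧸ maxIdeal (extInt k F) := fun x =>
    if h : (x : F) ∈ extInt k F then Ideal.Quotient.mk _ ⟨x, h⟩ else 0
  have := hs.to_subtype
  refine Finite.of_surjective f fun y => ?_
  obtain ⟨y, rfl⟩ := Ideal.Quotient.mk_surjective y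
  have hy : extAbs k F (y : F) ≤ 1 := (mem_extInt_iff _).1 y.2
  have hy' : (y : F) ∈ Metric.closedBall (0 : F) 1 := by
    rw [mem_closedBall_zero_iff]; exact hy
  obtain ⟨x, hx, hyx⟩ := Set.mem_iUnion₂.1 (hcov hy')
  rw [Metric.mem_ball, dist_eq_norm, hn] at hyx
  have hxi : x ∈ extInt k F := by
    rw [mem_extInt_iff]
    have := nonarch_sub_le (isNonarchimedean_extAbs k F) (y : F) (y - x)
    rw [sub_sub_cancel] at this
    exact this.trans (max_le hy hyx.le)
  refine ⟨⟨x, hx⟩, ?_⟩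
  simp only [f, dif_pos hxi]
  rw [Ideal.Quotient.eq, mem_maxIdeal_iff (extInt_inj k F) (isNonarchimedean_extAbs k F)
    (extInt_range k F)]
  change extAbs k F (x - y) < 1
  rwa [← neg_sub, AbsoluteValue.map_neg]

variable (k F) in
lemma maxIdeal_isMaximal [Algebra.IsAlgebraic k F] : (maxIdeal (extInt k F)).IsMaximal := by
  have hm := mem_maxIdeal_iff (extInt_inj k F) (isNonarchimedean_extAbs k F) (extInt_range k F)
  have hu := isUnit_iff_absVal (extInt_inj k F) (extInt_range k F)
  rw [Ideal.isMaximal_iff]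
  refine ⟨fun h => ?_, fun J x hJ hx hxJ => ?_⟩
  · have := (hm 1).1 h
    simp at this
  · rw [hm, not_lt] at hx
    have h1 : extAbs k F (algebraMap (extInt k F) F x) = 1 :=
      le_antisymm ((extInt_range k F _).2 ⟨x, rfl⟩) hx
    exact (Ideal.eq_top_of_isUnit_mem J hxJ ((hu x).2 h1)) ▸ Submodule.mem_top

/-- Every integer of a finite extension satisfies `x ^ q ≡ x`, where `q` is the cardinality of the
residue field. -/
lemma exists_pow_sub_lt [LocallyCompactSpace k] [FiniteDimensional k F] :
    ∃ q : ℕ, 1 < q ∧ ‖(q : k)‖ < 1 ∧ ∀ x : F, extAbs k F x ≤ 1 → extAbs k F (x ^ q - x) < 1 := by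
  have := finite_residue k F
  have := maxIdeal_isMaximal k F
  let : Field (extInt k F ⧸ maxIdeal (extInt k F)) := Ideal.Quotient.field _
  let := Fintype.ofFinite (extInt k F ⧸ maxIdeal (extInt k F))
  have hm := mem_maxIdeal_iff (extInt_inj k F) (isNonarchimedean_extAbs k F) (extInt_range k F)
  refine ⟨Fintype.card (extInt k F ⧸ maxIdeal (extInt k F)), Fintype.one_lt_card, ?_, fun x hx => ?_⟩
  · have h1 := FiniteField.cast_card_eq_zero (extInt k F ⧸ maxIdeal (extInt k F))
    rw [← map_natCast (Ideal.Quotient.mk (maxIdeal (extInt k F))), Ideal.Quotient.eq_zero_iff_mem,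
      hm, map_natCast, ← map_natCast (algebraMap k F), extAbs_algebraMap] at h1
    exact h1
  · have hx' := (mem_extInt_iff x).2 hx
    have h1 := FiniteField.pow_card (Ideal.Quotient.mk (maxIdeal (extInt k F)) ⟨x, hx'⟩)
    rw [← map_pow, Ideal.Quotient.eq, hm] at h1
    exact h1

end Finite

/-! ### Teichmüller representatives -/

section Teichmuller

/-- Two roots of `X ^ q - X` in the same residue class are equal. -/
lemma eq_of_pow_eq {M : Type*} [Field M] {v : AbsoluteValue M ℝ} (hv : IsNonarchimedean v) {q : ℕ}
    (hq1 : 1 < q) (hq : v (q : M) < 1) {s t : M} (hs : s ^ q = s) (ht : t ^ q = t)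
    (hst : v (s - t) < 1) : s = t := by
  have hle : ∀ u : M, u ^ q = u → v u ≤ 1 := by
    intro u hu
    by_contra! hc
    have : v u ^ q = v u := by rw [← map_pow, hu]
    have h2 := pow_lt_pow_right₀ hc hq1
    rw [pow_one, this] at h2
    exact lt_irrefl _ h2
  by_contra hne
  -- the quotient `(s ^ q - t ^ q) / (s - t)` is `1`, but it is congruent to `q * t ^ (q - 1)`
  have h1 : (∑ i ∈ Finset.range q, s ^ i * t ^ (q - 1 - i)) = 1 := by
    have := Commute.geom_sum₂_mul (Commute.all s t) q
    rw [hs, ht] at this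
    exact mul_right_cancel₀ (sub_ne_zero.2 hne) (this.trans (one_mul _).symm)
  have hpow : ∀ i, v (s ^ i - t ^ i) < 1 := by
    intro i
    obtain ⟨c, hc⟩ := sub_dvd_pow_sub_pow s t i
    have h3 := Commute.geom_sum₂_mul (Commute.all s t) i
    rw [← h3, map_mul]
    refine lt_of_le_of_lt (mul_le_of_le_one_left (v.nonneg _) ?_) hst
    refine nonarch_sum_le hv _ _ zero_le_one fun j _ => ?_
    rw [map_mul, map_pow, map_pow]
    exact mul_le_one₀ (pow_le_one₀ (v.nonneg _) (hle s hs)) (pow_nonneg (v.nonneg _) _)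
      (pow_le_one₀ (v.nonneg _) (hle t ht))
  have h2 : (∑ i ∈ Finset.range q, s ^ i * t ^ (q - 1 - i)) =
      (∑ i ∈ Finset.range q, (s ^ i - t ^ i) * t ^ (q - 1 - i)) + q * t ^ (q - 1) := by
    have : (q : M) * t ^ (q - 1) = ∑ i ∈ Finset.range q, t ^ i * t ^ (q - 1 - i) := by
      rw [Finset.sum_congr rfl fun i hi => ?_, Finset.sum_const, Finset.card_range, nsmul_eq_mul]
      rw [← pow_add]
      congr 1
      have := Finset.mem_range.1 hi
      omega
    rw [this, ← Finset.sum_add_distrib]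
    exact Finset.sum_congr rfl fun i _ => by ring
  have h3 : v (∑ i ∈ Finset.range q, s ^ i * t ^ (q - 1 - i)) < 1 := by
    rw [h2]
    refine (hv _ _).trans_lt (max_lt ?_ ?_)
    · obtain ⟨j, hj, hmax⟩ := Finset.exists_max_image (Finset.range q)
        (fun i => v (s ^ i - t ^ i)) ⟨0, Finset.mem_range.2 (by omega)⟩
      refine lt_of_le_of_lt (nonarch_sum_le hv _ _ (v.nonneg _) fun i hi => ?_) (hpow j)
      rw [map_mul, map_pow]
      exact (mul_le_of_le_one_right (v.nonneg _) (pow_le_one₀ (v.nonneg _) (hle t ht))).trans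
        (hmax i hi)
    · rw [map_mul, map_pow]
      exact lt_of_le_of_lt (mul_le_of_le_one_right (v.nonneg _)
        (pow_le_one₀ (v.nonneg _) (hle t ht))) hq
  rw [h1, map_one] at h3
  exact lt_irrefl _ h3

end Teichmuller

/-! ### The maximal unramified extension -/

section LocalField

variable (K : Type*) [NontriviallyNormedField K] [IsUltrametricDist K] [CompleteSpace K]

/-- A local field is discretely valued. -/
lemma exists_isUnif_base [LocallyCompactSpace K] : ∃ ϖ : K, IsUnif (extAbs K K) ϖ := by
  have : ProperSpace K := ProperSpace.of_locallyCompactSpace K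
  have hself : ∀ x : K, extAbs K K x = ‖x‖ := fun x => extAbs_algebraMap (F := K) x
  have hc : IsCompact (Metric.ball (0 : K) 1) :=
    (isCompact_closedBall (0 : K) 1).of_isClosed_subset (IsUltrametricDist.isClosed_ball _ _)
      Metric.ball_subset_closedBall
  obtain ⟨ϖ, h1, hmax⟩ := hc.exists_isMaxOn ⟨0, Metric.mem_ball_self one_pos⟩
    continuous_norm.continuousOn
  obtain ⟨x, hx0, hx1⟩ := NormedField.exists_norm_lt_one K
  have hle : ∀ x : K, ‖x‖ < 1 → ‖x‖ ≤ ‖ϖ‖ := fun x hx => hmax (mem_ball_zero_iff.2 hx)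
  exact ⟨ϖ, by rw [hself]; exact hx0.trans_le (hle x hx1), by rw [hself]; exact mem_ball_zero_iff.1 h1,
    fun x hx => by rw [hself] at hx ⊢; rw [hself]; exact hle x hx⟩

end LocalField

section MaxUnr

variable {K : Type*} [NontriviallyNormedField K] [IsUltrametricDist K] [CompleteSpace K]
  {Ω : Type*} [NormedField Ω] [NormedAlgebra K Ω] [IsAlgClosure K Ω]

lemma isGalois_closure (K Ω : Type*) [Field K] [Field Ω] [Algebra K Ω] [IsAlgClosure K Ω]
    [CharZero K] : IsGalois K Ω := by
  have := IsAlgClosure.normal K Ω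
  exact { to_isSeparable := inferInstance, to_normal := this }

variable (K) in
lemma extAbs_eq_norm (x : Ω) : extAbs K Ω x = ‖x‖ :=
  extAbs_unique (NormedField.toAbsoluteValue Ω) (fun x => norm_algebraMap' Ω x) x

lemma extAbs_coe {F : IntermediateField K Ω} (x : F) : extAbs K F x = ‖(x : Ω)‖ := by
  rw [← extAbs_eq_norm K]
  exact (extAbs_tower (k := K) (E := F) (F := Ω) x).symm

lemma norm_algEquiv (σ : Gal(Ω/K)) (x : Ω) : ‖σ x‖ = ‖x‖ := by
  rw [← extAbs_eq_norm K, ← extAbs_eq_norm K, extAbs_algEquiv]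

lemma norm_sub_lt {M : Type*} [NormedField M] [IsUltrametricDist M] {x y z : M} {r : ℝ}
    (h1 : ‖x - y‖ < r) (h2 : ‖y - z‖ < r) : ‖x - z‖ < r := by
  rw [← sub_add_sub_cancel x y z]
  exact (IsUltrametricDist.norm_add_le_max _ _).trans_lt (max_lt h1 h2)

lemma isNonarchimedean_toAbsoluteValue (M : Type*) [NormedField M] [IsUltrametricDist M] :
    IsNonarchimedean (NormedField.toAbsoluteValue M) :=
  fun x y => IsUltrametricDist.norm_add_le_max x y

section Teichmuller

variable (K) in
/-- A residue class of the algebraic closure contains a Teichmüller representative. -/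
lemma exists_teichmuller [LocallyCompactSpace K] {x : Ω} (hx : ‖x‖ ≤ 1) :
    ∃ (q : ℕ) (t : Ω), 1 < q ∧ ‖(q : K)‖ < 1 ∧ t ^ q = t ∧ ‖x - t‖ < 1 := by
  have hint : IsIntegral K x := (Algebra.IsAlgebraic.isAlgebraic x).isIntegral
  have := IntermediateField.adjoin.finiteDimensional hint
  obtain ⟨q, hq1, hq, h⟩ := exists_pow_sub_lt (k := K) (F := IntermediateField.adjoin K {x})
  have h1 := h ⟨x, IntermediateField.mem_adjoin_simple_self K x⟩ (by rw [extAbs_coe]; exact hx)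
  rw [extAbs_coe] at h1
  change ‖x ^ q - x‖ < 1 at h1
  have : IsAlgClosed Ω := IsAlgClosure.isAlgClosed K
  have hs := IsAlgClosed.splits (Polynomial.X ^ q - Polynomial.X : Polynomial Ω)
  have hp := congrArg (Polynomial.eval x) hs.eq_prod_roots
  have hmon : (Polynomial.X ^ q - Polynomial.X : Polynomial Ω).Monic :=
    Polynomial.monic_X_pow_sub (by rw [Polynomial.degree_X]; exact_mod_cast hq1)
  rw [hmon.leadingCoeff] at hp
  simp only [Polynomial.eval_sub, Polynomial.eval_pow, Polynomial.eval_X, map_one, one_mul,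
    Polynomial.eval_multiset_prod, Multiset.map_map, Function.comp_def, Polynomial.eval_C] at hp
  by_contra! hc
  -- otherwise `x ^ q - x`, the product of the `x - t` over the roots `t`, would be a unit
  have key : ∀ s : Multiset Ω, (∀ t ∈ s, 1 ≤ ‖x - t‖) → 1 ≤ ‖(s.map fun t => x - t).prod‖ := by
    intro s
    induction s using Multiset.induction_on with
    | empty => simp
    | cons a s ih =>
      intro hs
      rw [Multiset.map_cons, Multiset.prod_cons, norm_mul]
      exact one_le_mul_of_one_le_of_one_le (hs a (Multiset.mem_cons_self a s))
        (ih fun t ht => hs t (Multiset.mem_cons_of_mem ht))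
  refine absurd h1 (not_lt.2 ?_)
  rw [hp]
  refine key _ fun t ht => hc q t hq1 hq ?_
  have := (Polynomial.mem_roots hmon.ne_zero).1 ht
  simpa [Polynomial.IsRoot, sub_eq_zero] using this

end Teichmuller

/-- A finite Galois extension with trivial inertia group. -/
structure IsUnr (E : IntermediateField K Ω) : Prop where
  finite : FiniteDimensional K E
  galois : IsGalois K E
  inertia : lowerRam K E 0 = ⊥

/-- An automorphism acting trivially on the residue field of an unramified extension acts trivially
on the extension. -/
lemma IsUnr.apply_eq {E : IntermediateField K Ω} (hE : IsUnr E) (σ : Gal(Ω/K))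
    (hσ : ∀ x ∈ E, ‖x‖ ≤ 1 → ‖σ x - x‖ < 1) {x : Ω} (hx : x ∈ E) : σ x = x := by
  have := hE.finite
  have := hE.galois
  have h1 : ∀ y : E, ((AlgEquiv.restrictNormalHom E σ y : E) : Ω) = σ y := fun y =>
    AlgEquiv.restrictNormal_commutes σ E y
  have h : AlgEquiv.restrictNormalHom E σ ∈ lowerRam K E 0 := by
    rw [mem_lowerRam_zero_iff]
    intro y hy
    rw [extAbs_coe] at hy ⊢
    have := hσ y y.2 hy
    rw [← h1] at this
    exact this
  rw [hE.inertia, Subgroup.mem_bot] at h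
  rw [← h1 ⟨x, hx⟩, h, AlgEquiv.one_apply]

/-- The converse of `IsUnr.apply_eq`, in terms of automorphisms of the algebraic closure. -/
lemma isUnr_of_apply_eq {E : IntermediateField K Ω} [FiniteDimensional K E] [IsGalois K E]
    (h : ∀ σ : Gal(Ω/K), (∀ x ∈ E, ‖x‖ ≤ 1 → ‖σ x - x‖ < 1) → ∀ x ∈ E, σ x = x) : IsUnr E := by
  refine ⟨inferInstance, inferInstance, ?_⟩
  have := IsAlgClosure.normal K Ω
  rw [eq_bot_iff]
  intro τ hτ
  obtain ⟨σ, rfl⟩ := AlgEquiv.restrictNormalHom_surjective (F := K) (K₁ := E) Ω τ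
  have h1 : ∀ y : E, ((AlgEquiv.restrictNormalHom E σ y : E) : Ω) = σ y := fun y =>
    AlgEquiv.restrictNormal_commutes σ E y
  rw [mem_lowerRam_zero_iff] at hτ
  rw [Subgroup.mem_bot]
  ext y
  rw [h1, h σ ?_ y y.2, AlgEquiv.one_apply]
  intro x hx hx1
  have := hτ ⟨x, hx⟩ (by rw [extAbs_coe]; exact hx1)
  rw [extAbs_coe] at this
  rw [← h1 ⟨x, hx⟩]
  exact this

lemma IsUnr.sup {E E' : IntermediateField K Ω} (hE : IsUnr E) (hE' : IsUnr E') :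
    IsUnr (E ⊔ E') := by
  have := hE.finite
  have := hE.galois
  have := hE'.finite
  have := hE'.galois
  refine isUnr_of_apply_eq fun σ hσ => ?_
  have h1 : E ⊔ E' ≤ IntermediateField.fixedField (Subgroup.zpowers σ) := by
    have key : ∀ x, σ x = x → x ∈ IntermediateField.fixedField (Subgroup.zpowers σ) := by
      rintro x hx ⟨τ, hτ⟩
      have : Subgroup.zpowers σ ≤ MulAction.stabilizer Gal(Ω/K) x := by
        rw [Subgroup.zpowers_le]; exact hx
      exact this hτ
    refine sup_le (fun x hx => key x ?_) (fun x hx => key x ?_)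
    · exact hE.apply_eq σ (fun y hy => hσ y (le_sup_left (a := E) hy)) hx
    · exact hE'.apply_eq σ (fun y hy => hσ y (le_sup_right (a := E) hy)) hx
  exact fun x hx => h1 hx ⟨σ, Subgroup.mem_zpowers σ⟩

lemma isUnr_bot [CharZero K] : IsUnr (⊥ : IntermediateField K Ω) := by
  refine isUnr_of_apply_eq fun σ _ x hx => ?_
  obtain ⟨y, rfl⟩ := IntermediateField.mem_bot.1 hx
  exact σ.commutes y

omit [CompleteSpace K] [IsAlgClosure K Ω] in
lemma IsUnr.le_maxUnr {E : IntermediateField K Ω} (hE : IsUnr E) : E ≤ maxUnr K Ω :=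
  le_iSup_of_le E (le_iSup_of_le hE.finite (le_iSup_of_le hE.galois (le_iSup_of_le hE.inertia le_rfl)))

omit [CompleteSpace K] [IsAlgClosure K Ω] in
lemma maxUnr_eq_iSup :
    maxUnr K Ω = ⨆ E : {E : IntermediateField K Ω // IsUnr E}, (E : IntermediateField K Ω) := by
  refine le_antisymm ?_ (iSup_le fun E => E.2.le_maxUnr)
  exact iSup_le fun E => iSup_le fun h1 => iSup_le fun h2 => iSup_le fun h3 =>
    le_iSup (fun E : {E : IntermediateField K Ω // IsUnr E} => (E : IntermediateField K Ω))
      ⟨E, ⟨h1, h2, h3⟩⟩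

/-- Since the unramified extensions form a directed family, an element of `F K^unr` lies in `F E`
for one of them. -/
lemma exists_isUnr_of_mem_sup [CharZero K] {F : IntermediateField K Ω} {x : Ω}
    (hx : x ∈ F ⊔ maxUnr K Ω) : ∃ E : IntermediateField K Ω, IsUnr E ∧ x ∈ F ⊔ E := by
  have : Nonempty {E : IntermediateField K Ω // IsUnr E} := ⟨⟨⊥, isUnr_bot⟩⟩
  rw [maxUnr_eq_iSup, sup_iSup, ← SetLike.mem_coe, IntermediateField.coe_iSup_of_directed] at hx
  · obtain ⟨E, hE⟩ := Set.mem_iUnion.1 hx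
    exact ⟨E, E.2, hE⟩
  · intro E E'
    exact ⟨⟨E ⊔ E', E.2.sup E'.2⟩, sup_le_sup_left le_sup_left _, sup_le_sup_left le_sup_right _⟩

/-- Teichmüller representatives lie in the maximal unramified extension. -/
lemma mem_maxUnr_of_pow_eq [CharZero K] {q : ℕ} (hq1 : 1 < q) (hq : ‖(q : K)‖ < 1) {t : Ω}
    (ht : t ^ q = t) : t ∈ maxUnr K Ω := by
  have := IsUltrametricDist.of_normedAlgebra K (L := Ω)
  have : IsAlgClosed Ω := IsAlgClosure.isAlgClosed K
  let P : Polynomial K := Polynomial.X ^ q - Polynomial.X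
  have hmon : P.Monic :=
    Polynomial.monic_X_pow_sub (by rw [Polynomial.degree_X]; exact_mod_cast hq1)
  have hroot : ∀ s : Ω, s ∈ P.rootSet Ω ↔ s ^ q = s := fun s => by
    rw [Polynomial.mem_rootSet_of_ne hmon.ne_zero]
    simp [P, sub_eq_zero]
  let E := IntermediateField.adjoin K (P.rootSet Ω)
  have hsp : P.IsSplittingField K E :=
    IntermediateField.adjoin_rootSet_isSplittingField (IsAlgClosed.splits _)
  have : FiniteDimensional K E := Polynomial.IsSplittingField.finiteDimensional E P
  have : Normal K E := Normal.of_isSplittingField P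
  have : IsGalois K E := { to_isSeparable := inferInstance, to_normal := this }
  refine (isUnr_of_apply_eq (E := E) fun σ hσ => ?_).le_maxUnr
    (IntermediateField.subset_adjoin K _ ((hroot t).2 ht))
  have h1 : E ≤ IntermediateField.fixedField (Subgroup.zpowers σ) := by
    rw [IntermediateField.adjoin_le_iff]
    intro s hs
    have hs' := (hroot s).1 hs
    have hs1 : ‖s‖ ≤ 1 := by
      by_contra! hc
      have h2 := pow_lt_pow_right₀ hc hq1
      rw [pow_one, ← norm_pow, hs'] at h2
      exact lt_irrefl _ h2
    have h3 : σ s = s := eq_of_pow_eq (isNonarchimedean_toAbsoluteValue Ω) hq1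
      (by rw [← map_natCast (algebraMap K Ω)]; exact (norm_algebraMap' Ω (q : K)).trans_lt hq)
      (by rw [← map_pow, hs']) hs'
      (hσ s (IntermediateField.subset_adjoin K _ hs) hs1)
    rintro ⟨τ, hτ⟩
    have : Subgroup.zpowers σ ≤ MulAction.stabilizer Gal(Ω/K) s := by
      rw [Subgroup.zpowers_le]; exact h3
    exact this hτ
  exact fun x hx => h1 hx ⟨σ, Subgroup.mem_zpowers σ⟩

/-- The residue field of `K^unr` is that of the algebraic closure. -/
lemma exists_mem_maxUnr_sub_lt [CharZero K] [LocallyCompactSpace K] {x : Ω} (hx : ‖x‖ ≤ 1) :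
    ∃ t ∈ maxUnr K Ω, ‖x - t‖ < 1 := by
  obtain ⟨q, t, hq1, hq, ht, hxt⟩ := exists_teichmuller K hx
  exact ⟨t, mem_maxUnr_of_pow_eq hq1 hq ht, hxt⟩

/-- If the automorphisms of a finite Galois extension `M / F` are determined by their action on the
residue field, then `M / F` does not enlarge the value group. -/
lemma exists_extAbs_eq {F M : Type*} [Field F] [Field M] [Algebra K M] [Algebra.IsAlgebraic K M]
    [Algebra K F] [Algebra F M] [IsScalarTower K F M] [FiniteDimensional F M] [IsGalois F M]
    (A : Submonoid M) (hA1 : ∀ a ∈ A, extAbs K M a ≤ 1)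
    (hA : ∀ s : Gal(M/F), (∀ a ∈ A, extAbs K M (s a - a) < 1) → s = 1) (x : M) :
    ∃ y : F, extAbs K M (algebraMap F M y) = extAbs K M x := by
  have hinv : ∀ (s : Gal(M/F)) (y : M), extAbs K M (s y) = extAbs K M y := fun s y =>
    extAbs_algEquiv (s.restrictScalars K) y
  have hnon := isNonarchimedean_extAbs K M
  -- by independence of the residual actions, some trace of `a * x` is as large as `x`
  obtain ⟨a, ha⟩ := exists_le_abs_sum hnon (A := A)
    (fun s : Gal(M/F) => (s : M →* M).comp A.subtype)
    (fun s a => (hinv s _).trans_le (hA1 a a.2))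
    (fun s s' hss => by
      by_contra! hc
      refine hss (inv_mul_eq_one.1 (hA (s'⁻¹ * s) fun a ha => ?_)).symm
      have := hc ⟨a, ha⟩
      rw [← hinv s'⁻¹, map_sub] at this
      change extAbs K M (s'⁻¹ (s a) - s'⁻¹ (s' a)) < 1 at this
      rwa [← AlgEquiv.mul_apply s'⁻¹ s', inv_mul_cancel] at this)
    (fun s => s x) 1
  have e : ∑ s : Gal(M/F), ((s : M →* M).comp A.subtype) a * s x =
      algebraMap F M (Algebra.trace F M (a * x)) := by
    rw [trace_eq_sum_automorphisms]
    exact Finset.sum_congr rfl fun s _ => (map_mul s _ _).symm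
  rw [e] at ha
  refine ⟨_, le_antisymm ?_ ha⟩
  rw [trace_eq_sum_automorphisms]
  refine nonarch_sum_le hnon _ _ ((extAbs K M).nonneg _) fun s _ => ?_
  rw [hinv, map_mul]
  exact mul_le_of_le_one_left ((extAbs K M).nonneg _) (hA1 _ a.2)

/-- The compositum with the maximal unramified extension has the same value group. -/
lemma exists_norm_eq_of_mem_sup [CharZero K] {F : IntermediateField K Ω} [FiniteDimensional K F]
    [IsGalois K F] {x : Ω} (hx : x ∈ F ⊔ maxUnr K Ω) : ∃ y ∈ F, ‖y‖ = ‖x‖ := by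
  obtain ⟨E, hE, hxE⟩ := exists_isUnr_of_mem_sup hx
  have := hE.finite
  have := hE.galois
  let M : IntermediateField F Ω := IntermediateField.extendScalars (le_sup_left : F ≤ F ⊔ E)
  have : FiniteDimensional K M := inferInstanceAs (FiniteDimensional K ↥(F ⊔ E))
  have : Normal K M := inferInstanceAs (Normal K ↥(F ⊔ E))
  have : IsGalois K M := { to_isSeparable := inferInstance, to_normal := this }
  have : FiniteDimensional F M := FiniteDimensional.right K F M
  have : IsGalois F M := IsGalois.tower_top_of_isGalois K F M
  have : IsScalarTower K M Ω := .of_algebraMap_eq fun _ => rfl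
  have hnorm : ∀ x : M, extAbs K M x = ‖(x : Ω)‖ := fun x => by
    rw [← extAbs_eq_norm K]
    exact (extAbs_tower (k := K) (E := M) (F := Ω) x).symm
  have := IsAlgClosure.normal K Ω
  let A : Submonoid M :=
    { carrier := {a | (a : Ω) ∈ E ∧ ‖(a : Ω)‖ ≤ 1}
      one_mem' := ⟨E.one_mem, by simp⟩
      mul_mem' := fun {a b} ha hb => ⟨E.mul_mem ha.1 hb.1, by
        change ‖(a : Ω) * b‖ ≤ 1
        rw [norm_mul]; exact mul_le_one₀ ha.2 (norm_nonneg _) hb.2⟩ }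
  obtain ⟨y, hy⟩ := exists_extAbs_eq (K := K) (F := F) A
    (fun a ha => (hnorm a).trans_le ha.2) (fun s hs => by
    let σ : Gal(Ω/K) := (s.restrictScalars K).liftNormal Ω
    have hσ : ∀ m : M, σ m = s m := fun m => AlgEquiv.liftNormal_commutes (s.restrictScalars K) Ω m
    have hσE : ∀ e ∈ E, σ e = e := fun e he => hE.apply_eq σ (fun e he he1 => by
      have hm : e ∈ F ⊔ E := le_sup_right (a := F) he
      have := hs ⟨e, hm⟩ ⟨he, he1⟩
      rw [hnorm] at this
      have h2 := hσ ⟨e, hm⟩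
      change σ e = _ at h2
      rw [h2]
      exact this) he
    have h1 : F ⊔ E ≤ IntermediateField.fixedField (Subgroup.zpowers σ) := by
      have key : ∀ x, σ x = x → x ∈ IntermediateField.fixedField (Subgroup.zpowers σ) := by
        rintro x hx ⟨τ, hτ⟩
        have : Subgroup.zpowers σ ≤ MulAction.stabilizer Gal(Ω/K) x := by
          rw [Subgroup.zpowers_le]; exact hx
        exact this hτ
      refine sup_le (fun x hx => key x ?_) (fun x hx => key x (hσE x hx))
      have h3 := hσ (algebraMap F M ⟨x, hx⟩)
      rw [s.commutes] at h3
      exact h3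
    ext m
    rw [← hσ]
    exact h1 m.2 ⟨σ, Subgroup.mem_zpowers σ⟩) ⟨x, hxE⟩
  rw [hnorm, hnorm] at hy
  exact ⟨y, y.2, hy⟩

/-- An automorphism acting trivially on the residue field of `E` acts trivially on the unramified
part of `E`. -/
lemma apply_eq_of_mem_inf [CharZero K] [LocallyCompactSpace K] {E : IntermediateField K Ω}
    (σ : Gal(Ω/K)) (hσ : ∀ x ∈ E, ‖x‖ ≤ 1 → ‖σ x - x‖ < 1) {x : Ω} (hx : x ∈ E)
    (hx' : x ∈ maxUnr K Ω) : σ x = x := by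
  have := IsUltrametricDist.of_normedAlgebra K (L := Ω)
  have := isGalois_closure K Ω
  obtain ⟨ϖ, hϖ⟩ := exists_isUnif_base K
  have hself : ∀ x : K, extAbs K K x = ‖x‖ := fun x => extAbs_algebraMap (F := K) x
  let U : IntermediateField K Ω := E ⊓ maxUnr K Ω
  have hnon := isNonarchimedean_extAbs K U
  have hunif : IsUnif (extAbs K U) (algebraMap K U ϖ) := by
    refine ⟨?_, ?_, fun u hu => ?_⟩
    · rw [extAbs_algebraMap, ← hself]; exact hϖ.pos
    · rw [extAbs_algebraMap, ← hself]; exact hϖ.lt_one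
    · obtain ⟨y, hy, hyu⟩ := exists_norm_eq_of_mem_sup (K := K) (F := ⊥) (x := (u : Ω))
        ((le_sup_right : maxUnr K Ω ≤ ⊥ ⊔ maxUnr K Ω) u.2.2)
      obtain ⟨y, rfl⟩ := IntermediateField.mem_bot.1 hy
      rw [extAbs_algebraMap, ← hself]
      rw [extAbs_coe, ← hyu, norm_algebraMap', ← hself] at hu
      rw [extAbs_coe, ← hyu, norm_algebraMap', ← hself]
      exact hϖ.le y hu
  let S : Subring U :=
    { carrier := {u | σ (u : Ω) = u}
      zero_mem' := by simp
      one_mem' := by simp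
      neg_mem' := fun {a} h => by simpa using h
      add_mem' := fun {a b} ha hb => by
        change σ ((a : Ω) + b) = a + b
        rw [map_add, show σ (a : Ω) = a from ha, show σ (b : Ω) = b from hb]
      mul_mem' := fun {a b} ha hb => by
        change σ ((a : Ω) * b) = a * b
        rw [map_mul, show σ (a : Ω) = a from ha, show σ (b : Ω) = b from hb] }
  have hres : ∀ u, extAbs K U u ≤ 1 → ∃ t ∈ S, extAbs K U t ≤ 1 ∧ extAbs K U (u - t) < 1 := by
    intro u hu
    rw [extAbs_coe] at hu
    obtain ⟨q, t, hq1, hq, ht, hut⟩ := exists_teichmuller K hu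
    have hfix : ∀ τ : Gal(Ω/K), ‖τ t - t‖ < 1 → τ t = t := fun τ h =>
      eq_of_pow_eq (isNonarchimedean_toAbsoluteValue Ω) hq1
        (by rw [← map_natCast (algebraMap K Ω)]; exact (norm_algebraMap' Ω (q : K)).trans_lt hq)
        (by rw [← map_pow, ht]) ht h
    -- conjugates of `t` over `E` are congruent to `u ∈ E`, hence to `t`
    have htE : t ∈ E := by
      rw [← InfiniteGalois.fixedField_fixingSubgroup E]
      rintro ⟨τ, hτ⟩
      refine hfix τ (norm_sub_lt (y := (u : Ω)) ?_ hut)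
      rw [← (IntermediateField.mem_fixingSubgroup_iff _ _).1 hτ u (inf_le_left (a := E) u.2),
        ← map_sub, norm_algEquiv, norm_sub_rev]
      exact hut
    have ht1 : ‖t‖ ≤ 1 := by
      have := nonarch_sub_le (isNonarchimedean_toAbsoluteValue Ω) (u : Ω) (u - t)
      rw [sub_sub_cancel] at this
      exact this.trans (max_le hu hut.le)
    refine ⟨⟨t, htE, mem_maxUnr_of_pow_eq hq1 hq ht⟩, hfix σ (hσ t htE ht1), ?_, ?_⟩
    · rw [extAbs_coe]; exact ht1
    · rw [extAbs_coe]; exact hut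
  -- `U` is generated, up to closure, by Teichmüller representatives and the uniformizer `ϖ` of `K`,
  -- all of which are fixed by `σ`
  have key : ∀ u : U, extAbs K U u ≤ 1 → σ (u : Ω) = u := by
    intro u hu
    have hm : ∀ m : ℕ, ‖σ (u : Ω) - u‖ ≤ ‖ϖ‖ ^ m := fun m => by
      have := sub_le_of_unif hnon hunif S hres (isNonarchimedean_toAbsoluteValue Ω)
        ((σ : Ω →+* Ω).comp (algebraMap U Ω)) (algebraMap U Ω)
        (fun x => (norm_algEquiv σ (x : Ω)).trans (extAbs_coe x).symm) (fun x => (extAbs_coe x).symm)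
        m (fun t ht _ => by
          have : σ (t : Ω) = t := ht
          simp [this])
        (by
          have : σ (algebraMap K Ω ϖ) = algebraMap K Ω ϖ := σ.commutes ϖ
          simp [this, ← IsScalarTower.algebraMap_apply]) hu
      rw [extAbs_algebraMap] at this
      exact this
    have hlim := tendsto_pow_atTop_nhds_zero_of_lt_one (norm_nonneg ϖ)
      (by rw [← hself]; exact hϖ.lt_one)
    have h0 := ge_of_tendsto' hlim hm
    exact sub_eq_zero.1 (norm_le_zero_iff.1 h0)
  rcases le_total ‖x‖ 1 with h | h
  · exact key ⟨x, hx, hx'⟩ (by rw [extAbs_coe]; exact h)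
  · have h1 := key ⟨x⁻¹, E.inv_mem hx, (maxUnr K Ω).inv_mem hx'⟩
      (by rw [extAbs_coe]; change ‖x⁻¹‖ ≤ 1; rw [norm_inv]; exact inv_le_one_of_one_le₀ h)
    change σ x⁻¹ = x⁻¹ at h1
    rw [map_inv₀] at h1
    exact inv_injective h1

end MaxUnr

/-! ### Extensions generated by a base change -/

section BaseChangeField

variable {K E K' E' : Type*} [Field K] [Field E] [Field K'] [Field E'] [Algebra K E]
    [Algebra K' E'] [Algebra K K'] [Algebra E E'] [Algebra K E'] [IsScalarTower K E E']
    [IsScalarTower K K' E'] (h : IntermediateField.adjoin K' (Set.range (algebraMap E E')) = ⊤)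
include h

variable (K E) in
lemma isAlgebraic_of_adjoin_range [Algebra.IsAlgebraic K E] : Algebra.IsAlgebraic K' E' := by
  have h1 : Algebra.IsAlgebraic K' (IntermediateField.adjoin K' (Set.range (algebraMap E E'))) := by
    refine IntermediateField.isAlgebraic_adjoin ?_
    rintro _ ⟨x, rfl⟩
    have : IsIntegral K x := (Algebra.IsAlgebraic.isAlgebraic x).isIntegral
    exact (this.map (IsScalarTower.toAlgHom K E E')).tower_top
  rw [h] at h1
  exact (IntermediateField.topEquiv (F := K') (E := E')).isAlgebraic

variable (K E) in
lemma normal_of_adjoin_range [Normal K E] : Normal K' E' := by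
  have := isAlgebraic_of_adjoin_range K E h
  refine normal_iff.2 fun x => ⟨(Algebra.IsAlgebraic.isAlgebraic x).isIntegral, ?_⟩
  refine IntermediateField.splits_of_mem_adjoin (F := K') (K := E') (L := E')
    (S := Set.range (algebraMap E E')) ?_
    (by rw [h]; exact IntermediateField.mem_top)
  rintro _ ⟨y, rfl⟩
  have hy : IsIntegral K y := Normal.isIntegral inferInstance y
  refine ⟨(hy.map (IsScalarTower.toAlgHom K E E')).tower_top, ?_⟩
  have h1 : ((minpoly K y).map (algebraMap K E')).Splits := by
    rw [IsScalarTower.algebraMap_eq K E E', ← Polynomial.map_map]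
    exact (Normal.splits inferInstance y).map _
  have h2 : minpoly K' (algebraMap E E' y) ∣ (minpoly K y).map (algebraMap K K') := by
    refine minpoly.dvd _ _ ?_
    rw [Polynomial.aeval_map_algebraMap, Polynomial.aeval_algebraMap_apply, minpoly.aeval, map_zero]
  have h3 := Polynomial.map_dvd (algebraMap K' E') h2
  rw [Polynomial.map_map, ← IsScalarTower.algebraMap_eq] at h3
  exact h1.of_dvd ((Polynomial.map_ne_zero (minpoly.ne_zero hy))) h3

variable (K E) in
lemma finiteDimensional_of_adjoin_range [FiniteDimensional K E] : FiniteDimensional K' E' := by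
  let b := Module.finBasis K E
  let S : Set E' := Set.range fun i => algebraMap E E' (b i)
  have hS : IntermediateField.adjoin K' S = ⊤ := by
    rw [← top_le_iff, ← h, IntermediateField.adjoin_le_iff]
    rintro _ ⟨x, rfl⟩
    rw [← b.sum_repr x, map_sum]
    refine sum_mem fun i _ => ?_
    rw [Algebra.smul_def, map_mul, ← IsScalarTower.algebraMap_apply,
      IsScalarTower.algebraMap_apply K K' E']
    exact mul_mem (IntermediateField.algebraMap_mem _ _)
      (IntermediateField.subset_adjoin _ _ ⟨i, rfl⟩)
  have h1 : FiniteDimensional K' (IntermediateField.adjoin K' S) := by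
    refine IntermediateField.finiteDimensional_adjoin ?_
    rintro _ ⟨i, rfl⟩
    have : IsIntegral K (b i) := (Algebra.IsAlgebraic.isAlgebraic _).isIntegral
    exact (this.map (IsScalarTower.toAlgHom K E E')).tower_top
  rw [hS] at h1
  exact Module.Finite.equiv (IntermediateField.topEquiv (F := K') (E := E')).toLinearEquiv

end BaseChangeField

/-- A set of elements generates an intermediate field as soon as it does so in the big field. -/
lemma adjoin_eq_top_of_image {k M : Type*} [Field k] [Field M] [Algebra k M]
    {E : IntermediateField k M} {S : Set E} (h : E ≤ IntermediateField.adjoin k (E.val '' S)) :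
    IntermediateField.adjoin k S = ⊤ := by
  apply IntermediateField.lift_injective
  rw [IntermediateField.lift_top, IntermediateField.lift_adjoin]
  refine le_antisymm ?_ h
  rw [IntermediateField.adjoin_le_iff]
  rintro _ ⟨x, -, rfl⟩
  exact x.2

/-! ### The completion of the maximal unramified extension -/

section UnrHat

variable (K : Type*) [NontriviallyNormedField K] [IsUltrametricDist K]
  (Ω : Type*) [NormedField Ω] [NormedAlgebra K Ω]

include K in
lemma isUltrametricDist_completion : IsUltrametricDist (Completion Ω) :=
  IsUltrametricDist.of_normedAlgebra K

lemma algebraMap_mem_unrHat (x : K) : algebraMap K (Completion Ω) x ∈ unrHat K Ω :=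
  subset_closure ⟨algebraMap K Ω x, (maxUnr K Ω).algebraMap_mem x, rfl⟩

/-- The inclusion of `K` into `K'`. -/
instance algebraUnrHat : Algebra K (unrHat K Ω) :=
  ((algebraMap K (Completion Ω)).codRestrict (unrHat K Ω) (algebraMap_mem_unrHat K Ω)).toAlgebra

instance isScalarTower_unrHat : IsScalarTower K (unrHat K Ω) (Completion Ω) :=
  .of_algebraMap_eq fun _ => rfl

lemma norm_algebraMap_unrHat (x : K) : ‖algebraMap K (unrHat K Ω) x‖ = ‖x‖ :=
  norm_algebraMap' (Completion Ω) x

instance nontriviallyNormedFieldUnrHat : NontriviallyNormedField (unrHat K Ω) where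
  __ := SubfieldClass.toNormedField (unrHat K Ω)
  non_trivial := by
    obtain ⟨x, hx⟩ := NontriviallyNormedField.non_trivial (α := K)
    exact ⟨algebraMap K (unrHat K Ω) x, by rwa [norm_algebraMap_unrHat]⟩

instance completeSpace_unrHat : CompleteSpace (unrHat K Ω) :=
  (Subfield.isClosed_topologicalClosure _).completeSpace_coe

instance charZero_unrHat [CharZero K] : CharZero (unrHat K Ω) :=
  charZero_of_injective_algebraMap (algebraMap K (unrHat K Ω)).injective

variable {K Ω}

omit [IsUltrametricDist K] in
/-- Elements of the completion of a subfield are approximated by elements of the subfield. -/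
lemma exists_norm_coe_sub_lt {F : IntermediateField K Ω} {x : Completion Ω} (hx : x ∈ hat F) {ε : ℝ}
    (hε : 0 < ε) : ∃ y ∈ F, ‖x - (y : Completion Ω)‖ < ε := by
  obtain ⟨_, ⟨y, hy, rfl⟩, hxy⟩ := Metric.mem_closure_iff.1 hx ε hε
  exact ⟨y, hy, by rwa [dist_eq_norm] at hxy⟩

variable [CompleteSpace K] [IsAlgClosure K Ω]

/-- The completion of the maximal unramified extension contains no further algebraic elements. -/
lemma mem_maxUnr_of_coe_mem [CharZero K] {x : Ω} (hx : (x : Completion Ω) ∈ unrHat K Ω) :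
    x ∈ maxUnr K Ω := by
  have := isGalois_closure K Ω
  have := IsUltrametricDist.of_normedAlgebra K (L := Ω)
  rw [← InfiniteGalois.fixedField_fixingSubgroup (maxUnr K Ω)]
  rintro ⟨σ, hσ⟩
  change σ x = x
  -- Krasner: `x` is close to some `y` in `K^unr`, and so is `σ x`
  by_contra hne
  obtain ⟨y, hy, hxy⟩ := exists_norm_coe_sub_lt hx (norm_pos_iff.2 (sub_ne_zero.2 hne))
  rw [← Completion.coe_sub, Completion.norm_coe] at hxy
  refine lt_irrefl _ (norm_sub_lt (x := σ x) (y := y) (z := x) ?_ (by rwa [norm_sub_rev]))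
  rw [← (IntermediateField.mem_fixingSubgroup_iff _ _).1 hσ y hy, ← map_sub,
    norm_algEquiv (K := K)]
  exact hxy

/-- Every integer of the completed algebraic closure is congruent to an unramified element. -/
lemma exists_unrHat_sub_lt [CharZero K] [LocallyCompactSpace K] {x : Completion Ω} (hx : ‖x‖ ≤ 1) :
    ∃ t : unrHat K Ω, ‖x - t‖ < 1 := by
  have := isUltrametricDist_completion K Ω
  obtain ⟨_, ⟨y, rfl⟩, hxy⟩ := Metric.mem_closure_iff.1 (Completion.denseRange_coe x) 1 one_pos
  rw [dist_eq_norm] at hxy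
  have hy : ‖y‖ ≤ 1 := by
    rw [← Completion.norm_coe]
    have := nonarch_sub_le (isNonarchimedean_toAbsoluteValue (Completion Ω)) x (x - y)
    rw [sub_sub_cancel] at this
    exact this.trans (max_le hx hxy.le)
  obtain ⟨t, ht, hyt⟩ := exists_mem_maxUnr_sub_lt (K := K) hy
  refine ⟨⟨t, subset_closure ⟨t, ht, rfl⟩⟩, norm_sub_lt hxy ?_⟩
  change ‖(y : Completion Ω) - (t : Completion Ω)‖ < 1
  rwa [← Completion.coe_sub, Completion.norm_coe]

end UnrHat

section Embedding

variable {K : Type*} [NontriviallyNormedField K] [IsUltrametricDist K] [CompleteSpace K]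
  {Ω : Type*} [NormedField Ω] [NormedAlgebra K Ω] [IsAlgClosure K Ω]
  {E : Type*} [Field E] [Algebra K E]
  {E' : Type*} [Field E'] [Algebra (unrHat K Ω) E'] [Algebra.IsAlgebraic (unrHat K Ω) E']

omit [IsAlgClosure K Ω] in
lemma extAbs_eq_norm_embedding [Algebra.IsAlgebraic K E] (j : E →ₐ[K] Ω) (x : E) :
    extAbs K E x = ‖j x‖ :=
  extAbs_unique ((NormedField.toAbsoluteValue Ω).comp (j : E →+* Ω).injective) (fun x => by
    change ‖j (algebraMap K E x)‖ = _
    rw [j.commutes, norm_algebraMap']) x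

omit [CompleteSpace K] [IsAlgClosure K Ω] in
lemma extAbs_eq_norm_embedding' (i : E' →ₐ[unrHat K Ω] Completion Ω) (x : E') :
    extAbs (unrHat K Ω) E' x = ‖i x‖ :=
  extAbs_unique ((NormedField.toAbsoluteValue _).comp (i : E' →+* Completion Ω).injective) (fun x => by
    change ‖i (algebraMap _ E' x)‖ = _
    rw [i.commutes]; rfl) x

/-- Extensions of the completed maximal unramified extension are totally ramified. -/
lemma isResTrivial_of_embedding [CharZero K] [LocallyCompactSpace K]
    (i : E' →ₐ[unrHat K Ω] Completion Ω) : IsResTrivial (unrHat K Ω) E' := by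
  intro x hx
  rw [extAbs_eq_norm_embedding' i] at hx
  obtain ⟨t, ht⟩ := exists_unrHat_sub_lt (K := K) hx
  refine ⟨t, ?_⟩
  rw [extAbs_eq_norm_embedding' i, map_sub, i.commutes]
  exact ht

variable [Algebra E E']

/-- Extensions inside the completion of `Ω` arise by unramified base change: an inertia element
of `E / K` extends to an automorphism of `Ω`, which fixes `E ∩ K^unr`. -/
lemma isUnrBaseChange_of_embedding [CharZero K] [LocallyCompactSpace K] [Normal K E]
    (j : E →ₐ[K] Ω) (i : E' →ₐ[unrHat K Ω] Completion Ω) (hij : ∀ x, i (algebraMap E E' x) = (j x : Ω))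
    (hadj : IntermediateField.adjoin (unrHat K Ω) (Set.range (algebraMap E E')) = ⊤) :
    IsUnrBaseChange K E (unrHat K Ω) E' where
  norm := norm_algebraMap_unrHat K Ω
  adjoin := hadj
  res := isResTrivial_of_embedding i
  inertia τ hτ x hx := by
    rw [mem_lowerRam_zero_iff] at hτ
    have := IsAlgClosure.normal K Ω
    let : Algebra E Ω := j.toRingHom.toAlgebra
    have : IsScalarTower K E Ω := .of_algebraMap_eq fun x => (j.commutes x).symm
    let σ : Gal(Ω/K) := τ.liftNormal Ω
    have hσ : ∀ y : E, σ (j y) = j (τ y) := fun y => AlgEquiv.liftNormal_commutes τ Ω y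
    have hjx : j x ∈ maxUnr K Ω := by
      refine mem_maxUnr_of_coe_mem ?_
      obtain ⟨y, hy⟩ := hx
      rw [← hij, ← hy, i.commutes]
      exact y.2
    have := apply_eq_of_mem_inf (E := j.fieldRange) σ (by
      rintro _ ⟨y, rfl⟩ hy
      have h1 := hτ y (by rw [extAbs_eq_norm_embedding j]; exact hy)
      rw [extAbs_eq_norm_embedding j, map_sub, ← hσ] at h1
      exact h1) ⟨x, rfl⟩ hjx
    change σ (j x) = j x at this
    rw [hσ] at this
    exact (j : E →+* Ω).injective this

/-- A uniformizer of `E` remains one in a subextension of the completion of `E K^unr`. -/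
lemma isUnif_of_embedding [CharZero K] [FiniteDimensional K E] [IsGalois K E]
    (j : E →ₐ[K] Ω) (i : E' →ₐ[unrHat K Ω] Completion Ω) (hij : ∀ x, i (algebraMap E E' x) = (j x : Ω))
    (hi : ∀ x, i x ∈ hat (j.fieldRange ⊔ maxUnr K Ω)) {π : E} (hπ : IsUnif (extAbs K E) π) :
    IsUnif (extAbs (unrHat K Ω) E') (algebraMap E E' π) := by
  have := isUltrametricDist_completion K Ω
  have hval : extAbs (unrHat K Ω) E' (algebraMap E E' π) = extAbs K E π := by
    rw [extAbs_eq_norm_embedding' i, hij, extAbs_eq_norm_embedding j, Completion.norm_coe]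
  let e : E ≃ₐ[K] j.fieldRange := AlgEquiv.ofInjectiveField j
  have : FiniteDimensional K j.fieldRange := Module.Finite.equiv e.toLinearEquiv
  have : IsGalois K j.fieldRange := IsGalois.of_algEquiv e
  refine ⟨hval ▸ hπ.pos, hval ▸ hπ.lt_one, fun x hx => ?_⟩
  rw [hval]
  by_cases hx0 : x = 0
  · rw [hx0, map_zero]; exact hπ.pos.le
  rw [extAbs_eq_norm_embedding' i] at hx ⊢
  have hix : 0 < ‖i x‖ := norm_pos_iff.2 (by rwa [map_ne_zero])
  obtain ⟨y, hy, hxy⟩ := exists_norm_coe_sub_lt (hi x) hix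
  have h1 : ‖(y : Completion Ω)‖ = ‖i x‖ :=
    nonarch_eq_of_sub_lt (isNonarchimedean_toAbsoluteValue (Completion Ω))
      (x := (y : Completion Ω)) (y := i x)
      (by change ‖(y : Completion Ω) - i x‖ < ‖i x‖; rwa [norm_sub_rev])
  rw [Completion.norm_coe] at h1
  obtain ⟨_, ⟨z, rfl⟩, hz⟩ := exists_norm_eq_of_mem_sup hy
  have h2 : extAbs K E z = ‖i x‖ := by rw [extAbs_eq_norm_embedding j, ← h1, ← hz]; rfl
  rw [← h2]
  exact hπ.le z (h2 ▸ hx)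

end Embedding

section ExtHat

variable {K : Type*} [NontriviallyNormedField K] [IsUltrametricDist K]
  {Ω : Type*} [NormedField Ω] [NormedAlgebra K Ω]

lemma coe_mem_extHat {F : IntermediateField K Ω} {x : Ω} (hx : x ∈ F) :
    (x : Completion Ω) ∈ extHat F :=
  subset_closure ⟨x, (le_sup_left : F ≤ F ⊔ maxUnr K Ω) hx, rfl⟩

/-- The inclusion of `F` into the completion `extHat F` of `F K^unr`. -/
instance algebraExtHat (F : IntermediateField K Ω) : Algebra F (extHat F) :=
  (((algebraMap Ω (Completion Ω)).comp (algebraMap F Ω)).codRestrict (extHat F)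
    fun x => coe_mem_extHat x.2).toAlgebra

/-- A finite extension of the complete field `K'` is closed. -/
lemma isClosed_of_finiteDimensional (A : IntermediateField (unrHat K Ω) (Completion Ω))
    [FiniteDimensional (unrHat K Ω) A] : IsClosed (A : Set (Completion Ω)) :=
  have : FiniteDimensional (unrHat K Ω) (Subalgebra.toSubmodule A.toSubalgebra) :=
    inferInstanceAs (FiniteDimensional (unrHat K Ω) A)
  Submodule.closed_of_finiteDimensional (Subalgebra.toSubmodule A.toSubalgebra)

/-- For a finite extension `F / K`, the completion of `F K^unr` is generated by `F`. -/
lemma extHat_eq_adjoin (F : IntermediateField K Ω) [FiniteDimensional K F] :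
    extHat F = IntermediateField.adjoin (unrHat K Ω) (algebraMap Ω (Completion Ω) '' F) := by
  set A := IntermediateField.adjoin (unrHat K Ω) (algebraMap Ω (Completion Ω) '' F)
  have hFA : ∀ x ∈ F, (x : Completion Ω) ∈ A := fun x hx =>
    IntermediateField.subset_adjoin _ _ ⟨x, hx, rfl⟩
  apply le_antisymm
  · have : FiniteDimensional (unrHat K Ω) A := by
      let : Algebra F A := (((algebraMap Ω (Completion Ω)).comp (algebraMap F Ω)).codRestrict A
        fun x => hFA x x.2).toAlgebra
      have : IsScalarTower K F A := .of_algebraMap_eq fun _ => rfl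
      have : IsScalarTower K (unrHat K Ω) A := .of_algebraMap_eq fun _ => rfl
      refine finiteDimensional_of_adjoin_range K F (adjoin_eq_top_of_image ?_)
      refine IntermediateField.adjoin.mono _ _ _ ?_
      rintro _ ⟨x, hx, rfl⟩
      exact ⟨_, ⟨⟨x, hx⟩, rfl⟩, rfl⟩
    refine closure_minimal ?_ (isClosed_of_finiteDimensional A)
    have h1 : F ⊔ maxUnr K Ω ≤
        (A.restrictScalars K).comap (IsScalarTower.toAlgHom K Ω (Completion Ω)) := by
      refine sup_le (fun x hx => hFA x hx) (fun x hx => ?_)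
      exact A.algebraMap_mem (⟨x, subset_closure ⟨x, hx, rfl⟩⟩ : unrHat K Ω)
    rintro _ ⟨x, hx, rfl⟩
    exact h1 hx
  · rw [IntermediateField.adjoin_le_iff]
    rintro _ ⟨x, hx, rfl⟩
    exact coe_mem_extHat hx

lemma adjoin_range_extHat (F : IntermediateField K Ω) [FiniteDimensional K F] :
    IntermediateField.adjoin (unrHat K Ω) (Set.range (algebraMap F (extHat F))) = ⊤ := by
  refine adjoin_eq_top_of_image ?_
  conv_lhs => rw [extHat_eq_adjoin]
  refine IntermediateField.adjoin.mono _ _ _ ?_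
  rintro _ ⟨x, hx, rfl⟩
  exact ⟨_, ⟨⟨x, hx⟩, rfl⟩, rfl⟩

end ExtHat

/-! ### The action on the residue field -/

section Residue

universe u

variable {k : Type*} {F : Type u} [NontriviallyNormedField k] [IsUltrametricDist k]
  [CompleteSpace k] [LocallyCompactSpace k] [Field F] [Algebra k F] [FiniteDimensional k F]

variable (k F) in
/-- The Galois group modulo inertia acts faithfully on the finite residue field, hence is cyclic. -/
lemma exists_cyclic_residue : ∃ (A : Type u) (_ : Group A) (_ : IsCyclic A) (Θ : Gal(F/k) →* A),
    ∀ σ, Θ σ = 1 → σ ∈ lowerRam k F 0 := by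
  have := finite_residue k F
  have := maxIdeal_isMaximal k F
  have hm := mem_maxIdeal_iff (extInt_inj k F) (isNonarchimedean_extAbs k F) (extInt_range k F)
  let R := extInt k F ⧸ maxIdeal (extInt k F)
  let : Field R := Ideal.Quotient.field _
  have : Finite R := finite_residue k F
  obtain ⟨ℓ, hℓ⟩ := CharP.exists R
  have : Fact ℓ.Prime := ⟨CharP.char_is_prime R ℓ⟩
  let : Algebra (ZMod ℓ) R := ZMod.algebra R ℓ
  have hle : ∀ σ : Gal(F/k), maxIdeal (extInt k F) ≤
      (maxIdeal (extInt k F)).comap (MulSemiringAction.toRingHom Gal(F/k) (extInt k F) σ) := by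
    intro σ x hx
    rw [Ideal.mem_comap, hm]
    rw [hm] at hx
    change extAbs k F (σ x) < 1
    rw [extAbs_algEquiv]
    exact hx
  let f : Gal(F/k) → (R →+* R) := fun σ => Ideal.quotientMap _ _ (hle σ)
  have hf : ∀ σ x, f σ (Ideal.Quotient.mk _ x) = Ideal.Quotient.mk _ (σ • x) := fun σ x => rfl
  let Θ₀ : Gal(F/k) →* (R →ₐ[ZMod ℓ] R) :=
    { toFun σ := { f σ with
        commutes' := fun x => RingHom.congr_fun (Subsingleton.elim ((f σ).comp (algebraMap (ZMod ℓ) R))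
          (algebraMap (ZMod ℓ) R)) x }
      map_one' := by
        ext x
        obtain ⟨x, rfl⟩ := Ideal.Quotient.mk_surjective x
        change f 1 (Ideal.Quotient.mk _ x) = _
        rw [hf, one_smul]; rfl
      map_mul' σ τ := by
        ext x
        obtain ⟨x, rfl⟩ := Ideal.Quotient.mk_surjective x
        change f (σ * τ) (Ideal.Quotient.mk _ x) = f σ (f τ (Ideal.Quotient.mk _ x))
        rw [hf, hf, hf, mul_smul] }
  refine ⟨R ≃ₐ[ZMod ℓ] R, inferInstance, inferInstance,
    (AlgEquiv.algHomUnitsEquiv (ZMod ℓ) R).toMonoidHom.comp Θ₀.toHomUnits, fun σ hσ => ?_⟩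
  have h1 : Θ₀ σ = 1 := by
    have h2 : AlgEquiv.algHomUnitsEquiv (ZMod ℓ) R (Θ₀.toHomUnits σ) = 1 := hσ
    rw [EmbeddingLike.map_eq_one_iff] at h2
    exact congrArg Units.val h2
  rw [mem_lowerRam_zero_iff]
  intro x hx
  have h3 : f σ (Ideal.Quotient.mk _ ⟨x, (mem_extInt_iff x).2 hx⟩) = Ideal.Quotient.mk _ _ :=
    DFunLike.congr_fun h1 (Ideal.Quotient.mk _ ⟨x, (mem_extInt_iff x).2 hx⟩)
  rw [hf, Ideal.Quotient.eq, hm] at h3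
  exact h3

/-- The quotient of the Galois group by inertia is abelian. -/
lemma commutator_mem_lowerRam (σ τ : Gal(F/k)) : σ * τ * σ⁻¹ * τ⁻¹ ∈ lowerRam k F 0 := by
  obtain ⟨A, _, _, Θ, hΘ⟩ := exists_cyclic_residue k F
  apply hΘ
  have : Θ σ * Θ τ = Θ τ * Θ σ := (IsCyclic.isMulCommutative (α := A)).is_comm.comm _ _
  simp [this]

/-- The image of every subgroup in the quotient by inertia is cyclic. -/
lemma exists_zpow_mem_lowerRam (P : Subgroup Gal(F/k)) :
    ∃ g ∈ P, ∀ x ∈ P, ∃ n : ℤ, (g ^ n)⁻¹ * x ∈ lowerRam k F 0 := by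
  obtain ⟨A, _, _, Θ, hΘ⟩ := exists_cyclic_residue k F
  obtain ⟨⟨_, g, hg, rfl⟩, hgen⟩ := IsCyclic.exists_generator (α := P.map Θ)
  refine ⟨g, hg, fun x hx => ?_⟩
  obtain ⟨n, hn⟩ := hgen ⟨Θ x, x, hx, rfl⟩
  refine ⟨n, hΘ _ ?_⟩
  have h1 : Θ g ^ n = Θ x := congrArg Subtype.val hn
  rw [map_mul, map_inv, map_zpow, h1, inv_mul_cancel]

end Residue

/-! ### Towers in an infinite extension -/

section FixedField

variable {K L : Type*} [Field K] [Field L] [Algebra K L] [IsGalois K L]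

lemma finiteDimensional_fixedField {N : Subgroup Gal(L/K)} (hN : IsOpen (N : Set Gal(L/K))) :
    FiniteDimensional K (IntermediateField.fixedField N) := by
  rw [← InfiniteGalois.isOpen_iff_finite,
    InfiniteGalois.fixingSubgroup_fixedField ⟨N, N.isClosed_of_isOpen hN⟩]
  exact hN

lemma isGalois_fixedField {N : Subgroup Gal(L/K)} (hN : IsOpen (N : Set Gal(L/K))) (h : N.Normal) :
    IsGalois K (IntermediateField.fixedField N) := by
  rw [← InfiniteGalois.normal_iff_isGalois,
    InfiniteGalois.fixingSubgroup_fixedField ⟨N, N.isClosed_of_isOpen hN⟩]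
  exact h

end FixedField

section Tower

variable {K : Type*} [NontriviallyNormedField K]
  {Ω : Type*} [NormedField Ω] [NormedAlgebra K Ω] {L : IntermediateField K Ω}

lemma extHat_mono [IsUltrametricDist K] {F F' : IntermediateField K Ω} (h : F ≤ F') :
    extHat F ≤ extHat F' :=
  closure_mono (Set.image_mono (sup_le_sup_right h (maxUnr K Ω)))

lemma tower_mono {Γ : ℕ → Subgroup Gal(L/K)} (hΓ : Antitone Γ) : Monotone (tower Γ) := by
  intro i j hij
  exact IntermediateField.map_mono _ (IntermediateField.fixedField_antitone (hΓ hij))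

lemma mem_towerHat_iff [IsUltrametricDist K] {T : ℕ → IntermediateField K Ω} (hT : Monotone T)
    {x : Completion Ω} :
    x ∈ towerHat T ↔ ∃ i, x ∈ extHat (T i) := by
  rw [towerHat, ← SetLike.mem_coe, IntermediateField.coe_iSup_of_directed, Set.mem_iUnion]
  · rfl
  · exact (Monotone.directed_le fun i j hij => extHat_mono (hT hij))

variable [IsGalois K L] {Γ : ℕ → Subgroup Gal(L/K)}

variable {p : ℕ} (hP : IsPowFiltration p Γ)
include hP

lemma IsPowFiltration.finiteDimensional_tower (i : ℕ) : FiniteDimensional K (tower Γ i) :=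
  have := finiteDimensional_fixedField (hP.isOpen i)
  Module.Finite.equiv (IntermediateField.liftAlgEquiv (IntermediateField.fixedField (Γ i))).toLinearEquiv

lemma IsPowFiltration.isGalois_tower (i : ℕ) : IsGalois K (tower Γ i) :=
  have := isGalois_fixedField (hP.isOpen i) (hP.normal i)
  IsGalois.of_algEquiv (IntermediateField.liftAlgEquiv (IntermediateField.fixedField (Γ i)))

/-- The fixed fields of a Lie filtration exhaust the extension. -/
lemma IsPowFiltration.exists_mem_tower {x : Ω} (hx : x ∈ L) : ∃ i, x ∈ tower Γ i := by
  have : Algebra.IsAlgebraic K L := inferInstance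
  have h1 : (MulAction.stabilizer Gal(L/K) (⟨x, hx⟩ : L) : Set Gal(L/K)) ∈ nhds 1 :=
    (stabilizer_isOpen_of_isIntegral _).mem_nhds (one_mem _)
  obtain ⟨i, hi⟩ := hP.exists_le h1
  refine ⟨i, (IntermediateField.mem_lift (⟨x, hx⟩ : L)).2 ?_⟩
  rintro ⟨σ, hσ⟩
  exact hi hσ

end Tower

/-! ### Unramified base change of infinite Galois extensions -/

section InfiniteBaseChange

section GenField

variable {K L : Type*} (K' L' : Type*) [Field K] [Field L] [Field K'] [Field L'] [Algebra K L]
    [Algebra K' L'] [Algebra K K'] [Algebra L L'] [Algebra K L'] [IsScalarTower K L L']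
    [IsScalarTower K K' L']

/-- The subextension of `L' / K'` generated by a subextension `E` of `L / K`. -/
def genField (E : IntermediateField K L) : IntermediateField K' L' :=
  IntermediateField.adjoin K' (algebraMap L L' '' E)

variable {K' L'}

omit [Algebra K K'] [IsScalarTower K L L'] [Algebra K L'] [IsScalarTower K K' L'] in
lemma algebraMap_mem_genField {E : IntermediateField K L} {x : L} (hx : x ∈ E) :
    algebraMap L L' x ∈ genField K' L' E :=
  IntermediateField.subset_adjoin _ _ ⟨x, hx, rfl⟩

/-- The inclusion of `E` into the subextension generated by it. -/
instance algebraGenField (E : IntermediateField K L) : Algebra E (genField K' L' E) :=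
  (((algebraMap L L').comp (algebraMap E L)).codRestrict (genField K' L' E)
    fun x => algebraMap_mem_genField x.2).toAlgebra

instance isScalarTower_genField (E : IntermediateField K L) :
    IsScalarTower K E (genField K' L' E) :=
  .of_algebraMap_eq fun x => Subtype.ext (IsScalarTower.algebraMap_apply K L L' x)

instance isScalarTower_genField' (E : IntermediateField K L) :
    IsScalarTower K K' (genField K' L' E) :=
  .of_algebraMap_eq fun x => Subtype.ext (IsScalarTower.algebraMap_apply K K' L' x)

omit [Algebra K K'] [Algebra K L'] [IsScalarTower K L L'] [IsScalarTower K K' L'] in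
lemma adjoin_range_genField (E : IntermediateField K L) :
    IntermediateField.adjoin K' (Set.range (algebraMap E (genField K' L' E))) = ⊤ := by
  refine adjoin_eq_top_of_image (IntermediateField.adjoin.mono _ _ _ ?_)
  rintro _ ⟨x, hx, rfl⟩
  exact ⟨_, ⟨⟨x, hx⟩, rfl⟩, rfl⟩

instance normal_genField (E : IntermediateField K L) [Normal K E] : Normal K' (genField K' L' E) :=
  normal_of_adjoin_range K E (adjoin_range_genField E)

instance finiteDimensional_genField (E : IntermediateField K L) [FiniteDimensional K E] :
    FiniteDimensional K' (genField K' L' E) :=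
  finiteDimensional_of_adjoin_range K E (adjoin_range_genField E)

instance isGalois_genField [IsGalois K' L'] (E : IntermediateField K L) [IsGalois K E] :
    IsGalois K' (genField K' L' E) where

/-- Restriction to `E` of the restriction to `L` is the restriction of the restriction to the
extension generated by `E`. -/
lemma restrict_baseChangeRes [Normal K L] (E : IntermediateField K L) [Normal K E]
    (σ : Gal(L'/K')) :
    AlgEquiv.restrictNormalHom E (baseChangeRes K L K' L' σ) =
      baseChangeRes K E K' (genField K' L' E)
        (AlgEquiv.restrictNormalHom (genField K' L' E) σ) := by
  ext x
  apply (algebraMap L L').injective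
  have h1 : ((AlgEquiv.restrictNormalHom E (baseChangeRes K L K' L' σ) x : E) : L) =
    baseChangeRes K L K' L' σ x := AlgEquiv.restrictNormal_commutes _ E x
  rw [h1, algebraMap_baseChangeRes]
  have h2 := congrArg (fun y : genField K' L' E => (y : L'))
    (algebraMap_baseChangeRes (K := K) (AlgEquiv.restrictNormalHom (genField K' L' E) σ) x)
  have h3 : ((AlgEquiv.restrictNormalHom (genField K' L' E) σ
    (algebraMap E (genField K' L' E) x) : genField K' L' E) : L') = σ (algebraMap L L' x) :=
    AlgEquiv.restrictNormal_commutes σ (genField K' L' E) _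
  exact h3.symm.trans h2.symm

end GenField

section Layers

variable {K L : Type*} [NontriviallyNormedField K] [IsUltrametricDist K] [CompleteSpace K]
  [Field L] [Algebra K L] [IsGalois K L]

/-- An automorphism of an infinite extension acts trivially on the residue field if it does so on all
finite layers. -/
lemma mem_lowerRam_zero_iff_restrict (σ : Gal(L/K)) : σ ∈ lowerRam K L 0 ↔
    ∀ (E : IntermediateField K L) (_ : FiniteDimensional K E) (_ : IsGalois K E),
      AlgEquiv.restrictNormalHom E σ ∈ lowerRam K E 0 := by
  have key : ∀ (E : IntermediateField K L) [FiniteDimensional K E] [IsGalois K E] (x : E),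
      extAbs K E (AlgEquiv.restrictNormalHom E σ x - x) = extAbs K L (σ x - x) := by
    intro E _ _ x
    have h1 : algebraMap E L (AlgEquiv.restrictNormalHom E σ x) = σ x :=
      AlgEquiv.restrictNormal_commutes σ E x
    rw [← extAbs_tower (F := L), map_sub, h1]
    rfl
  constructor
  · intro hσ E _ _
    rw [mem_lowerRam_zero_iff] at hσ ⊢
    intro x hx
    rw [key]
    refine hσ x ?_
    rw [← extAbs_tower (F := L)] at hx
    exact hx
  · intro hσ
    rw [mem_lowerRam_zero_iff]
    intro x hx
    let E := FiniteGaloisIntermediateField.adjoin K {x}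
    have hxE : x ∈ E.toIntermediateField :=
      FiniteGaloisIntermediateField.subset_adjoin K {x} rfl
    have h1 := (mem_lowerRam_zero_iff _).1 (hσ E.toIntermediateField inferInstance inferInstance)
      ⟨x, hxE⟩ (by rw [← extAbs_tower (F := L)]; exact hx)
    rwa [key] at h1

end Layers

/-- The hypotheses under which ramification groups of `L / K` and `L' / K'` are compared: all finite
layers of `L' / K'` arise by unramified base change without change of the uniformizers. -/
structure IsUnrTower (K L K' L' : Type*) [NontriviallyNormedField K] [IsUltrametricDist K]
    [CompleteSpace K] [Field L] [Algebra K L] [IsGalois K L]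
    [NontriviallyNormedField K'] [IsUltrametricDist K'] [CompleteSpace K'] [Field L'] [Algebra K' L']
    [IsGalois K' L'] [Algebra K K'] [Algebra L L'] [Algebra K L'] [IsScalarTower K L L']
    [IsScalarTower K K' L'] : Prop where
  base : IsUnrBaseChange K L K' L'
  layer : ∀ (E : IntermediateField K L) [FiniteDimensional K E] [IsGalois K E],
    IsUnrBaseChange K E K' (genField K' L' E)
  unif : ∀ (E : IntermediateField K L) [FiniteDimensional K E] [IsGalois K E],
    ∃ π : E, IsUnif (extAbs K E) π ∧
      IsUnif (extAbs K' (genField K' L' E)) (algebraMap E (genField K' L' E) π)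
  unif' : ∃ ϖ : K', IsUnif (extAbs K' K') ϖ
  exists_mem : ∀ x : L', ∃ (E : IntermediateField K L), FiniteDimensional K E ∧ IsGalois K E ∧
    x ∈ genField K' L' E

namespace IsUnrTower

variable {K L K' L' : Type*} [NontriviallyNormedField K] [IsUltrametricDist K]
    [CompleteSpace K] [Field L] [Algebra K L] [IsGalois K L]
    [NontriviallyNormedField K'] [IsUltrametricDist K'] [CompleteSpace K'] [Field L'] [Algebra K' L']
    [IsGalois K' L'] [Algebra K K'] [Algebra L L'] [Algebra K L'] [IsScalarTower K L L']
    [IsScalarTower K K' L'] (h : IsUnrTower K L K' L')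

include h

/-- The inverse limit of the inertia groups of the finite layers is the inertia group of `L / K`,
which acts trivially on the residue field. -/
lemma upperRam_zero : upperRam K L 0 = lowerRam K L 0 := by
  ext σ
  rw [mem_lowerRam_zero_iff_restrict, upperRam]
  simp only [Subgroup.mem_iInf, Subgroup.mem_comap]
  refine forall_congr' fun E => forall_congr' fun h1 => forall_congr' fun h2 => ?_
  obtain ⟨π, hπ, hπ'⟩ := h.unif E
  rw [(h.layer E).finUpperRam_zero hπ hπ']

lemma range_eq : (baseChangeRes K L K' L').range = upperRam K L 0 :=
  h.base.range_eq.trans h.upperRam_zero.symm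

/-- The automorphism group of `L' / K'` has the upper ramification groups of `L / K`. -/
lemma upperRam_eq {v : ℝ} (hv : -1 ≤ v) :
    upperRam K' L' v = (upperRam K L v).comap (baseChangeRes K L K' L') := by
  ext σ
  rw [Subgroup.mem_comap, upperRam, upperRam]
  simp only [Subgroup.mem_iInf, Subgroup.mem_comap]
  constructor
  · intro hσ E _ _
    obtain ⟨π, hπ, hπ'⟩ := h.unif E
    have := hσ (genField K' L' E) inferInstance inferInstance
    rw [(h.layer E).finUpperRam_eq hπ hπ', Subgroup.mem_comap] at this
    rwa [restrict_baseChangeRes]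
  · intro hσ N _ _
    -- a finite layer `N` of `L' / K'` need not come from `L`, but it is contained in one which does
    obtain ⟨α, hα⟩ := Field.exists_primitive_element K' N
    obtain ⟨E, _, _, hE⟩ := h.exists_mem α
    obtain ⟨π, hπ, hπ'⟩ := h.unif E
    have hN : N ≤ genField K' L' E := by
      have h1 := congrArg IntermediateField.lift hα
      rw [IntermediateField.lift_top, IntermediateField.lift_adjoin] at h1
      rw [← h1, IntermediateField.adjoin_le_iff]
      rintro _ ⟨_, rfl, rfl⟩
      exact hE
    have h1 := hσ E inferInstance inferInstance
    rw [restrict_baseChangeRes, ← Subgroup.mem_comap, ← (h.layer E).finUpperRam_eq hπ hπ'] at h1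
    let : Algebra N (genField K' L' E) := (IntermediateField.inclusion hN).toRingHom.toAlgebra
    have : IsScalarTower K' N (genField K' L' E) := .of_algebraMap_eq fun _ => rfl
    obtain ⟨ϖ, hϖ⟩ := h.unif'
    obtain ⟨π₁, hπ₁⟩ := exists_isUnif (F := N) hϖ
    have h2 := (h.layer E).res.restrict_mem_finUpperRam hπ' hπ₁ hv h1
    convert h2 using 1
    ext x
    have e1 : ((AlgEquiv.restrictNormalHom N σ x : N) : L') = σ x :=
      AlgEquiv.restrictNormal_commutes σ N x
    have e2 : algebraMap N (genField K' L' E) (AlgEquiv.restrictNormalHom N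
        (AlgEquiv.restrictNormalHom (genField K' L' E) σ) x) =
      AlgEquiv.restrictNormalHom (genField K' L' E) σ (algebraMap N (genField K' L' E) x) :=
      AlgEquiv.restrictNormal_commutes _ N x
    have e3 : ((AlgEquiv.restrictNormalHom (genField K' L' E) σ
        (algebraMap N (genField K' L' E) x) : genField K' L' E) : L') = σ x :=
      AlgEquiv.restrictNormal_commutes σ (genField K' L' E) _
    rw [e1, ← e3, ← e2]
    rfl

/-- The inertia group of `L / K` is isomorphic to the Galois group of `L' / K'`, together with the
upper ramification groups. -/
theorem exists_equiv : ∃ φ : upperRam K L 0 ≃ₜ* Gal(L'/K'), ∀ v : ℝ, -1 ≤ v →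
    upperRam K' L' v =
      ((upperRam K L v).subgroupOf (upperRam K L 0)).map φ.toMulEquiv.toMonoidHom := by
  let ρ := baseChangeRes K L K' L'
  have hρ : ∀ σ, ρ σ ∈ upperRam K L 0 := fun σ => h.range_eq ▸ ⟨σ, rfl⟩
  let e : Gal(L'/K') ≃* upperRam K L 0 := MulEquiv.ofBijective (ρ.codRestrict _ hρ) (by
    constructor
    · intro σ τ hστ
      exact baseChangeRes_injective h.base.adjoin (congrArg Subtype.val hστ)
    · rintro ⟨τ, hτ⟩
      rw [← h.range_eq] at hτ
      obtain ⟨σ, hσ⟩ := hτ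
      exact ⟨σ, Subtype.ext hσ⟩)
  have he : Continuous e := (baseChangeRes_continuous (K := K) (E := L)).subtype_mk hρ
  let e' : Gal(L'/K') ≃ₜ* upperRam K L 0 :=
    { e with
      continuous_toFun := he
      continuous_invFun := (he.homeoOfEquivCompactToT2 (f := e.toEquiv)).continuous_invFun }
  refine ⟨e'.symm, fun v hv => ?_⟩
  have hφ : ∀ τ, ρ (e'.symm τ) = τ := fun τ => congrArg Subtype.val (e'.apply_symm_apply τ)
  rw [h.upperRam_eq hv]
  ext σ
  obtain ⟨τ, rfl⟩ := e'.symm.surjective σ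
  rw [Subgroup.mem_comap, hφ]
  constructor
  · exact fun hτ => ⟨τ, hτ, rfl⟩
  · rintro ⟨τ', hτ', h1⟩
    rwa [← e'.symm.injective h1]

/-- An automorphism which acts on the finite layer `E` as an inertia element agrees on `E` with an
element of the inertia group of `L / K`. -/
lemma exists_restrict_eq (E : IntermediateField K L) [FiniteDimensional K E] [IsGalois K E]
    {σ : Gal(L/K)} (hσ : AlgEquiv.restrictNormalHom E σ ∈ lowerRam K E 0) :
    ∃ τ ∈ upperRam K L 0, AlgEquiv.restrictNormalHom E τ = AlgEquiv.restrictNormalHom E σ := by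
  rw [← (h.layer E).range_eq] at hσ
  obtain ⟨s, hs⟩ := hσ
  obtain ⟨t, rfl⟩ := AlgEquiv.restrictNormalHom_surjective (F := K') (K₁ := genField K' L' E) L' s
  refine ⟨baseChangeRes K L K' L' t, h.range_eq ▸ ⟨t, rfl⟩, ?_⟩
  rw [restrict_baseChangeRes, hs]

end IsUnrTower

end InfiniteBaseChange

/-! ### The extensions `F' / K'` for finite `F / K` -/

lemma isGalois_of_normal (k F : Type*) [Field k] [CharZero k] [Field F] [Algebra k F] [Normal k F] :
    IsGalois k F where

lemma isAlgebraic_of_isGalois (k F : Type*) [Field k] [Field F] [Algebra k F] [IsGalois k F] :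
    Algebra.IsAlgebraic k F := inferInstance

section ConcretePairs

variable {K : Type*} [NontriviallyNormedField K] [IsUltrametricDist K] [CompleteSpace K]
  {Ω : Type*} [NormedField Ω] [NormedAlgebra K Ω] [IsAlgClosure K Ω] [CharZero K]

section Finite

instance isScalarTower_extHat (F : IntermediateField K Ω) : IsScalarTower K F (extHat F) :=
  .of_algebraMap_eq fun _ => rfl

instance isScalarTower_extHat' (F : IntermediateField K Ω) :
    IsScalarTower K (unrHat K Ω) (extHat F) :=
  .of_algebraMap_eq fun _ => rfl

variable (F : IntermediateField K Ω) [FiniteDimensional K F]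

omit [CompleteSpace K] [IsAlgClosure K Ω] [CharZero K] in
lemma finiteDimensional_extHat : FiniteDimensional (unrHat K Ω) (extHat F) :=
  finiteDimensional_of_adjoin_range K F (adjoin_range_extHat F)

variable [IsGalois K F]

omit [CompleteSpace K] [IsAlgClosure K Ω] in
lemma isGalois_extHat : IsGalois (unrHat K Ω) (extHat F) :=
  have := normal_of_adjoin_range K F (adjoin_range_extHat F)
  isGalois_of_normal _ _

lemma isUnrBaseChange_extHat [LocallyCompactSpace K]
    [Algebra.IsAlgebraic (unrHat K Ω) (extHat F)] :
    IsUnrBaseChange K F (unrHat K Ω) (extHat F) :=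
  isUnrBaseChange_of_embedding F.val (extHat F).val (fun _ => rfl) (adjoin_range_extHat F)

lemma isUnif_extHat [Algebra.IsAlgebraic (unrHat K Ω) (extHat F)] {π : F}
    (hπ : IsUnif (extAbs K F) π) :
    IsUnif (extAbs (unrHat K Ω) (extHat F)) (algebraMap F (extHat F) π) :=
  isUnif_of_embedding F.val (extHat F).val (fun _ => rfl)
    (fun x => by rw [IntermediateField.fieldRange_val]; exact x.2) hπ

end Finite

variable (K Ω) in
/-- `K` and `K'` have a common uniformizer. -/
lemma exists_isUnif_unrHat [LocallyCompactSpace K] :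
    ∃ ϖ : K, IsUnif (extAbs K K) ϖ ∧
      IsUnif (extAbs (unrHat K Ω) (unrHat K Ω)) (algebraMap K (unrHat K Ω) ϖ) := by
  obtain ⟨ϖ, hϖ⟩ := exists_isUnif_base K
  exact ⟨ϖ, hϖ, isUnif_of_embedding (Algebra.ofId K Ω) (Algebra.ofId (unrHat K Ω) (Completion Ω))
    (fun _ => rfl) (fun x => unrHat_le _ x.2) hϖ⟩

/-! ### The extension `L' / K'` -/

section Infinite

variable {L : IntermediateField K Ω} [IsGalois K L] {Γ : ℕ → Subgroup Gal(L/K)} {p : ℕ}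
  (hP : IsPowFiltration p Γ)

omit [CompleteSpace K] [IsAlgClosure K Ω] [CharZero K] in
include hP in
lemma coe_mem_towerHat (x : L) : ((x : Ω) : Completion Ω) ∈ towerHat (tower Γ) := by
  obtain ⟨i, hi⟩ := hP.exists_mem_tower x.2
  exact le_iSup (fun j => extHat (tower Γ j)) i (coe_mem_extHat hi)

/-- The inclusion of `L` into `L'`. -/
@[reducible] def algebraTowerHat : Algebra L (towerHat (tower Γ)) :=
  (((algebraMap Ω (Completion Ω)).comp (algebraMap L Ω)).codRestrict (towerHat (tower Γ))
    fun x => coe_mem_towerHat hP x).toAlgebra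

variable [Algebra L (towerHat (tower Γ))]
  (hcoe : ∀ x : L, (algebraMap L (towerHat (tower Γ)) x : Completion Ω) = ((x : Ω) : Completion Ω))

omit [CompleteSpace K] [IsAlgClosure K Ω] [CharZero K] [IsGalois K L] in
include hcoe in
lemma isScalarTower_towerHat : IsScalarTower K L (towerHat (tower Γ)) :=
  .of_algebraMap_eq fun x => Subtype.ext (hcoe (algebraMap K L x)).symm

omit [CompleteSpace K] [IsAlgClosure K Ω] [CharZero K] [IsGalois K L] in
include hcoe in
/-- The completed layers are generated by the layers of `L / K`. -/
lemma lift_genField (E : IntermediateField K L) [FiniteDimensional K (IntermediateField.lift E)] :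
    IntermediateField.lift (genField (unrHat K Ω) (towerHat (tower Γ)) E) =
      extHat (IntermediateField.lift E) := by
  rw [genField, IntermediateField.lift_adjoin, extHat_eq_adjoin]
  congr 1
  ext x
  constructor
  · rintro ⟨_, ⟨x, hx, rfl⟩, rfl⟩
    exact ⟨x, (IntermediateField.mem_lift x).2 hx, (hcoe x).symm⟩
  · rintro ⟨_, ⟨x, hx, rfl⟩, rfl⟩
    exact ⟨_, ⟨x, hx, rfl⟩, hcoe x⟩

omit [CompleteSpace K] [IsAlgClosure K Ω] [CharZero K] in
include hcoe hP in
/-- The field `K(i)'` is generated over `K'` by `K(i)`. -/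
lemma genField_eq_stepHat (i : ℕ) :
    genField (unrHat K Ω) (towerHat (tower Γ)) (IntermediateField.fixedField (Γ i)) =
      stepHat (tower Γ) i := by
  have := hP.finiteDimensional_tower i
  apply IntermediateField.lift_injective
  have : FiniteDimensional K (IntermediateField.lift (IntermediateField.fixedField (Γ i))) := this
  exact (lift_genField hcoe _).trans (IntermediateField.lift_restrict _).symm

omit [CompleteSpace K] [IsAlgClosure K Ω] [CharZero K] in
include hcoe hP in
lemma adjoin_range_towerHat : IntermediateField.adjoin (unrHat K Ω)
    (Set.range (algebraMap L (towerHat (tower Γ)))) = ⊤ := by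
  refine adjoin_eq_top_of_image (iSup_le fun i => ?_)
  have := hP.finiteDimensional_tower i
  rw [extHat_eq_adjoin]
  refine IntermediateField.adjoin.mono _ _ _ ?_
  rintro _ ⟨x, hx, rfl⟩
  have hxL : x ∈ L := IntermediateField.lift_le _ hx
  exact ⟨_, ⟨⟨x, hxL⟩, rfl⟩, hcoe ⟨x, hxL⟩⟩

omit [CompleteSpace K] [IsAlgClosure K Ω] in
include hP hcoe in
lemma isGalois_towerHat : IsGalois (unrHat K Ω) (towerHat (tower Γ)) :=
  have := isScalarTower_towerHat hcoe
  have := normal_of_adjoin_range K L (adjoin_range_towerHat hP hcoe)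
  isGalois_of_normal _ _

include hP hcoe in
/-- The ramification groups of `L' / K'` can be compared with those of `L / K`. -/
lemma isUnrTower_towerHat [LocallyCompactSpace K] [IsScalarTower K L (towerHat (tower Γ))]
    [IsGalois (unrHat K Ω) (towerHat (tower Γ))] :
    IsUnrTower K L (unrHat K Ω) (towerHat (tower Γ)) where
  base := isUnrBaseChange_of_embedding L.val (towerHat (tower Γ)).val hcoe
    (adjoin_range_towerHat hP hcoe)
  layer E _ _ := isUnrBaseChange_of_embedding (L.val.comp E.val)
    ((towerHat (tower Γ)).val.comp (genField _ _ E).val) (fun x => hcoe x) (adjoin_range_genField E)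
  unif E _ _ := by
    obtain ⟨ϖ, hϖ, -⟩ := exists_isUnif_unrHat K Ω
    obtain ⟨π, hπ⟩ := exists_isUnif (F := E) hϖ
    refine ⟨π, hπ, isUnif_of_embedding (L.val.comp E.val)
      ((towerHat (tower Γ)).val.comp (genField _ _ E).val) (fun x => hcoe x) (fun x => ?_) hπ⟩
    have h1 : genField (unrHat K Ω) (towerHat (tower Γ)) E ≤
        (extHat (L.val.comp E.val).fieldRange).comap (towerHat (tower Γ)).val := by
      rw [genField, IntermediateField.adjoin_le_iff]
      rintro _ ⟨y, hy, rfl⟩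
      change (algebraMap L (towerHat (tower Γ)) y : Completion Ω) ∈ extHat (L.val.comp E.val).fieldRange
      rw [hcoe]
      exact coe_mem_extHat ⟨⟨y, hy⟩, rfl⟩
    exact h1 x.2
  unif' := by
    obtain ⟨ϖ, -, hϖ⟩ := exists_isUnif_unrHat K Ω
    exact ⟨_, hϖ⟩
  exists_mem x := by
    obtain ⟨i, hi⟩ := (mem_towerHat_iff (tower_mono hP.antitone)).1 x.2
    refine ⟨IntermediateField.fixedField (Γ i), finiteDimensional_fixedField (hP.isOpen i),
      isGalois_fixedField (hP.isOpen i) (hP.normal i), ?_⟩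
    rw [genField_eq_stepHat hP hcoe]
    exact (IntermediateField.mem_restrict _ x).2 hi

end Infinite

end ConcretePairs

/-! ### The filtration of the Galois group of `L' / K'` -/

section Filtration

/-- The Galois group of `L' / E'`, for `E'` generated by `E`, consists of the automorphisms which
restrict to the identity on `E`. -/
lemma fixingSubgroup_genField {K L K' L' : Type*} [Field K] [Field L] [Field K'] [Field L']
    [Algebra K L] [Algebra K' L'] [Algebra K K'] [Algebra L L'] [Algebra K L'] [IsScalarTower K L L']
    [IsScalarTower K K' L'] [Normal K L] (E : IntermediateField K L) :
    (genField K' L' E).fixingSubgroup = E.fixingSubgroup.comap (baseChangeRes K L K' L') := by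
  ext σ
  rw [Subgroup.mem_comap, IntermediateField.mem_fixingSubgroup_iff,
    IntermediateField.mem_fixingSubgroup_iff]
  constructor
  · intro h x hx
    apply (algebraMap L L').injective
    rw [algebraMap_baseChangeRes]
    exact h _ (algebraMap_mem_genField hx)
  · intro h
    have h1 : genField K' L' E ≤ IntermediateField.fixedField (Subgroup.zpowers σ) := by
      rw [genField, IntermediateField.adjoin_le_iff]
      rintro _ ⟨x, hx, rfl⟩ ⟨τ, hτ⟩
      have : Subgroup.zpowers σ ≤ MulAction.stabilizer Gal(L'/K') (algebraMap L L' x) := by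
        rw [Subgroup.zpowers_le]
        change σ (algebraMap L L' x) = _
        rw [← algebraMap_baseChangeRes (K := K), h x hx]
      exact this hτ
    exact fun x hx => h1 hx ⟨σ, Subgroup.mem_zpowers σ⟩

variable {K L K' L' : Type*} [NontriviallyNormedField K] [IsUltrametricDist K]
    [CompleteSpace K] [LocallyCompactSpace K] [Field L] [Algebra K L] [IsGalois K L]
    [NontriviallyNormedField K'] [IsUltrametricDist K'] [CompleteSpace K'] [Field L'] [Algebra K' L']
    [IsGalois K' L'] [Algebra K K'] [Algebra L L'] [Algebra K L'] [IsScalarTower K L L']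
    [IsScalarTower K K' L'] (h : IsUnrTower K L K' L')
include h

/-- The quotient by the inertia group is abelian, as this is so for all finite layers. -/
lemma IsUnrTower.commutator_mem (σ τ : Gal(L/K)) : σ * τ * σ⁻¹ * τ⁻¹ ∈ upperRam K L 0 := by
  rw [h.upperRam_zero, mem_lowerRam_zero_iff_restrict]
  intro E _ _
  simp only [map_mul, map_inv]
  exact commutator_mem_lowerRam _ _

omit [LocallyCompactSpace K] in
lemma IsUnrTower.isClosed_upperRam_zero : IsClosed (upperRam K L 0 : Set Gal(L/K)) := by
  rw [← h.range_eq, MonoidHom.coe_range]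
  exact (isCompact_range baseChangeRes_continuous).isClosed

omit [LocallyCompactSpace K] in
/-- An automorphism acting as an inertia element on the fixed field of `N` is the product of an
inertia element and an element of `N`. -/
lemma IsUnrTower.mem_sup {N : Subgroup Gal(L/K)} (hN : IsOpen (N : Set Gal(L/K))) (hn : N.Normal)
    [FiniteDimensional K (IntermediateField.fixedField N)]
    [IsGalois K (IntermediateField.fixedField N)] {σ : Gal(L/K)} :
    σ ∈ upperRam K L 0 ⊔ N ↔ AlgEquiv.restrictNormalHom (IntermediateField.fixedField N) σ ∈
      lowerRam K (IntermediateField.fixedField N) 0 := by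
  have hker : (AlgEquiv.restrictNormalHom (F := K) (K₁ := L) (IntermediateField.fixedField N)).ker =
      N := by
    rw [IntermediateField.restrictNormalHom_ker]
    exact InfiniteGalois.fixingSubgroup_fixedField ⟨N, N.isClosed_of_isOpen hN⟩
  constructor
  · intro hσ
    obtain ⟨c, hc, x, hx, rfl⟩ := Subgroup.mem_sup_of_normal_right.1 hσ
    rw [map_mul, show AlgEquiv.restrictNormalHom (IntermediateField.fixedField N) x = 1 from
      MonoidHom.mem_ker.1 (hker.ge hx), mul_one]
    rw [h.upperRam_zero, mem_lowerRam_zero_iff_restrict] at hc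
    exact hc _ inferInstance inferInstance
  · intro hσ
    obtain ⟨τ, hτ, hτσ⟩ := h.exists_restrict_eq _ hσ
    rw [← mul_inv_cancel_left τ σ]
    refine Subgroup.mul_mem_sup hτ ?_
    rw [← hker, MonoidHom.mem_ker, map_mul, map_inv, hτσ, inv_mul_cancel]

variable {Γ : ℕ → Subgroup Gal(L/K)} {p : ℕ} [Fact p.Prime] (hP : IsPowFiltration p Γ)
include hP

/-- The Galois group of `L' / K'` carries the filtration induced by a Lie filtration of the Galois
group of `L / K`, up to an index shift. -/
lemma IsUnrTower.exists_isPowFiltration : ∃ k,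
    IsPowFiltration p (fun i => (Γ (k + i)).comap (baseChangeRes K L K' L')) ∧
      ((∀ i, k ≤ i → (upperRam K L 0 ⊔ Γ i).index = (upperRam K L 0 ⊔ Γ k).index) ∨
        ∀ i, k ≤ i → (upperRam K L 0 ⊔ Γ i).index = (upperRam K L 0 ⊔ Γ k).index * p ^ (i - k)) := by
  obtain ⟨k, h1, h2⟩ := hP.exists_surj_of_procyclic h.isClosed_upperRam_zero h.commutator_mem (by
    have := finiteDimensional_fixedField (hP.isOpen 1)
    have := isGalois_fixedField (hP.isOpen 1) (hP.normal 1)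
    obtain ⟨_, ⟨g, hg, rfl⟩, hgen⟩ := exists_zpow_mem_lowerRam
      ((Γ 0).map (AlgEquiv.restrictNormalHom (IntermediateField.fixedField (Γ 1))))
    refine ⟨g, hg, fun x hx => ?_⟩
    obtain ⟨n, hn⟩ := hgen _ ⟨x, hx, rfl⟩
    refine ⟨n, (h.mem_sup (hP.isOpen 1) (hP.normal 1)).2 ?_⟩
    rwa [map_mul, map_inv, map_zpow])
  refine ⟨k, hP.comap _ baseChangeRes_continuous (baseChangeRes_injective h.base.adjoin) k ?_, h2⟩
  intro i hi y hy hyP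
  rw [h.range_eq] at hy ⊢
  exact h1 i hi y hy hyP

end Filtration

/-! ### The exponent of the different -/

section Different

variable {k F : Type*} [NontriviallyNormedField k] [IsUltrametricDist k] [CompleteSpace k]
  [Field F] [Algebra k F]

variable (k) in
/-- `y` lies in the codifferent of `F / k`. -/
def MemCodiff [Algebra.IsAlgebraic k F] (y : F) : Prop :=
  ∀ z, extAbs k F z ≤ 1 → ‖Algebra.trace k F (y * z)‖ ≤ 1

/-- The codifferent is a fractional ideal. -/
lemma MemCodiff.mono [Algebra.IsAlgebraic k F] {x y : F} (hy : MemCodiff k y)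
    (hxy : extAbs k F x ≤ extAbs k F y) : MemCodiff k x := by
  intro z hz
  by_cases hy0 : y = 0
  · rw [hy0, map_zero] at hxy
    have : x = 0 := (extAbs k F).eq_zero.1 (le_antisymm hxy ((extAbs k F).nonneg _))
    simp [this]
  · have h1 : x * z = y * (x / y * z) := by field_simp
    rw [h1]
    refine hy _ ?_
    rw [map_mul, map_div₀]
    exact mul_le_one₀ (div_le_one_of_le₀ hxy ((extAbs k F).nonneg _)) ((extAbs k F).nonneg _) hz

variable [FiniteDimensional k F] [IsGalois k F] {π : F}

/-- The codifferent is the fractional ideal generated by some `π ^ (-d)` with `d ≥ 0`. -/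
lemma exists_memCodiff_iff (hπ : IsUnif (extAbs k F) π) :
    ∃ d : ℕ, ∀ y : F, MemCodiff k y ↔ extAbs k F y * extAbs k F π ^ d ≤ 1 := by
  classical
  have hnorm : ∀ x : F, ‖Algebra.trace k F x‖ ≤ extAbs k F x := fun x => by
    rw [← extAbs_algebraMap (F := F), trace_eq_sum_automorphisms]
    exact nonarch_sum_le (isNonarchimedean_extAbs k F) _ _ ((extAbs k F).nonneg _) fun σ _ =>
      (extAbs_algEquiv σ x).le
  -- the trace form is unbounded, since it is surjective
  have hex : ∃ m : ℕ, ¬ MemCodiff k (π ^ m)⁻¹ := by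
    by_contra! hc
    obtain ⟨c, hc1⟩ := NormedField.exists_one_lt_norm k
    obtain ⟨x, hx⟩ := Algebra.trace_surjective k F c
    have hx0 : 0 < extAbs k F x := lt_of_lt_of_le (by rw [hx]; linarith) (hnorm x)
    obtain ⟨m, hm⟩ := exists_pow_lt_of_lt_one (inv_pos.2 hx0) hπ.lt_one
    have h1 := ((hc m).mono (x := x) (by
      rw [map_inv₀, map_pow, le_inv_comm₀ hx0 (pow_pos hπ.pos m)]
      exact hm.le)) 1 (by simp)
    rw [mul_one, hx] at h1
    exact absurd hc1 (not_lt.2 h1)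
  have h0 : Nat.find hex ≠ 0 := by
    intro h
    have := Nat.find_spec hex
    rw [h] at this
    refine this fun z hz => ?_
    rw [pow_zero, inv_one, one_mul]
    exact (hnorm z).trans hz
  obtain ⟨d, hd⟩ := Nat.exists_eq_succ_of_ne_zero h0
  refine ⟨d, fun y => ?_⟩
  have hpos : ∀ m : ℕ, 0 < extAbs k F π ^ m := fun m => pow_pos hπ.pos m
  constructor
  · intro hy
    by_contra! hlt
    refine Nat.find_spec hex (hy.mono ?_)
    have hy0 : y ≠ 0 := by rintro rfl; rw [map_zero, zero_mul] at hlt; linarith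
    have h2 : extAbs k F (y * π ^ d)⁻¹ ≤ extAbs k F π := by
      refine hπ.le _ ?_
      rw [map_inv₀, map_mul, map_pow]
      exact inv_lt_one_of_one_lt₀ hlt
    rw [hd, map_inv₀, map_pow, inv_le_comm₀ (hpos _) ((extAbs k F).pos hy0), pow_succ']
    rw [map_inv₀, map_mul, map_pow, mul_inv, ← div_eq_mul_inv, div_le_iff₀ (hpos d)] at h2
    exact h2
  · intro hy
    have h2 : MemCodiff k (π ^ d)⁻¹ := not_not.1 (Nat.find_min hex (by omega))
    refine h2.mono ?_
    rw [map_inv₀, map_pow, ← one_div, le_div_iff₀ (hpos d)]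
    exact hy

omit [FiniteDimensional k F] in
lemma mem_different_iff (hπ : IsUnif (extAbs k F) π) {d : ℕ}
    (hd : ∀ y : F, MemCodiff k y ↔ extAbs k F y * extAbs k F π ^ d ≤ 1) (x : extInt k F) :
    x ∈ different k F ↔ extAbs k F x ≤ extAbs k F π ^ d := by
  have hC : ∀ y : F, (∀ z : extInt k F, Algebra.trace k F (y * z) ∈ baseInt k) ↔ MemCodiff k y := by
    intro y
    simp only [baseInt_iff]
    exact ⟨fun h z hz => h ⟨z, (mem_extInt_iff z).2 hz⟩, fun h z => h z ((mem_extInt_iff _).1 z.2)⟩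
  have h0 : x ∈ different k F ↔ ∀ y : F, (∀ z : extInt k F, Algebra.trace k F (y * z) ∈ baseInt k) →
    (x : F) * y ∈ extInt k F := Iff.rfl
  rw [h0]
  simp only [hC, hd, mem_extInt_iff]
  have hpos : 0 < extAbs k F π ^ d := pow_pos hπ.pos d
  constructor
  · intro h
    have h1 := h (π ^ d)⁻¹ (by rw [map_inv₀, map_pow, inv_mul_cancel₀ hpos.ne'])
    rwa [map_mul, map_inv₀, map_pow, ← div_eq_mul_inv, div_le_one hpos] at h1
  · intro h y hy
    rw [map_mul, mul_comm]
    exact (mul_le_mul_of_nonneg_left h ((extAbs k F).nonneg _)).trans hy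

omit [FiniteDimensional k F] in
lemma idealVal_different (hπ : IsUnif (extAbs k F) π) {d : ℕ}
    (hd : ∀ y : F, MemCodiff k y ↔ extAbs k F y * extAbs k F π ^ d ≤ 1) :
    idealVal (different k F) = d :=
  idealVal_eq_of_mem_iff (extInt_inj k F) (isNonarchimedean_extAbs k F) (extInt_range k F) hπ
    (mem_different_iff hπ hd)

/-- The discriminant exponent is the residue degree times the exponent of the different. -/
lemma idealVal_discriminant (hπ : IsUnif (extAbs k F) π) {d : ℕ}
    (hd : ∀ y : F, MemCodiff k y ↔ extAbs k F y * extAbs k F π ^ d ≤ 1) {ϖ : k}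
    (hϖ : IsUnif (extAbs k k) ϖ) {f : ℕ} (hf : extAbs k F π ^ Module.finrank k F = ‖ϖ‖ ^ f) :
    idealVal (discriminant k F) = (f * d : ℕ) := by
  have hself : ∀ x : k, extAbs k k x = ‖x‖ := fun x => extAbs_algebraMap (F := k) x
  have hnorm : ∀ x : F, ‖Algebra.norm k x‖ = extAbs k F x ^ Module.finrank k F := fun x => by
    rw [← extAbs_algebraMap (F := F), Algebra.norm_eq_prod_automorphisms, map_prod]
    simp [extAbs_algEquiv, ← IsGalois.card_aut_eq_finrank k F, Nat.card_eq_fintype_card]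
  have hr : ∀ x : k, extAbs k k x ≤ 1 ↔ ∃ r, (algebraMap (baseInt k) k) r = x := fun x => by
    rw [hself, ← baseInt_iff]
    exact ⟨fun h => ⟨⟨x, h⟩, rfl⟩, fun ⟨r, hr⟩ => hr ▸ r.2⟩
  refine idealVal_eq_of_mem_iff Subtype.val_injective (isNonarchimedean_extAbs k k) hr hϖ fun r => ?_
  have hbound : ‖ϖ‖ ^ (f * d) = (extAbs k F π ^ d) ^ Module.finrank k F := by
    rw [pow_mul, ← hf, ← pow_mul, ← pow_mul, mul_comm]
  rw [hself, hself]
  change _ ↔ ‖(r : k)‖ ≤ _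
  constructor
  · intro hmem
    refine Submodule.span_induction (p := fun (a : baseInt k) _ => ‖(a : k)‖ ≤ ‖ϖ‖ ^ (f * d))
      ?_ ?_ ?_ ?_ hmem
    · rintro a ⟨x, hx, ha⟩
      rw [ha, hnorm, hbound]
      exact pow_le_pow_left₀ ((extAbs k F).nonneg _) ((mem_different_iff hπ hd x).1 hx) _
    · change ‖(0 : k)‖ ≤ _
      rw [norm_zero]; positivity
    · intro a b _ _ ha hb
      exact (IsUltrametricDist.norm_add_le_max (a : k) b).trans (max_le ha hb)
    · intro a b _ hb
      change ‖(a : k) * b‖ ≤ _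
      rw [norm_mul]
      exact (mul_le_of_le_one_left (norm_nonneg _) ((baseInt_iff _).1 a.2)).trans hb
  · intro h
    have hπd : extAbs k F (π ^ d) ≤ 1 := by
      rw [map_pow]; exact pow_le_one₀ hπ.pos.le hπ.lt_one.le
    set N := Algebra.norm k (π ^ d)
    have hN : ‖N‖ = ‖ϖ‖ ^ (f * d) := by rw [hnorm, hbound, map_pow]
    have hN0 : 0 < ‖N‖ := by rw [hnorm, map_pow]; exact pow_pos (pow_pos hπ.pos _) _
    have hNi : N ∈ baseInt k := by
      rw [baseInt_iff, hnorm]; exact pow_le_one₀ ((extAbs k F).nonneg _) hπd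
    have hq : (r : k) / N ∈ baseInt k := by
      rw [baseInt_iff, norm_div, div_le_one hN0, hN]; exact h
    have e : r = (⟨_, hq⟩ : baseInt k) * ⟨N, hNi⟩ :=
      Subtype.ext (div_mul_cancel₀ (r : k) (norm_pos_iff.1 hN0)).symm
    rw [e]
    refine Ideal.mul_mem_left _ _ (Ideal.subset_span ⟨⟨π ^ d, (mem_extInt_iff _).2 hπd⟩, ?_, rfl⟩)
    rw [mem_different_iff hπ hd, map_pow]

end Different

/-! ### The trace and the inertia group -/

section Trace

/-- Taking powers improves congruences. -/
lemma abs_pow_sub_pow_le {M : Type*} [Field M] {v : AbsoluteValue M ℝ} (hv : IsNonarchimedean v)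
    {q : ℕ} {a b : M} (ha : v a ≤ 1) (hb : v b ≤ 1) {θ δ : ℝ} (hq : v (q : M) ≤ θ)
    (hδ : v (a - b) ≤ δ) (hδθ : δ ≤ θ) : v (a ^ q - b ^ q) ≤ δ * θ := by
  have h0 : 0 ≤ θ := (v.nonneg _).trans hq
  have hpow : ∀ i, v (a ^ i - b ^ i) ≤ v (a - b) := by
    intro i
    rw [← Commute.geom_sum₂_mul (Commute.all a b) i, map_mul]
    refine mul_le_of_le_one_left (v.nonneg _) (nonarch_sum_le hv _ _ zero_le_one fun j _ => ?_)
    rw [map_mul, map_pow, map_pow]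
    exact mul_le_one₀ (pow_le_one₀ (v.nonneg _) ha) (pow_nonneg (v.nonneg _) _)
      (pow_le_one₀ (v.nonneg _) hb)
  have h2 : (∑ i ∈ Finset.range q, a ^ i * b ^ (q - 1 - i)) =
      (∑ i ∈ Finset.range q, (a ^ i - b ^ i) * b ^ (q - 1 - i)) + q * b ^ (q - 1) := by
    have : (q : M) * b ^ (q - 1) = ∑ i ∈ Finset.range q, b ^ i * b ^ (q - 1 - i) := by
      rw [Finset.sum_congr rfl fun i hi => ?_, Finset.sum_const, Finset.card_range, nsmul_eq_mul]
      rw [← pow_add]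
      congr 1
      have := Finset.mem_range.1 hi
      omega
    rw [this, ← Finset.sum_add_distrib]
    exact Finset.sum_congr rfl fun i _ => by ring
  rw [← Commute.geom_sum₂_mul (Commute.all a b) q, map_mul, mul_comm]
  refine mul_le_mul hδ ?_ (v.nonneg _) ((v.nonneg _).trans hδ)
  rw [h2]
  refine (hv _ _).trans (max_le (nonarch_sum_le hv _ _ h0 fun i _ => ?_) ?_)
  · rw [map_mul, map_pow]
    exact (mul_le_of_le_one_right (v.nonneg _) (pow_le_one₀ (v.nonneg _) hb)).trans
      ((hpow i).trans (hδ.trans hδθ))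
  · rw [map_mul, map_pow]
    exact (mul_le_of_le_one_right (v.nonneg _) (pow_le_one₀ (v.nonneg _) hb)).trans hq

variable {k F : Type*} [NontriviallyNormedField k] [IsUltrametricDist k] [CompleteSpace k]
  [LocallyCompactSpace k] [Field F] [Algebra k F] [FiniteDimensional k F]

/-- For a suitable exponent `N`, the multiplicative map `c ↦ c ^ N` on integers is the identity on
residues, and `c ^ N` is almost fixed by inertia. -/
lemma exists_pow_almost_fixed {π : F} (hπ : IsUnif (extAbs k F) π) {ε : ℝ} (hε : 0 < ε) :
    ∃ N : ℕ, ∀ c, extAbs k F c ≤ 1 → extAbs k F (c ^ N - c) < 1 ∧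
      ∀ σ ∈ lowerRam k F 0, extAbs k F (σ (c ^ N) - c ^ N) ≤ ε := by
  have hv := isNonarchimedean_extAbs k F
  obtain ⟨q, -, hq, hqx⟩ := exists_pow_sub_lt (k := k) (F := F)
  set θ := max (extAbs k F π) ‖(q : k)‖
  have hθ1 : θ < 1 := max_lt hπ.lt_one hq
  have hθ0 : 0 ≤ θ := hπ.pos.le.trans (le_max_left _ _)
  have hqθ : extAbs k F (q : F) ≤ θ := by
    rw [← map_natCast (algebraMap k F), extAbs_algebraMap]; exact le_max_right _ _
  obtain ⟨n, hn⟩ := exists_pow_lt_of_lt_one hε hθ1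
  have hpow1 : ∀ (c : F) (m : ℕ), extAbs k F c ≤ 1 → extAbs k F (c ^ m) ≤ 1 := fun c m hc => by
    rw [map_pow]; exact pow_le_one₀ ((extAbs k F).nonneg _) hc
  refine ⟨q ^ n, fun c hc => ⟨?_, fun σ hσ => ?_⟩⟩
  · clear hn
    induction n with
    | zero => simp
    | succ n ih =>
      rw [pow_succ, pow_mul, ← sub_add_sub_cancel _ (c ^ q ^ n) c]
      exact (hv _ _).trans_lt (max_lt (hqx _ (hpow1 c _ hc)) ih)
  · have key : ∀ m, extAbs k F (σ (c ^ q ^ m) - c ^ q ^ m) ≤ θ ^ (m + 1) := by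
      intro m
      induction m with
      | zero =>
        rw [pow_zero, pow_one, zero_add, pow_one]
        exact (hπ.le _ ((mem_lowerRam_zero_iff σ).1 hσ c hc)).trans (le_max_left _ _)
      | succ m ih =>
        rw [pow_succ, pow_mul, map_pow, pow_succ θ]
        refine abs_pow_sub_pow_le hv ?_ (hpow1 c _ hc) hqθ ih ?_
        · rw [extAbs_algEquiv]; exact hpow1 c _ hc
        · exact pow_le_of_le_one hθ0 hθ1.le (Nat.succ_ne_zero m)
    exact (key n).trans ((pow_le_pow_of_le_one hθ0 hθ1.le (Nat.le_succ n)).trans hn.le)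

end Trace

/-- A sum over a group as a sum over representatives of the cosets of a subgroup. -/
lemma sum_eq_sum_quotient {G M : Type*} [Group G] [Fintype G] [AddCommMonoid M] (H : Subgroup G)
    [Fintype H] [Fintype (G ⧸ H)] (f : G → M) :
    ∑ g, f g = ∑ q : G ⧸ H, ∑ h : H, f (q.out * h) := by
  rw [← Fintype.sum_prod_type' (f := fun (q : G ⧸ H) (h : H) => f (q.out * h))]
  refine (Fintype.sum_bijective (fun x : (G ⧸ H) × H => x.1.out * x.2) ⟨?_, ?_⟩ _ _
    fun _ => rfl).symm
  · rintro ⟨q, h⟩ ⟨q', h'⟩ e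
    have h1 : q = q' := by
      have := congrArg (QuotientGroup.mk (s := H)) e
      simpa [QuotientGroup.mk_mul_of_mem] using this
    subst h1
    exact Prod.ext rfl (Subtype.ext (mul_left_cancel e))
  · intro g
    refine ⟨(QuotientGroup.mk g, ⟨(QuotientGroup.mk g : G ⧸ H).out⁻¹ * g, ?_⟩), ?_⟩
    · rw [← QuotientGroup.eq, QuotientGroup.out_eq']
    · simp

section Trace

variable {k F : Type*} [NontriviallyNormedField k] [IsUltrametricDist k] [CompleteSpace k]
  [LocallyCompactSpace k] [Field F] [Algebra k F] [FiniteDimensional k F] [IsGalois k F]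

/-- An element lies in the codifferent if and only if its multiples have integral traces down to the
inertia field. -/
lemma memCodiff_iff_inertia {π : F} (hπ : IsUnif (extAbs k F) π) [Fintype (lowerRam k F 0)] (y : F) :
    MemCodiff k y ↔ ∀ z, extAbs k F z ≤ 1 →
      extAbs k F (∑ σ : lowerRam k F 0, (σ : Gal(F/k)) (y * z)) ≤ 1 := by
  classical
  have hv := isNonarchimedean_extAbs k F
  let := Fintype.ofFinite (Gal(F/k) ⧸ lowerRam k F 0)
  have htr : ∀ x : F, algebraMap k F (Algebra.trace k F x) =
      ∑ q : Gal(F/k) ⧸ lowerRam k F 0, q.out (∑ σ : lowerRam k F 0, (σ : Gal(F/k)) x) := fun x => by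
    rw [trace_eq_sum_automorphisms, sum_eq_sum_quotient (lowerRam k F 0)]
    exact Finset.sum_congr rfl fun q _ => (map_sum q.out _ _).symm
  constructor
  · intro hy z hz
    set T := ∑ σ : lowerRam k F 0, (σ : Gal(F/k)) (y * z)
    obtain ⟨N, hN⟩ := exists_pow_almost_fixed hπ
      (ε := (extAbs k F y + 1)⁻¹) (inv_pos.2 (by linarith [(extAbs k F).nonneg y]))
    have hε : (extAbs k F y + 1)⁻¹ * extAbs k F y ≤ 1 := by
      rw [inv_mul_le_one₀ (by linarith [(extAbs k F).nonneg y])]; linarith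
    let A : Submonoid F :=
      { carrier := {a | extAbs k F a ≤ 1}
        one_mem' := by simp
        mul_mem' := fun {a b} ha hb => by
          change extAbs k F (a * b) ≤ 1
          rw [map_mul]; exact mul_le_one₀ ha ((extAbs k F).nonneg _) hb }
    -- apply the independence statement to the maps `c ↦ q (c ^ N)`, which are almost independent of
    -- the choice of the representative of the coset `q`
    obtain ⟨a, ha⟩ := exists_le_abs_sum hv (A := A)
      (fun q : Gal(F/k) ⧸ lowerRam k F 0 =>
        ((q.out : F →* F).comp (powMonoidHom N)).comp A.subtype)
      (fun q a => by
        change extAbs k F (q.out ((a : F) ^ N)) ≤ 1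
        rw [extAbs_algEquiv, map_pow]
        exact pow_le_one₀ ((extAbs k F).nonneg _) a.2)
      (fun q q' hqq => by
        -- otherwise `q` and `q'` would agree modulo inertia
        by_contra! hc
        refine hqq ?_
        rw [← QuotientGroup.out_eq' q, ← QuotientGroup.out_eq' q', eq_comm, QuotientGroup.eq,
          mem_lowerRam_zero_iff]
        intro x hx
        have h1 : extAbs k F (q.out (x ^ N) - q'.out (x ^ N)) < 1 := hc ⟨x, hx⟩
        have h2 := (hN x hx).1
        have h3 : extAbs k F (q.out x - q'.out x) < 1 := by
          have e : q.out x - q'.out x = (q.out (x ^ N) - q'.out (x ^ N)) -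
            (q.out (x ^ N - x) - q'.out (x ^ N - x)) := by rw [map_sub, map_sub]; ring
          rw [e]
          refine (nonarch_sub_le hv _ _).trans_lt (max_lt h1 ((nonarch_sub_le hv _ _).trans_lt ?_))
          rw [extAbs_algEquiv, extAbs_algEquiv, max_self]
          exact h2
        rw [← extAbs_algEquiv q'.out⁻¹, map_sub] at h3
        rw [AlgEquiv.mul_apply]
        convert h3 using 3
        rw [← AlgEquiv.mul_apply, inv_mul_cancel, AlgEquiv.one_apply])
      (fun q => q.out T) (QuotientGroup.mk 1)
    rw [extAbs_algEquiv] at ha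
    refine ha.trans ?_
    -- the sum is the trace of `a ^ N * y * z`, up to an integral error
    have e : ∑ q : Gal(F/k) ⧸ lowerRam k F 0,
        (((q.out : F →* F).comp (powMonoidHom N)).comp A.subtype) a * q.out T =
        algebraMap k F (Algebra.trace k F (y * ((a : F) ^ N * z))) -
        ∑ q : Gal(F/k) ⧸ lowerRam k F 0, q.out (∑ σ : lowerRam k F 0,
          ((σ : Gal(F/k)) ((a : F) ^ N) - (a : F) ^ N) * (σ : Gal(F/k)) (y * z)) := by
      rw [htr, ← Finset.sum_sub_distrib]
      refine Finset.sum_congr rfl fun q _ => ?_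
      rw [← map_sub, ← Finset.sum_sub_distrib]
      change q.out ((a : F) ^ N) * q.out T = _
      rw [← map_mul, Finset.mul_sum]
      congr 1
      refine Finset.sum_congr rfl fun σ _ => ?_
      simp only [map_mul]
      ring
    have haN : extAbs k F ((a : F) ^ N) ≤ 1 := by
      rw [map_pow]; exact pow_le_one₀ ((extAbs k F).nonneg _) a.2
    rw [e]
    refine (nonarch_sub_le hv _ _).trans (max_le ?_ ?_)
    · rw [extAbs_algebraMap]
      refine hy _ ?_
      rw [map_mul]
      exact mul_le_one₀ haN ((extAbs k F).nonneg _) hz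
    · refine nonarch_sum_le hv _ _ zero_le_one fun q _ => ?_
      rw [extAbs_algEquiv]
      refine nonarch_sum_le hv _ _ zero_le_one fun σ _ => ?_
      rw [map_mul, extAbs_algEquiv, map_mul]
      refine le_trans (mul_le_mul ((hN a a.2).2 σ σ.2)
        (mul_le_of_le_one_right ((extAbs k F).nonneg _) hz) ?_ ?_) hε
      · exact mul_nonneg ((extAbs k F).nonneg _) ((extAbs k F).nonneg _)
      · exact inv_nonneg.2 (by linarith [(extAbs k F).nonneg y])
  · intro h z hz
    rw [← extAbs_algebraMap (F := F), htr]
    refine nonarch_sum_le hv _ _ zero_le_one fun q _ => ?_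
    rw [extAbs_algEquiv]
    exact h z hz

end Trace

/-! ### Different and discriminant under unramified base change -/

section DifferentBaseChange

namespace IsUnrBaseChange

variable {K E K' E' : Type*} [NontriviallyNormedField K] [IsUltrametricDist K]
    [CompleteSpace K] [LocallyCompactSpace K] [Field E] [Algebra K E] [FiniteDimensional K E]
    [IsGalois K E] [NontriviallyNormedField K'] [IsUltrametricDist K'] [CompleteSpace K'] [Field E']
    [Algebra K' E'] [FiniteDimensional K' E'] [IsGalois K' E'] [Algebra K K'] [Algebra E E']
    [Algebra K E'] [IsScalarTower K E E'] [IsScalarTower K K' E'] (h : IsUnrBaseChange K E K' E')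
include h

omit [LocallyCompactSpace K] [FiniteDimensional K E] in
/-- The trace of `E' / K'` is, on `E`, the sum over the inertia group. -/
lemma algebraMap_sum_inertia [Fintype (lowerRam K E 0)] (x : E) :
    algebraMap E E' (∑ σ : lowerRam K E 0, (σ : Gal(E/K)) x) =
      algebraMap K' E' (Algebra.trace K' E' (algebraMap E E' x)) := by
  rw [trace_eq_sum_automorphisms, map_sum]
  refine (Fintype.sum_bijective (fun s : Gal(E'/K') =>
    (⟨baseChangeRes K E K' E' s, h.range_eq ▸ ⟨s, rfl⟩⟩ : lowerRam K E 0)) ⟨?_, ?_⟩ _ _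
    fun s => (algebraMap_baseChangeRes s x).symm).symm
  · intro s t hst
    exact baseChangeRes_injective h.adjoin (congrArg Subtype.val hst)
  · rintro ⟨σ, hσ⟩
    rw [← h.range_eq] at hσ
    obtain ⟨s, hs⟩ := hσ
    exact ⟨s, Subtype.ext hs⟩

omit [LocallyCompactSpace K] [FiniteDimensional K E] in
lemma card_lowerRam_zero : Nat.card (lowerRam K E 0) = Module.finrank K' E' := by
  rw [← IsGalois.card_aut_eq_finrank, ← h.range_eq]
  exact (Nat.card_congr (MonoidHom.ofInjective (baseChangeRes_injective h.adjoin)).toEquiv).symm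

variable {π : E} (hπ : IsUnif (extAbs K E) π) (hπ' : IsUnif (extAbs K' E') (algebraMap E E' π))
include hπ hπ'

/-- The codifferents correspond: by `memCodiff_iff_inertia` and `algebraMap_sum_inertia` the
condition on `y` is integrality of the traces of `E' / K'` on `y` times the integers of `E`, and these
integers together with `K'` generate a dense part of the integers of `E'`. -/
lemma memCodiff_iff (y : E) : MemCodiff K y ↔ MemCodiff K' (algebraMap E E' y) := by
  classical
  have := Fintype.ofFinite (lowerRam K E 0)
  rw [memCodiff_iff_inertia hπ]
  have hT : ∀ x : E, extAbs K E (∑ σ : lowerRam K E 0, (σ : Gal(E/K)) x) =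
      ‖Algebra.trace K' E' (algebraMap E E' x)‖ := fun x => by
    rw [← h.extAbs_algebraMap, h.algebraMap_sum_inertia, LieTower.extAbs_algebraMap]
  have hT' : ∀ z, extAbs K E (∑ σ : lowerRam K E 0, (σ : Gal(E/K)) (y * z)) =
      ‖Algebra.trace K' E' (algebraMap E E' y * algebraMap E E' z)‖ := fun z => by rw [hT, map_mul]
  simp only [hT']
  constructor
  · -- integers of `E'` are approximated by polynomials in `π` with coefficients in `K'`
    intro hy z hz
    have hv := isNonarchimedean_extAbs K' E'
    have hsum : ∀ x : E', ‖Algebra.trace K' E' x‖ ≤ extAbs K' E' x := fun x => by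
      rw [← LieTower.extAbs_algebraMap (F := E'), trace_eq_sum_automorphisms]
      exact nonarch_sum_le hv _ _ ((extAbs K' E').nonneg _) fun σ _ => (extAbs_algEquiv σ x).le
    obtain ⟨n, hn⟩ := exists_pow_lt_of_lt_one
      (inv_pos.2 (by linarith [(extAbs K' E').nonneg (algebraMap E E' y)] :
        0 < extAbs K' E' (algebraMap E E' y) + 1)) hπ'.lt_one
    obtain ⟨g, hg, hgz⟩ := exists_poly_approx hv hπ' (algebraMap K' E').range
      h.res.exists_mem_range hz n
    have e : algebraMap E E' y * z = algebraMap E E' y * (z - g.eval (algebraMap E E' π)) +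
        algebraMap E E' y * g.eval (algebraMap E E' π) := by ring
    rw [e, map_add]
    refine (IsUltrametricDist.norm_add_le_max _ _).trans (max_le ((hsum _).trans ?_) ?_)
    · rw [map_mul]
      have h0 := (extAbs K' E').nonneg (algebraMap E E' y)
      have h1 := hgz.trans hn.le
      calc _ ≤ extAbs K' E' (algebraMap E E' y) * (extAbs K' E' (algebraMap E E' y) + 1)⁻¹ :=
            mul_le_mul_of_nonneg_left h1 h0
        _ ≤ 1 := by rw [← div_eq_mul_inv, div_le_one (by linarith)]; linarith
    · rw [Polynomial.eval_eq_sum_range, Finset.mul_sum, map_sum]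
      refine IsUltrametricDist.norm_sum_le_of_forall_le_of_nonneg zero_le_one fun i _ => ?_
      obtain ⟨⟨a, ha⟩, ha1⟩ := hg i
      rw [← ha] at ha1 ⊢
      rw [LieTower.extAbs_algebraMap] at ha1
      have e2 : algebraMap E E' y * (algebraMap K' E' a * algebraMap E E' π ^ i) =
          a • (algebraMap E E' y * algebraMap E E' (π ^ i)) := by
        rw [Algebra.smul_def, map_pow]; ring
      rw [e2, map_smul, smul_eq_mul, norm_mul]
      refine mul_le_one₀ ha1 (norm_nonneg _) (hy _ ?_)
      rw [map_pow]
      exact pow_le_one₀ hπ.pos.le hπ.lt_one.le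
  · intro hy z hz
    exact hy _ (by rwa [h.extAbs_algebraMap])

/-- The different is compatible with unramified base change, and the discriminant exponents differ by
the factor by which the degrees differ. -/
theorem idealVal_different_discriminant {ϖ : K} (hϖ : IsUnif (extAbs K K) ϖ)
    (hϖ' : IsUnif (extAbs K' K') (algebraMap K K' ϖ)) :
    (∃ d : ℕ, idealVal (different K E) = d ∧ idealVal (different K' E') = d) ∧
      ∃ n : ℕ, idealVal (discriminant K' E') = n ∧
        idealVal (discriminant K E) = ((lowerRam K E 0).index * n : ℕ) := by
  obtain ⟨d, hd⟩ := exists_memCodiff_iff hπ'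
  have hd' : ∀ y : E, MemCodiff K y ↔ extAbs K E y * extAbs K E π ^ d ≤ 1 := fun y => by
    rw [h.memCodiff_iff hπ hπ', hd, h.extAbs_algebraMap, h.extAbs_algebraMap]
  have hself : ∀ x : K', extAbs K' K' x = ‖x‖ := fun x => LieTower.extAbs_algebraMap (F := K') x
  have hn : ‖Algebra.norm K' (algebraMap E E' π)‖ =
      extAbs K E π ^ Module.finrank K' E' := by
    rw [← LieTower.extAbs_algebraMap (F := E'), Algebra.norm_eq_prod_automorphisms, map_prod]
    simp [extAbs_algEquiv, h.extAbs_algebraMap, ← IsGalois.card_aut_eq_finrank K' E',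
      Nat.card_eq_fintype_card]
  obtain ⟨f, hf⟩ := hϖ'.exists_pow (Algebra.norm_ne_zero_iff.2 hπ'.ne_zero)
    (by rw [hself, hn]; exact pow_le_one₀ hπ.pos.le hπ.lt_one.le)
  rw [hself, hself, hn] at hf
  refine ⟨⟨d, idealVal_different hπ hd', idealVal_different hπ' hd⟩, f * d,
    idealVal_discriminant hπ' hd hϖ' (by rw [h.extAbs_algebraMap, hf]), ?_⟩
  rw [idealVal_discriminant hπ hd' hϖ (f := (lowerRam K E 0).index * f), mul_assoc]
  rw [h.norm] at hf
  rw [pow_mul', ← hf, ← pow_mul, ← h.card_lowerRam_zero, Subgroup.card_mul_index,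
    IsGalois.card_aut_eq_finrank]

end IsUnrBaseChange

/-- The inertia index depends only on the isomorphism class of an extension. -/
lemma index_lowerRam_zero_algEquiv {K E F : Type*} [NontriviallyNormedField K] [IsUltrametricDist K]
    [CompleteSpace K] [Field E] [Algebra K E] [Algebra.IsAlgebraic K E] [Field F] [Algebra K F]
    [Algebra.IsAlgebraic K F] (e : E ≃ₐ[K] F) :
    (lowerRam K E 0).index = (lowerRam K F 0).index := by
  have h1 : lowerRam K E 0 = (lowerRam K F 0).comap (e.autCongr : Gal(E/K) →* Gal(F/K)) := by
    ext σ
    rw [Subgroup.mem_comap, mem_lowerRam_zero_iff, mem_lowerRam_zero_iff]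
    have key : ∀ y : E, extAbs K F ((e.autCongr : Gal(E/K) →* Gal(F/K)) σ (e y) - e y) =
        extAbs K E (σ y - y) := fun y => by
      change extAbs K F (e (σ (e.symm (e y))) - e y) = _
      rw [e.symm_apply_apply, ← map_sub, extAbs_algEquiv]
    constructor
    · intro h x hx
      obtain ⟨y, rfl⟩ := e.surjective x
      rw [key]
      exact h y (by rwa [extAbs_algEquiv] at hx)
    · intro h y hy
      rw [← key]
      exact h _ (by rwa [extAbs_algEquiv])
  rw [h1]
  exact Subgroup.index_comap_of_surjective _ e.autCongr.surjective

lemma index_lowerRam_zero_lift {K Ω : Type*} [NontriviallyNormedField K] [IsUltrametricDist K]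
    [CompleteSpace K] [Field Ω] [Algebra K Ω] [Algebra.IsAlgebraic K Ω] {L : IntermediateField K Ω}
    (E : IntermediateField K L) :
    (lowerRam K (IntermediateField.lift E) 0).index = (lowerRam K E 0).index :=
  (index_lowerRam_zero_algEquiv (IntermediateField.liftAlgEquiv E)).symm

end DifferentBaseChange

/-! ### Stability -/

section Stability

/-- Substitution of a shifted index into a polynomial in `i` and `p ^ i`. -/
lemma exists_eval_shift (p : ℕ) (hp : p ≠ 0) (k : ℕ) (f : MvPolynomial (Fin 2) ℚ) :
    ∃ g : MvPolynomial (Fin 2) ℚ, ∀ i : ℕ,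
      MvPolynomial.eval ![((k + i : ℕ) : ℚ), (p : ℚ) ^ (k + i)] g =
        MvPolynomial.eval ![(i : ℚ), (p : ℚ) ^ i] f := by
  refine ⟨MvPolynomial.bind₁ ![MvPolynomial.X 0 - MvPolynomial.C (k : ℚ),
    MvPolynomial.C ((p : ℚ) ^ k)⁻¹ * MvPolynomial.X 1] f, fun i => ?_⟩
  have hp' : (p : ℚ) ^ k ≠ 0 := pow_ne_zero _ (by exact_mod_cast hp)
  rw [MvPolynomial.eval, MvPolynomial.eval₂Hom_bind₁]
  congr 2
  funext j
  fin_cases j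
  · simp
  · simp [pow_add, hp']

/-- If discriminant valuations differ by factors which are eventually constant or eventually
proportional to `p ^ i`, stability is preserved. -/
lemma IsStable.of_mul {p : ℕ} (hp : p ≠ 0) (k : ℕ) (c : ℕ → ℕ)
    (hc : (∀ i, k ≤ i → c i = c k) ∨ ∀ i, k ≤ i → c i = c k * p ^ (i - k))
    {K K' F F' : Type*} [NormedField K] [IsUltrametricDist K] [Field F] [Algebra K F]
    [NormedField K'] [IsUltrametricDist K'] [Field F'] [Algebra K' F']
    {T : ℕ → IntermediateField K F} {T' : ℕ → IntermediateField K' F'}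
    (hT : ∀ i, ∃ n : ℕ, idealVal (discriminant K' (T' i)) = n ∧
      idealVal (discriminant K (T i)) = (c i * n : ℕ))
    (h : IsStable K' p (fun i => T' (k + i))) : IsStable K p T := by
  obtain ⟨f, hf⟩ := h
  obtain ⟨g, hg⟩ : ∃ g : MvPolynomial (Fin 2) ℚ, ∀ i : ℕ,
      MvPolynomial.eval ![((k + i : ℕ) : ℚ), (p : ℚ) ^ (k + i)] g =
        c (k + i) * MvPolynomial.eval ![(i : ℚ), (p : ℚ) ^ i] f := by
    rcases hc with hc | hc
    · obtain ⟨g, hg⟩ := exists_eval_shift p hp k (MvPolynomial.C (c k : ℚ) * f)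
      refine ⟨g, fun i => ?_⟩
      rw [hg, hc (k + i) (Nat.le_add_right k i)]
      simp
    · obtain ⟨g, hg⟩ := exists_eval_shift p hp k
        (MvPolynomial.C (c k : ℚ) * MvPolynomial.X 1 * f)
      refine ⟨g, fun i => ?_⟩
      rw [hg, hc (k + i) (Nat.le_add_right k i)]
      simp
  obtain ⟨m, hm⟩ := eventually_atTop.1 hf
  refine ⟨g, eventually_atTop.2 ⟨k + m, fun j hj => ?_⟩⟩
  obtain ⟨i, rfl⟩ := Nat.exists_eq_add_of_le (show k ≤ j by omega)
  obtain ⟨n, hn, hnf⟩ := hm i (by omega)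
  obtain ⟨n', hn', hd⟩ := hT (k + i)
  have : n' = n := by
    have := hn'.symm.trans hn
    exact_mod_cast this
  subst this
  refine ⟨_, hd, ?_⟩
  rw [hg, ← hnf, Nat.cast_mul]

end Stability

end LieTower

end

theorem proposition4 (p : ℕ) [Fact p.Prime]
    -- `K` is a nonarchimedean local field of characteristic `0` and residue characteristic `p`
    (K : Type*) [NontriviallyNormedField K] [IsUltrametricDist K] [LocallyCompactSpace K]
    [CharZero K] (hp : ‖(p : K)‖ < 1)
    -- `Ω` is an algebraic closure of `K`, with the extended absolute value
    (Ω : Type*) [NormedField Ω] [NormedAlgebra K Ω] [IsAlgClosure K Ω]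
    (L : IntermediateField K Ω) [IsGalois K L]
    (Γ : ℕ → Subgroup Gal(L/K)) (hΓ : IsLieFiltration p Γ) :
    -- the `K(i)' / K'` are finite, Galois and totally ramified, and `L' / K'` is Galois
    (∀ i, FiniteDimensional (unrHat K Ω) (extHat (tower Γ i)) ∧
      IsGalois (unrHat K Ω) (extHat (tower Γ i)) ∧
      lowerRam (unrHat K Ω) (extHat (tower Γ i)) 0 = ⊤) ∧
    IsGalois (unrHat K Ω) (towerHat (tower Γ)) ∧
    -- `G^0` and `G'` are isomorphic with their upper ramification groups
    (∃ φ : upperRam K L 0 ≃ₜ* Gal(towerHat (tower Γ)/unrHat K Ω),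
      ∀ v : ℝ, -1 ≤ v → upperRam (unrHat K Ω) (towerHat (tower Γ)) v =
        ((upperRam K L v).subgroupOf (upperRam K L 0)).map φ.toMulEquiv.toMonoidHom) ∧
    IsPadicLieGroup Gal(towerHat (tower Γ)/unrHat K Ω) p ∧
    -- the differents of `K(i) / K` and `K(i)' / K'` have the same valuation
    (∀ i, ∃ n : ℕ, idealVal (different K (tower Γ i)) = n ∧
      idealVal (different (unrHat K Ω) (extHat (tower Γ i))) = n) ∧
    -- the `K(k + i)'` form a Lie tower, and stability descends from it
    ∃ k : ℕ,
      IsLieFiltration p (fun i => (stepHat (tower Γ) (k + i)).fixingSubgroup) ∧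
      IsPadicLieTower p (fun i => stepHat (tower Γ) (k + i)) ∧
      (IsStable (unrHat K Ω) p (fun i => extHat (tower Γ (k + i))) →
        IsStable K p (tower Γ)) := by
  have : ProperSpace K := ProperSpace.of_locallyCompactSpace K
  have hP : IsPowFiltration p Γ := by
    obtain ⟨H, hHo, hHn, hH, hΓ⟩ := hΓ
    rw [show Γ = fun i => powSubgroup H (p ^ i) from funext hΓ]
    exact hH.isPowFiltration hHo hHn
  let : Algebra L (towerHat (tower Γ)) := algebraTowerHat hP
  have hcoe : ∀ x : L, (algebraMap L (towerHat (tower Γ)) x : UniformSpace.Completion Ω) =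
    ((x : Ω) : UniformSpace.Completion Ω) := fun _ => rfl
  have := isScalarTower_towerHat hcoe
  have hgal := isGalois_towerHat hP hcoe
  have hT := isUnrTower_towerHat hP hcoe
  have hfin := hP.finiteDimensional_tower
  have hgalT := hP.isGalois_tower
  have hfin' := fun i => finiteDimensional_extHat (tower Γ i)
  have hgal' := fun i => isGalois_extHat (tower Γ i)
  have halg := fun i => isAlgebraic_of_isGalois (unrHat K Ω) (extHat (tower Γ i))
  have hbase := fun i => isUnrBaseChange_extHat (tower Γ i)
  obtain ⟨ϖ, hϖ, hϖ'⟩ := exists_isUnif_unrHat K Ω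
  choose π hπ using fun i => exists_isUnif (F := tower Γ i) hϖ
  have hdd := fun i => (hbase i).idealVal_different_discriminant (hπ i)
    (isUnif_extHat (tower Γ i) (hπ i)) hϖ hϖ'
  obtain ⟨k, hk, hidx⟩ := hT.exists_isPowFiltration hP
  have hstep : ∀ i, (stepHat (tower Γ) i).fixingSubgroup =
      (Γ i).comap (baseChangeRes K L (unrHat K Ω) (towerHat (tower Γ))) := fun i => by
    rw [← genField_eq_stepHat hP hcoe, fixingSubgroup_genField,
      InfiniteGalois.fixingSubgroup_fixedField ⟨Γ i, (Γ i).isClosed_of_isOpen (hP.isOpen i)⟩]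
  have hlie : IsLieFiltration p (fun i => (stepHat (tower Γ) (k + i)).fixingSubgroup) := by
    simp only [hstep]
    exact hk.isLieFiltration
  have hindex : ∀ i, (lowerRam K (tower Γ i) 0).index = (upperRam K L 0 ⊔ Γ i).index := fun i => by
    have := finiteDimensional_fixedField (hP.isOpen i)
    have := isGalois_fixedField (hP.isOpen i) (hP.normal i)
    refine (index_lowerRam_zero_lift (IntermediateField.fixedField (Γ i))).trans ?_
    rw [← Subgroup.index_comap_of_surjective _
        (AlgEquiv.restrictNormalHom_surjective (F := K) (K₁ := IntermediateField.fixedField (Γ i)) L)]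
    congr 1
    ext σ
    rw [Subgroup.mem_comap, hT.mem_sup (hP.isOpen i) (hP.normal i)]
  refine ⟨fun i => ⟨hfin' i, hgal' i, (hbase i).res.lowerRam_zero⟩, hgal, hT.exists_equiv, ?_,
    fun i => (hdd i).1, k, hlie, ?_, ?_⟩
  · obtain ⟨H, hHo, -, hH, -⟩ := hlie
    exact ⟨H, hHo, hH⟩
  · exact ⟨_, hlie, fun i => (InfiniteGalois.fixedField_fixingSubgroup _).symm⟩
  · simp only [← hindex] at hidx
    exact IsStable.of_mul (K := K) (K' := unrHat K Ω) (T := tower Γ)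
      (T' := fun i => extHat (tower Γ i)) (Nat.Prime.ne_zero Fact.out) k
      (fun i => (lowerRam K (tower Γ i) 0).index) hidx (fun i => (hdd i).2)
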